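/- Let $N\in\{1,2\}$, let $\eta\ge 1$ and $q$ be integers with $q>\frac N2$ and $q\ge\eta$, let $\lambda\in\mathbb R$ and $\psi_0\in H^q(\mathbb R^N)$ (complex-valued). For $T>0$, a mild solution on $[0,T]$ of $$ i\partial_t\psi+\Delta\psi=\lambda|\psi|^{2\eta}\psi\ \text{ in }\mathbb R^N,\qquad \psi(\cdot,0)=\psi_0, \tag{NLS}$$ is a $\psi\in L^\infty((0,T);H^q(\mathbb R^N))$, defined for every $t\in[0,T]$, such that $$\psi(t)=e^{it\Delta}\psi_0-i\lambda\int_0^t e^{i(t-\nu)\Delta}\big(|\psi(\nu)|^{2\eta}\psi(\nu)\big)\,d\nu\qquad\text{for all }t\in[0,T].$$ (i) There are $T>0$ and a mild solution of (NLS) on $[0,T]$, which moreover belongs to $C([0,T];H^q(\mathbb R^N))$. For every $T>0$ there is at most one mild solution of (NLS) on $[0,T]$. (ii) Assume in addition that $\eta N=2$ and that $x\psi_0\in L^2(\mathbb R^N)$. Let $T>0$ and let $\psi$ be a mild solution of (NLS) on $[0,T]$; take $\psi(\cdot,t)$ to be the continuous representative for each $t$. Then there is a function $\mathcal H:\mathbb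 R^N\times[0,T]\to\mathbb R$ such that for almost every $x\in\mathbb R^N$ $$\mathcal H(x,0)=0,\qquad \partial_t\mathcal H(x,t)=t|\psi(x,t)|^2\quad\text{for all }t\in[0,T]$$ (with one-sided derivatives at the end points), and for every such $\mathcal H$ all the terms of $$\mathbb P[\psi](t)=\big\|(x+2it\nabla)\psi(\cdot,t)\big\|_{L^2(\mathbb R^N)}^2+\frac{4t^2\lambda N}{N+2}\int_{\mathbb R^N}|\psi(x,t)|^{\frac4N+2}\,dx-2N\int_{\mathbb R^N}\mathrm{div}\big(\nabla\mathcal H(x,t)\big)\,dx$$ (with weak spatial derivatives) exist and are finite for every $t\in[0,T]$, and $$\mathbb P[\psi](t)=\mathbb P[\psi](0)=\|x\psi_0\|_{L^2(\mathbb R^N)}^2\qquad\text{for all }t\in[0,T].$$ -/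

import Mathlib

open MeasureTheory Set FourierTransform TemperedDistribution
open scoped SchwartzMap ENNReal ContDiff

noncomputable section

/-- The Euclidean space `ℝ^N`. -/
abbrev RSpace (N : ℕ) : Type := EuclideanSpace ℝ (Fin N)

/-- The space `L²(ℝ^N; ℂ)`. -/
abbrev L2Space (N : ℕ) : Type := Lp ℂ 2 (volume : Measure (RSpace N))

/-- The symbol `ξ ↦ exp (- i t |2πξ|²)` of `e^{itΔ}`; Mathlib's Fourier transform is
`∫ f(x) e^{-2πi⟨x,ξ⟩} dx`, so that `Δ` has the symbol `-|2πξ|²`. -/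
def schrodingerSymbol (N : ℕ) (t : ℝ) (ξ : RSpace N) : ℂ :=
  Complex.exp (((-(t * (2 * Real.pi * ‖ξ‖) ^ 2) : ℝ) : ℂ) * Complex.I)

theorem schrodingerSymbol_memLp (N : ℕ) (t : ℝ) :
    MemLp (schrodingerSymbol N t) ∞ (volume : Measure (RSpace N)) := by
  refine memLp_top_of_bound (C := 1) ?_ ?_
  · unfold schrodingerSymbol
    exact Continuous.aestronglyMeasurable (by fun_prop)
  · filter_upwards with ξ
    exact (Complex.norm_exp_ofReal_mul_I _).le

/-- The free Schrödinger group `e^{itΔ}` on `L²(ℝ^N)`. -/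
def freePropagator {N : ℕ} (t : ℝ) (f : L2Space N) : L2Space N :=
  𝓕⁻ ((schrodingerSymbol_memLp N t).toLp (schrodingerSymbol N t) • (𝓕 f : L2Space N))

open Classical in
/-- The map `f ↦ |f|^{2η} f` with values in `L²`; the value is `0` if `|f|^{2η} f` is not
square integrable (which never happens for `f ∈ H^q`, `q > N/2`). -/
def powerNonlinearity {N : ℕ} (η : ℕ) (f : L2Space N) : L2Space N :=
  if h : MemLp (fun x => ((‖f x‖ ^ (2 * η) : ℝ) : ℂ) * f x) 2 (volume : Measure (RSpace N))
  then h.toLp _ else 0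

/-- `ψ ∈ L^∞((0,T); H^q(ℝ^N))`. The Bessel potential of order `q`, i.e. multiplication of the
Fourier transform by `(1 + |ξ|²)^{q/2}`, is the isometry of `H^q` onto `L²` that defines `H^q`
and its norm, so it has to carry `ψ` to an element of `L^∞((0,T); L²)`. -/
def InLinftySobolev {N : ℕ} (q : ℕ) (T : ℝ) (ψ : ℝ → L2Space N) : Prop :=
  ∃ G : ℝ → L2Space N, MemLp G ∞ (volume.restrict (Ioo 0 T)) ∧
    ∀ᵐ t ∂(volume.restrict (Ioo 0 T)),
      besselPotential (RSpace N) ℂ (q : ℝ) (ψ t : 𝓢'(RSpace N, ℂ)) = (G t : 𝓢'(RSpace N, ℂ))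

/-- `ψ ∈ C([0,T]; H^q(ℝ^N))`. -/
def InCSobolev {N : ℕ} (q : ℕ) (T : ℝ) (ψ : ℝ → L2Space N) : Prop :=
  ∃ G : ℝ → L2Space N, ContinuousOn G (Icc 0 T) ∧
    ∀ t ∈ Icc 0 T,
      besselPotential (RSpace N) ℂ (q : ℝ) (ψ t : 𝓢'(RSpace N, ℂ)) = (G t : 𝓢'(RSpace N, ℂ))

/-- `ψ` is a mild solution on `[0,T]`, of class `L^∞((0,T); H^q)`, of
`i ∂ₜψ + Δψ = λ |ψ|^{2η} ψ`, `ψ(0) = ψ₀`. Only the values `ψ t`, `t ∈ [0,T]`, matter. -/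
structure IsMildSolution {N : ℕ} (η q : ℕ) (lam : ℝ) (ψ₀ : L2Space N) (T : ℝ)
    (ψ : ℝ → L2Space N) : Prop where
  memLinfty : InLinftySobolev q T ψ
  integrable : ∀ t ∈ Icc 0 T, IntervalIntegrable
    (fun ν => freePropagator (t - ν) (powerNonlinearity η (ψ ν))) volume 0 t
  duhamel : ∀ t ∈ Icc 0 T, ψ t = freePropagator t ψ₀ -
    (Complex.I * (lam : ℂ)) •
      ∫ ν in (0 : ℝ)..t, freePropagator (t - ν) (powerNonlinearity η (ψ ν))

/-- `v` is the weak partial derivative `∂ᵢ u` on `ℝ^N`. -/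
def IsWeakPartial {N : ℕ} {F : Type*} [NormedAddCommGroup F] [NormedSpace ℝ F] (i : Fin N)
    (u v : RSpace N → F) : Prop :=
  LocallyIntegrable u ∧ LocallyIntegrable v ∧
    ∀ φ : RSpace N → ℝ, ContDiff ℝ ∞ φ → HasCompactSupport φ →
      ∫ x, (fderiv ℝ φ x (EuclideanSpace.single i 1)) • u x = - ∫ x, φ x • v x

open Classical in
/-- The weak partial derivative `∂ᵢ u` (unique up to null sets), and `0` if there is none. -/
def weakPartial {N : ℕ} {F : Type*} [NormedAddCommGroup F] [NormedSpace ℝ F] (i : Fin N)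
    (u : RSpace N → F) : RSpace N → F :=
  if h : ∃ v, IsWeakPartial i u v then h.choose else 0

/-- `div (∇ h)`, with weak derivatives. -/
def divGrad {N : ℕ} (h : RSpace N → ℝ) (x : RSpace N) : ℝ :=
  ∑ i, weakPartial i (weakPartial i h) x

/-- The vector field `(x + 2it∇) f`. -/
def pseudoConformalField {N : ℕ} (t : ℝ) (f : RSpace N → ℂ) (x : RSpace N) :
    EuclideanSpace ℂ (Fin N) :=
  WithLp.toLp 2 fun i =>
    ((x i : ℝ) : ℂ) * f x + 2 * Complex.I * (t : ℂ) * weakPartial i f x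

/-- The modified pseudo-conformal quantity at time `t`, where `f = ψ(·,t)` and `h = 𝓗(·,t)`. -/
def pseudoConformal {N : ℕ} (lam t : ℝ) (f : RSpace N → ℂ) (h : RSpace N → ℝ) : ℝ :=
  (∫ x, ‖pseudoConformalField t f x‖ ^ 2)
    + 4 * t ^ 2 * lam * N / (N + 2) * (∫ x, ‖f x‖ ^ (4 / (N : ℝ) + 2))
    - 2 * N * ∫ x, divGrad h x

/-- All the terms of the modified pseudo-conformal quantity make sense: the weak derivatives
exist and the integrals converge. -/
structure PseudoConformalDefined {N : ℕ} (t : ℝ) (f : RSpace N → ℂ) (h : RSpace N → ℝ) :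
    Prop where
  grad : ∀ i, ∃ v, IsWeakPartial i f v
  field : MemLp (pseudoConformalField t f) 2
  power : Integrable fun x => ‖f x‖ ^ (4 / (N : ℝ) + 2)
  gradH : ∀ i, ∃ v, IsWeakPartial i h v
  divGradH : ∀ i, ∃ w, IsWeakPartial i (weakPartial i h) w
  integrable : Integrable (divGrad h)

/-- `𝓗(x,0) = 0` and `∂ₜ𝓗(x,t) = t |ψ(x,t)|²` on `[0,T]`, for almost every `x`
(one-sided derivatives at the end points). The values `ψ(x,t)` are those of the continuous
representatives `φ t` of the `ψ t`. -/
def IsPhaseFunction {N : ℕ} (T : ℝ) (ψ : ℝ → L2Space N) (H : RSpace N → ℝ → ℝ) : Prop :=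
  ∃ φ : ℝ → RSpace N → ℂ,
    (∀ t ∈ Icc 0 T, Continuous (φ t) ∧ φ t =ᵐ[volume] ψ t) ∧
    ∀ᵐ x : RSpace N, H x 0 = 0 ∧
      ∀ t ∈ Icc 0 T, HasDerivWithinAt (H x) (t * ‖φ t x‖ ^ 2) (Icc 0 T) t

end

noncomputable section

open Filter Topology BoundedContinuousFunction

variable {N : ℕ}

/-! ### Dominated convergence in `L^p` -/

/-! A function of `H^q` is written as `ofCoord q A` with `A` in `L²`: up to the Sobolev weight, `A`
is its Fourier transform. In this coordinate the Schrödinger group is multiplication by a unimodular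
symbol. Since `q > N/2` makes the reciprocal weight square integrable, multiplication of functions
becomes a bounded bilinear map (`prodCoord`), and `|ψ|^{2η}ψ`, a polynomial in `ψ` and its
conjugate, is Lipschitz on balls. For `Y(t) = e^{-itΔ}ψ(t)` the equation is then an ordinary
differential equation in `L²`. Part (i) follows from Picard–Lindelöf and uniqueness for such
equations, once mild solutions are identified with solutions of the ODE
(`isMildSolution_of_interaction`, `IsMildSolution.exists_interaction`).

In part (ii) the term with `𝓗` contributes nothing. At each time `𝓗` is almost everywhere the time
integral of `s|ψ(s)|²`, so `∂ᵢ²𝓗` is the time integral of `s ∂ᵢ²|ψ(s)|²`. The latter is an `L¹`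
limit of difference quotients, and such a limit has integral zero (`IsPhaseFunction.derivatives`).
What remains is the classical pseudo-conformal law.

For that law, `2πi(xᵢ + 2it∂ᵢ)` is the generator of the boosts `e^{itΔ} e^{2πi b xᵢ} e^{-itΔ}`. A
boost is a unimodular factor times a translation (`coeFn_boost`), so it commutes with the gauge
invariant nonlinearity. Pulled back to `Y`, a boost is multiplication by a character that does not
depend on time. Therefore `‖(boost - 1)ψ‖²` can be differentiated in time with bounded operators
only. Gronwall shows that `‖(boost - 1)ψ‖` is `O(|b|)`, which propagates the first moment; dividing
its square by `b²` and letting `b → 0` gives an integral formula for `‖(xᵢ + 2it∂ᵢ)ψ‖²`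
(`integral_norm_conformalPart_sq`), with no cut-off of the weight and no approximation of the data.

The hypothesis `ηN = 2` forces `q ≥ 2`, so `ψ` is differentiable in time with values in `L²` and the
potential energy can be differentiated (`hasDerivWithinAt_integral_pow`). After integrations by
parts in space the two contributions cancel exactly because `ηN = 2` (`pseudoConformal_law`). -/

theorem tendsto_eLpNorm_zero_of_dominated {α ι F : Type*} [MeasurableSpace α] {μ : Measure α}
    [NormedAddCommGroup F] {l : Filter ι} [l.IsCountablyGenerated] {p : ℝ≥0∞} (hp0 : p ≠ 0)
    (hp : p ≠ ⊤) {f : ι → α → F} {bound : α → ℝ} (hb : MemLp bound p μ)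
    (hf : ∀ᶠ n in l, AEStronglyMeasurable (f n) μ)
    (hle : ∀ᶠ n in l, ∀ᵐ a ∂μ, ‖f n a‖ ≤ bound a)
    (hlim : ∀ᵐ a ∂μ, Tendsto (fun n => f n a) l (𝓝 0)) :
    Tendsto (fun n => eLpNorm (f n) p μ) l (𝓝 0) := by
  have hpos : 0 < p.toReal := ENNReal.toReal_pos hp0 hp
  have key : Tendsto (fun n => ∫⁻ a, ‖f n a‖ₑ ^ p.toReal ∂μ) l (𝓝 (∫⁻ _, 0 ∂μ)) := by
    refine tendsto_lintegral_filter_of_dominated_convergence'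
      (fun a => ‖bound a‖ₑ ^ p.toReal) ?_ ?_ ?_ ?_
    · filter_upwards [hf] with n hn using hn.enorm.pow_const _
    · filter_upwards [hle] with n hn
      filter_upwards [hn] with a ha
      gcongr
      rw [enorm_le_iff_norm_le]
      exact ha.trans (le_abs_self _)
    · exact ((eLpNorm_lt_top_iff_lintegral_rpow_enorm_lt_top hp0 hp).1 hb.2).ne
    · filter_upwards [hlim] with a ha
      have h1 : Tendsto (fun n => ‖f n a‖ₑ) l (𝓝 0) := by
        simpa [Function.comp_def] using (continuous_enorm.tendsto (0 : F)).comp ha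
      have := (ENNReal.continuous_rpow_const (y := p.toReal)).tendsto 0 |>.comp h1
      simpa [hpos, Function.comp_def] using this
  simp only [eLpNorm_eq_lintegral_rpow_enorm_toReal hp0 hp]
  have := (ENNReal.continuous_rpow_const (y := 1 / p.toReal)).tendsto _ |>.comp key
  simpa [hpos, Function.comp_def] using this

/-! ### Multiplication by bounded continuous functions on `L²` -/

/-- Multiplication by a bounded continuous function, on `L²`. -/
def bmul (m : RSpace N →ᵇ ℂ) : L2Space N →L[ℂ] L2Space N :=
  LinearMap.mkContinuous
    { toFun := fun f => (memLp_top_of_bound (μ := volume) m.continuous.aestronglyMeasurable ‖m‖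
        (ae_of_all _ m.norm_coe_le_norm)).toLp m • f
      map_add' := fun f g => Lp.add_smul _ _ _
      map_smul' := fun c f => by simpa using (Lp.smul_comm c _ f).symm } ‖m‖
    (fun f => by
      refine (Lp.norm_smul_le _ _).trans ?_
      gcongr
      refine (Lp.norm_toLp _ _).trans_le ?_
      refine ENNReal.toReal_le_of_le_ofReal (norm_nonneg _) ?_
      simpa using eLpNorm_le_of_ae_bound (p := ⊤) (ae_of_all _ m.norm_coe_le_norm))

theorem coeFn_bmul (m : RSpace N →ᵇ ℂ) (f : L2Space N) :
    bmul m f =ᵐ[volume] fun x => m x * f x := by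
  change (((memLp_top_of_bound (μ := volume) m.continuous.aestronglyMeasurable ‖m‖
    (ae_of_all _ m.norm_coe_le_norm)).toLp m • f : L2Space N) : _ → ℂ) =ᵐ[volume] _
  filter_upwards [Lp.coeFn_lpSMul (r := 2) ((memLp_top_of_bound (μ := volume)
    m.continuous.aestronglyMeasurable ‖m‖ (ae_of_all _ m.norm_coe_le_norm)).toLp m) f,
    MemLp.coeFn_toLp (memLp_top_of_bound (μ := volume)
    m.continuous.aestronglyMeasurable ‖m‖ (ae_of_all _ m.norm_coe_le_norm))] with x h1 h2
  rw [h1, Pi.smul_apply', h2, smul_eq_mul]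

theorem norm_bmul_le (m : RSpace N →ᵇ ℂ) (f : L2Space N) : ‖bmul m f‖ ≤ ‖m‖ * ‖f‖ :=
  ContinuousLinearMap.le_of_opNorm_le _ (LinearMap.mkContinuous_norm_le _ (norm_nonneg _) _) f

theorem bmul_bmul (m n : RSpace N →ᵇ ℂ) (f : L2Space N) :
    bmul m (bmul n f) = bmul (m * n) f := by
  apply Lp.ext
  filter_upwards [coeFn_bmul m (bmul n f), coeFn_bmul n f, coeFn_bmul (m * n) f] with x h1 h2 h3
  rw [h1, h2, h3, BoundedContinuousFunction.mul_apply, mul_assoc]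

theorem bmul_comm (m n : RSpace N →ᵇ ℂ) (f : L2Space N) :
    bmul m (bmul n f) = bmul n (bmul m f) := by
  rw [bmul_bmul, bmul_bmul, mul_comm]

theorem bmul_one (f : L2Space N) : bmul 1 f = f := by
  apply Lp.ext
  filter_upwards [coeFn_bmul 1 f] with x h1
  simp [h1]

theorem norm_bmul_of_norm_eq_one (m : RSpace N →ᵇ ℂ) (hm : ∀ x, ‖m x‖ = 1) (f : L2Space N) :
    ‖bmul m f‖ = ‖f‖ := by
  rw [Lp.norm_def, Lp.norm_def]
  congr 1
  apply eLpNorm_congr_norm_ae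
  filter_upwards [coeFn_bmul m f] with x hx
  rw [hx, norm_mul, hm, one_mul]

/-- Strong convergence of multiplication operators. -/
theorem tendsto_bmul {ι : Type*} {l : Filter ι} [l.IsCountablyGenerated]
    {m : ι → RSpace N →ᵇ ℂ} {m₀ : RSpace N →ᵇ ℂ} {C : ℝ} (hC : ∀ᶠ i in l, ∀ x, ‖m i x‖ ≤ C)
    (hm : ∀ x, Tendsto (fun i => m i x) l (𝓝 (m₀ x))) (f : L2Space N) :
    Tendsto (fun i => bmul (m i) f) l (𝓝 (bmul m₀ f)) := by
  rw [Lp.tendsto_Lp_iff_tendsto_eLpNorm']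
  have h : ∀ i, eLpNorm (⇑(bmul (m i) f) - ⇑(bmul m₀ f)) 2 volume
      = eLpNorm (fun x => (m i x - m₀ x) * f x) 2 volume := fun i => by
    apply eLpNorm_congr_ae
    filter_upwards [coeFn_bmul (m i) f, coeFn_bmul m₀ f] with x h1 h2
    rw [Pi.sub_apply, h1, h2, ← sub_mul]
  simp only [h]
  refine tendsto_eLpNorm_zero_of_dominated (by norm_num) (by norm_num)
    (bound := fun x => (C + ‖m₀‖) * ‖f x‖) ((Lp.memLp f).norm.const_mul _) ?_ ?_ ?_
  · exact Eventually.of_forall fun i =>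
      ((m i).continuous.sub m₀.continuous).aestronglyMeasurable.mul (Lp.aestronglyMeasurable _)
  · filter_upwards [hC] with i hi
    refine ae_of_all _ fun x => ?_
    rw [norm_mul]
    gcongr
    exact (norm_sub_le _ _).trans (add_le_add (hi x) (m₀.norm_coe_le_norm x))
  · refine ae_of_all _ fun x => ?_
    simpa using ((hm x).sub_const (m₀ x)).mul_const (f x)

/-! ### The Fourier transform on `L¹ ∩ L²` -/

/-- Both sides define the same distribution: tested against a Schwartz function, either transform
can be moved onto the test function. This gives access to the integral formula whenever the function
is also integrable. -/
theorem coeFn_fourierInv_toLp {a : RSpace N → ℂ} (h1 : Integrable a) (h2 : MemLp a 2) :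
    (𝓕⁻ (h2.toLp a) : L2Space N) =ᵐ[volume] 𝓕⁻ a := by
  have hcont : Continuous (𝓕⁻ a : RSpace N → ℂ) := by
    rw [← Real.Lp.fourierTransformInv_toLp (memLp_one_iff_integrable.2 h1)]
    exact BoundedContinuousFunction.continuous _
  apply ae_eq_of_integral_contDiff_smul_eq ((Lp.memLp _).locallyIntegrable (by norm_num))
    hcont.locallyIntegrable
  intro g hg hgc
  have hg₁ : HasCompactSupport (Complex.ofRealCLM ∘ g) := hgc.comp_left rfl
  have hg₂ : ContDiff ℝ ∞ (Complex.ofRealCLM ∘ g) := by fun_prop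
  set G : 𝓢(RSpace N, ℂ) := hg₁.toSchwartzMap hg₂ with hG
  have hGx : ∀ x, G x = (g x : ℂ) := fun x => rfl
  calc ∫ x, g x • (𝓕⁻ (h2.toLp a) : L2Space N) x
      = ((𝓕⁻ (h2.toLp a) : L2Space N) : 𝓢'(RSpace N, ℂ)) G := by
        rw [Lp.toTemperedDistribution_apply]
        simp [hGx]
    _ = ((h2.toLp a : L2Space N) : 𝓢'(RSpace N, ℂ)) (𝓕⁻ G) := by
        rw [← Lp.fourierInv_toTemperedDistribution_eq]; rfl
    _ = ∫ x, (𝓕⁻ (G : RSpace N → ℂ)) x • a x := by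
        rw [Lp.toTemperedDistribution_apply]
        apply integral_congr_ae
        filter_upwards [h2.coeFn_toLp] with x hx
        rw [hx, SchwartzMap.fourierInv_coe]
    _ = ∫ x, G x • (𝓕⁻ a) x := by
        -- The pairing `-⟨x,ξ⟩` turns the general self-adjointness identity into the one for the
        -- inverse transform; it is symmetric, so flipping it changes nothing.
        have := VectorFourier.integral_fourierIntegral_smul_eq_flip (μ := volume) (ν := volume)
          (L := -innerₗ (RSpace N)) Real.continuous_fourierChar (f := (G : RSpace N → ℂ)) (g := a)
          (by simp only [LinearMap.neg_apply, innerₗ_apply_apply]; fun_prop) G.integrable h1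
        have hf : (-innerₗ (RSpace N)).flip = -innerₗ (RSpace N) := by
          ext x y; simp [real_inner_comm]
        rw [hf] at this
        exact this
    _ = _ := by simp [hGx]

/-! ### Translations and modulations -/

theorem measurePreserving_add_const (a : RSpace N) :
    MeasurePreserving (fun x : RSpace N => x + a) volume volume :=
  measurePreserving_add_right volume a

/-- Translation `f ↦ f(· + a)` on `L²`. -/
def shiftL2 (a : RSpace N) : L2Space N →ₗᵢ[ℂ] L2Space N :=
  Lp.compMeasurePreservingₗᵢ ℂ (fun x : RSpace N => x + a) (measurePreserving_add_const a)

theorem coeFn_shiftL2 (a : RSpace N) (f : L2Space N) :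
    shiftL2 a f =ᵐ[volume] fun x => f (x + a) :=
  Lp.coeFn_compMeasurePreserving f (measurePreserving_add_const a)

/-- The character `ξ ↦ exp (2πi⟨ξ,a⟩)`. -/
def charB (a : RSpace N) : RSpace N →ᵇ ℂ :=
  BoundedContinuousFunction.ofNormedAddCommGroup
    (fun ξ => ((Real.fourierChar (inner ℝ ξ a) : Circle) : ℂ))
    (by have := Real.continuous_fourierChar; fun_prop) 1
    (fun ξ => (Circle.norm_coe _).le)

theorem charB_apply (a ξ : RSpace N) :
    charB a ξ = ((Real.fourierChar (inner ℝ ξ a) : Circle) : ℂ) := rfl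

theorem charB_apply' (a ξ : RSpace N) :
    charB a ξ = Complex.exp (2 * Real.pi * inner ℝ ξ a * Complex.I) := by
  rw [charB_apply, Real.fourierChar_apply]; push_cast; rfl

theorem norm_charB (a ξ : RSpace N) : ‖charB a ξ‖ = 1 := by
  exact Circle.norm_coe _

/-- A property of `L²` functions which is closed and holds for classes of Schwartz functions. -/
theorem L2_induction {p : L2Space N → Prop} (hc : IsClosed {f | p f})
    (h : ∀ (a : RSpace N → ℂ) (_ : Integrable a) (h2 : MemLp a 2), p (h2.toLp a))
    (f : L2Space N) : p f := by
  refine DenseRange.induction_on (p := p)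
    (SchwartzMap.denseRange_toLpCLM (E := RSpace N) (F := ℂ) (p := 2) (μ := volume)
      ENNReal.ofNat_ne_top) f hc fun g => ?_
  exact h g g.integrable (g.memLp 2)

/-- Both sides are continuous in `f`, so the integral formula on `L¹ ∩ L²` suffices, where the
character is absorbed into the exponential. The same density argument, with a change of variables,
gives the dual rule `bmul_charB_fourierInv`. -/
theorem fourierInv_bmul_charB (a : RSpace N) (f : L2Space N) :
    (𝓕⁻ (bmul (charB a) f) : L2Space N) = shiftL2 a (𝓕⁻ f) := by
  refine L2_induction (p := fun f => (𝓕⁻ (bmul (charB a) f) : L2Space N) = shiftL2 a (𝓕⁻ f))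
    (isClosed_eq ?_ ?_) ?_ f
  · exact (Lp.fourierTransformₗᵢ (RSpace N) ℂ).symm.continuous.comp (bmul (charB a)).continuous
  · exact (shiftL2 a).continuous.comp (Lp.fourierTransformₗᵢ (RSpace N) ℂ).symm.continuous
  · intro b h1 h2
    have hm : MemLp (fun ξ => charB a ξ * b ξ) 2 :=
      (MemLp.const_mul h2 1).congr_norm
        ((charB a).continuous.aestronglyMeasurable.mul h2.1)
        (ae_of_all _ fun x => by simp [norm_charB])
    have hi : Integrable (fun ξ => charB a ξ * b ξ) :=
      h1.congr' ((charB a).continuous.aestronglyMeasurable.mul h2.1)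
        (ae_of_all _ fun x => by simp [norm_charB])
    have he : bmul (charB a) (h2.toLp b) = hm.toLp _ := by
      apply Lp.ext
      filter_upwards [coeFn_bmul (charB a) (h2.toLp b), hm.coeFn_toLp, h2.coeFn_toLp]
        with x h3 h4 h5
      rw [h3, h4, h5]
    apply Lp.ext
    rw [he]
    filter_upwards [coeFn_fourierInv_toLp hi hm, coeFn_shiftL2 a (𝓕⁻ (h2.toLp b)),
      (measurePreserving_add_const a).quasiMeasurePreserving.ae (coeFn_fourierInv_toLp h1 h2)]
      with x h3 h4 h5
    rw [h3, h4, h5, Real.fourierInv_eq, Real.fourierInv_eq]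
    congr 1
    ext ξ
    rw [charB_apply, inner_add_right, AddChar.map_add_eq_mul, Circle.smul_def, Circle.smul_def,
      Circle.coe_mul, smul_eq_mul, smul_eq_mul]
    ring

theorem bmul_charB_fourierInv (a : RSpace N) (f : L2Space N) :
    bmul (charB a) (𝓕⁻ f : L2Space N) = 𝓕⁻ (shiftL2 (-a) f) := by
  refine L2_induction (p := fun f => bmul (charB a) (𝓕⁻ f : L2Space N) = 𝓕⁻ (shiftL2 (-a) f))
    (isClosed_eq ?_ ?_) ?_ f
  · exact (bmul (charB a)).continuous.comp (Lp.fourierTransformₗᵢ (RSpace N) ℂ).symm.continuous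
  · exact (Lp.fourierTransformₗᵢ (RSpace N) ℂ).symm.continuous.comp (shiftL2 (-a)).continuous
  · intro b h1 h2
    have hm : MemLp (fun ξ => b (ξ + -a)) 2 :=
      h2.comp_measurePreserving (measurePreserving_add_const (-a))
    have hi : Integrable (fun ξ => b (ξ + -a)) := h1.comp_add_right (-a)
    have he : shiftL2 (-a) (h2.toLp b) = hm.toLp _ := rfl
    apply Lp.ext
    rw [he]
    filter_upwards [coeFn_fourierInv_toLp hi hm, coeFn_bmul (charB a) (𝓕⁻ (h2.toLp b)),
      coeFn_fourierInv_toLp h1 h2] with x h3 h4 h5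
    rw [h3, h4, h5, Real.fourierInv_eq, Real.fourierInv_eq,
      ← integral_add_right_eq_self (fun ξ => Real.fourierChar (inner ℝ ξ x) • b (ξ + -a)) a,
      ← integral_const_mul]
    congr 1
    ext ξ
    rw [charB_apply, add_neg_cancel_right, inner_add_left, AddChar.map_add_eq_mul,
      Circle.smul_def, Circle.smul_def, Circle.coe_mul, smul_eq_mul, smul_eq_mul, real_inner_comm]
    ring

/-! ### The free Schrödinger group -/

/-- The symbol of `e^{itΔ}`, as a bounded continuous function. -/
def symB (N : ℕ) (t : ℝ) : RSpace N →ᵇ ℂ :=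
  BoundedContinuousFunction.ofNormedAddCommGroup (schrodingerSymbol N t)
    (by unfold schrodingerSymbol; fun_prop) 1
    (fun ξ => (Complex.norm_exp_ofReal_mul_I _).le)

theorem symB_apply (t : ℝ) (ξ : RSpace N) : symB N t ξ = schrodingerSymbol N t ξ := rfl

theorem norm_symB (t : ℝ) (ξ : RSpace N) : ‖symB N t ξ‖ = 1 :=
  Complex.norm_exp_ofReal_mul_I _

theorem symB_mul (s t : ℝ) : symB N s * symB N t = symB N (s + t) := by
  ext ξ
  simp only [BoundedContinuousFunction.mul_apply, symB_apply, schrodingerSymbol]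
  rw [← Complex.exp_add]
  congr 1
  push_cast
  ring

theorem symB_zero : symB N 0 = 1 := by
  ext ξ
  simp [symB_apply, schrodingerSymbol]

theorem bmul_symB_symB (s t : ℝ) (f : L2Space N) :
    bmul (symB N s) (bmul (symB N t) f) = bmul (symB N (s + t)) f := by
  rw [bmul_bmul, symB_mul]

theorem bmul_symB_zero (f : L2Space N) : bmul (symB N 0) f = f := by
  rw [symB_zero, bmul_one]

theorem norm_bmul_symB (t : ℝ) (f : L2Space N) : ‖bmul (symB N t) f‖ = ‖f‖ :=
  norm_bmul_of_norm_eq_one _ (norm_symB t) f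

theorem freePropagator_eq (t : ℝ) (f : L2Space N) :
    freePropagator t f = 𝓕⁻ (bmul (symB N t) (𝓕 f : L2Space N)) := rfl

theorem freePropagator_fourierInv (t : ℝ) (f : L2Space N) :
    freePropagator t (𝓕⁻ f : L2Space N) = 𝓕⁻ (bmul (symB N t) f) := by
  rw [freePropagator_eq, fourier_fourierInv_eq]

theorem tendsto_bmul_symB {t₀ : ℝ} (f : L2Space N) :
    Tendsto (fun t => bmul (symB N t) f) (𝓝 t₀) (𝓝 (bmul (symB N t₀) f)) := by
  refine tendsto_bmul (C := 1) (Eventually.of_forall fun t ξ => (norm_symB t ξ).le) ?_ f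
  intro ξ
  have : Continuous fun t => schrodingerSymbol N t ξ := by
    unfold schrodingerSymbol; fun_prop
  exact this.tendsto t₀

/-- Joint strong continuity of the Schrödinger symbols. -/
theorem Filter.Tendsto.bmul_symB {ι : Type*} {l : Filter ι} {s : ι → ℝ} {s₀ : ℝ}
    {f : ι → L2Space N} {f₀ : L2Space N} (hs : Tendsto s l (𝓝 s₀)) (hf : Tendsto f l (𝓝 f₀)) :
    Tendsto (fun i => bmul (symB N (s i)) (f i)) l (𝓝 (bmul (symB N s₀) f₀)) := by
  have h1 : Tendsto (fun i => bmul (symB N (s i)) (f i - f₀)) l (𝓝 0) := by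
    rw [tendsto_zero_iff_norm_tendsto_zero]
    simp only [norm_bmul_symB]
    simpa using (hf.sub_const f₀).norm
  have h2 := (tendsto_bmul_symB f₀).comp hs
  simpa [map_sub, Function.comp_def] using h1.add h2

theorem ContinuousOn.bmul_symB {X : Type*} [TopologicalSpace X] {S : Set X} {s : X → ℝ}
    {f : X → L2Space N} (hs : ContinuousOn s S) (hf : ContinuousOn f S) :
    ContinuousOn (fun x => bmul (symB N (s x)) (f x)) S :=
  fun x hx => (hs x hx).bmul_symB (hf x hx)

/-! ### Sobolev functions in Fourier coordinates -/

/-- The Sobolev weight `(1 + |ξ|²)^{q/2}`. -/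
def sobWeight (q : ℕ) (ξ : RSpace N) : ℝ := (1 + ‖ξ‖ ^ 2) ^ ((q : ℝ) / 2)

theorem sobWeight_pos (q : ℕ) (ξ : RSpace N) : 0 < sobWeight q ξ :=
  Real.rpow_pos_of_pos (by positivity) _

theorem one_le_sobWeight (q : ℕ) (ξ : RSpace N) : 1 ≤ sobWeight q ξ :=
  Real.one_le_rpow (by simp) (by positivity)

theorem continuous_sobWeight (q : ℕ) : Continuous (sobWeight q : RSpace N → ℝ) := by
  unfold sobWeight
  refine Continuous.rpow_const (by fun_prop) fun x => Or.inl (by positivity)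

/-- The reciprocal of the Sobolev weight, as a bounded continuous function. -/
def invWeight (N q : ℕ) : RSpace N →ᵇ ℂ :=
  BoundedContinuousFunction.ofNormedAddCommGroup (fun ξ => (((sobWeight q ξ)⁻¹ : ℝ) : ℂ))
    (Complex.continuous_ofReal.comp
      ((continuous_sobWeight q).inv₀ fun ξ => (sobWeight_pos q ξ).ne')) 1
    (fun ξ => by
      rw [Complex.norm_real, Real.norm_of_nonneg (inv_nonneg.2 (sobWeight_pos q ξ).le)]
      exact inv_le_one_of_one_le₀ (one_le_sobWeight q ξ))

theorem invWeight_apply (q : ℕ) (ξ : RSpace N) :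
    invWeight N q ξ = (((sobWeight q ξ)⁻¹ : ℝ) : ℂ) := rfl

theorem invWeight_ne_zero (q : ℕ) (ξ : RSpace N) : invWeight N q ξ ≠ 0 := by
  rw [invWeight_apply]
  exact_mod_cast inv_ne_zero (sobWeight_pos q ξ).ne'

theorem norm_invWeight (q : ℕ) (ξ : RSpace N) : ‖invWeight N q ξ‖ = (sobWeight q ξ)⁻¹ := by
  rw [invWeight_apply, Complex.norm_real,
    Real.norm_of_nonneg (inv_nonneg.2 (sobWeight_pos q ξ).le)]

/-- The function of `H^q` whose Fourier transform is `(1 + |ξ|²)^{-q/2} A`. -/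
def ofCoord (q : ℕ) : L2Space N →L[ℂ] L2Space N :=
  ((Lp.fourierTransformₗᵢ (RSpace N) ℂ).symm.toContinuousLinearEquiv :
    L2Space N →L[ℂ] L2Space N) ∘L bmul (invWeight N q)

theorem ofCoord_apply (q : ℕ) (A : L2Space N) :
    ofCoord q A = 𝓕⁻ (bmul (invWeight N q) A) := rfl

theorem bmul_invWeight_injective (q : ℕ) :
    Function.Injective (bmul (invWeight N q)) := by
  intro A B h
  apply Lp.ext
  have h1 := coeFn_bmul (invWeight N q) A
  rw [h] at h1
  filter_upwards [h1, coeFn_bmul (invWeight N q) B] with x h2 h3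
  exact mul_left_cancel₀ (invWeight_ne_zero q x) (h2.symm.trans h3)

theorem ofCoord_injective (q : ℕ) : Function.Injective (ofCoord q : L2Space N → L2Space N) :=
  (Lp.fourierTransformₗᵢ (RSpace N) ℂ).symm.injective.comp (bmul_invWeight_injective q)

theorem toTemperedDistribution_injective {f g : L2Space N}
    (h : (f : 𝓢'(RSpace N, ℂ)) = (g : 𝓢'(RSpace N, ℂ))) : f = g :=
  LinearMap.ker_eq_bot.1 (Lp.ker_toTemperedDistributionCLM_eq_bot (E := RSpace N) (F := ℂ)
    (μ := volume) (p := 2)) h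

/-- The Bessel potential of order `-q` inverts that of order `q` and acts as multiplication by
`invWeight`. This is the dictionary between the distributional definition of `H^q` and coordinates
in `L²`. -/
theorem besselPotential_eq_iff (q : ℕ) (f G : L2Space N) :
    besselPotential (RSpace N) ℂ (q : ℝ) (f : 𝓢'(RSpace N, ℂ)) = (G : 𝓢'(RSpace N, ℂ)) ↔
      f = ofCoord q (𝓕 G) := by
  rw [← besselPotential_neg_apply_eq_iff]
  have hw : (fun x : RSpace N => (((1 + ‖x‖ ^ 2) ^ (-(q : ℝ) / 2) : ℝ) : ℂ)) = invWeight N q := by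
    ext x
    rw [invWeight_apply, sobWeight, ← Real.rpow_neg (by positivity), neg_div]
  have hm : MemLp (invWeight N q) ⊤ (volume : Measure (RSpace N)) :=
    memLp_top_of_bound (invWeight N q).continuous.aestronglyMeasurable ‖invWeight N q‖
        (ae_of_all _ (invWeight N q).norm_coe_le_norm)
  have key : besselPotential (RSpace N) ℂ (-(q : ℝ)) (G : 𝓢'(RSpace N, ℂ))
      = (ofCoord q (𝓕 G) : L2Space N) := by
    have h2 : (bmul (invWeight N q) (𝓕 G) : L2Space N)
        = (hm.toLp (invWeight N q) • (𝓕 G : L2Space N) : L2Space N) := rfl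
    rw [ofCoord_apply, ← Lp.fourierInv_toTemperedDistribution_eq, besselPotential,
      fourierMultiplierCLM_apply, Lp.fourier_toTemperedDistribution_eq, h2,
      Lp.toTemperedDistribution_smul_eq (by rw [← hw]; fun_prop), hw]
  rw [key]
  exact ⟨fun h => (toTemperedDistribution_injective h).symm, fun h => by rw [h]⟩

theorem freePropagator_ofCoord (q : ℕ) (t : ℝ) (A : L2Space N) :
    freePropagator t (ofCoord q A) = ofCoord q (bmul (symB N t) A) := by
  rw [ofCoord_apply, freePropagator_fourierInv, bmul_comm, ofCoord_apply]

/-! ### The continuous representative -/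

/-- The square of the reciprocal weight is `(1 + |ξ|²)^{-q}`, which is integrable as `2q > N`.
Continuity of representatives and the algebra property both rest on this. -/
theorem memLp_two_invWeight {q : ℕ} (hq : (N : ℝ) / 2 < q) :
    MemLp (invWeight N q) 2 (volume : Measure (RSpace N)) := by
  rw [memLp_two_iff_integrable_sq_norm (invWeight N q).continuous.aestronglyMeasurable]
  have := integrable_rpow_neg_one_add_norm_sq (E := RSpace N) (μ := volume) (r := 2 * q)
    (by rw [finrank_euclideanSpace_fin]; linarith)
  refine this.congr (ae_of_all _ fun x => ?_)
  simp only [norm_invWeight, sobWeight]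
  rw [← Real.rpow_neg (by positivity), ← Real.rpow_mul_natCast (by positivity)]
  congr 1
  push_cast
  ring

/-- The continuous representative of `ofCoord q A`, for `q > N/2`. -/
def contRep {q : ℕ} (hq : (N : ℝ) / 2 < q) : L2Space N →L[ℂ] (RSpace N →ᵇ ℂ) :=
  Real.Lp.fourierTransformInvCLM (RSpace N) ℂ ∘L
    (ContinuousLinearMap.mul ℂ ℂ).holderL volume 2 2 1 ((memLp_two_invWeight hq).toLp _)

theorem integrable_invWeight_mul {q : ℕ} (hq : (N : ℝ) / 2 < q) (A : L2Space N) :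
    Integrable (fun ξ => invWeight N q ξ * A ξ) :=
  (memLp_two_invWeight hq).integrable_mul (Lp.memLp A)

theorem memLp_invWeight_mul (q : ℕ) (A : L2Space N) :
    MemLp (fun ξ => invWeight N q ξ * A ξ) 2 :=
  (memLp_congr_ae (coeFn_bmul _ A)).1 (Lp.memLp _)

theorem contRep_apply {q : ℕ} (hq : (N : ℝ) / 2 < q) (A : L2Space N) (x : RSpace N) :
    contRep hq A x = 𝓕⁻ (fun ξ => invWeight N q ξ * A ξ) x := by
  rw [contRep, ContinuousLinearMap.comp_apply, Real.Lp.fourierTransformInvCLM_apply,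
    Real.Lp.fourierTransformInv_apply]
  apply Real.fourierInv_congr_ae
  filter_upwards [ContinuousLinearMap.coeFn_holder (r := 1) (ContinuousLinearMap.mul ℂ ℂ)
    ((memLp_two_invWeight hq).toLp _) A, (memLp_two_invWeight hq).coeFn_toLp] with ξ h1 h2
  rw [ContinuousLinearMap.holderL_apply_apply, h1, h2]
  rfl

theorem coeFn_ofCoord {q : ℕ} (hq : (N : ℝ) / 2 < q) (A : L2Space N) :
    ofCoord q A =ᵐ[volume] contRep hq A := by
  have h : bmul (invWeight N q) A = (memLp_invWeight_mul q A).toLp _ := by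
    apply Lp.ext
    exact (coeFn_bmul _ A).trans (MemLp.coeFn_toLp _).symm
  rw [ofCoord_apply, h]
  filter_upwards [coeFn_fourierInv_toLp (integrable_invWeight_mul hq A) (memLp_invWeight_mul q A)]
    with x hx
  rw [hx, contRep_apply]

theorem memLp_contRep {q : ℕ} (hq : (N : ℝ) / 2 < q) (A : L2Space N) :
    MemLp (contRep hq A) 2 (volume : Measure (RSpace N)) :=
  (memLp_congr_ae (coeFn_ofCoord hq A)).1 (Lp.memLp _)

/-! ### Young's inequality -/

/-- Cauchy–Schwarz for the splitting `f g = (f² g)^{1/2} g^{1/2}`, followed by Tonelli and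
translation invariance. -/
theorem lintegral_convolution_sq_le {f g : RSpace N → ℝ≥0∞} (hf : Measurable f)
    (hg : Measurable g) :
    ∫⁻ x, (∫⁻ y, f y * g (x - y)) ^ 2 ≤ (∫⁻ x, f x ^ 2) * (∫⁻ x, g x) ^ 2 := by
  have h1 : ∀ x, (∫⁻ y, f y * g (x - y)) ^ 2 ≤ (∫⁻ y, f y ^ 2 * g (x - y)) * ∫⁻ y, g y := by
    intro x
    have h2 := ENNReal.lintegral_mul_norm_pow_le (μ := volume)
      (f := fun y => f y ^ 2 * g (x - y)) (g := fun y => g (x - y))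
      (by fun_prop) (by fun_prop) (p := 1 / 2) (q := 1 / 2) (by norm_num) (by norm_num)
      (by norm_num)
    have h3 : ∀ y, (f y ^ 2 * g (x - y)) ^ (1 / 2 : ℝ) * g (x - y) ^ (1 / 2 : ℝ)
        = f y * g (x - y) := by
      intro y
      rw [ENNReal.mul_rpow_of_nonneg _ _ (by norm_num), mul_assoc,
        ← ENNReal.rpow_add_of_nonneg _ _ (by norm_num) (by norm_num), ← ENNReal.rpow_natCast,
        ← ENNReal.rpow_mul]
      norm_num
    simp only [h3, lintegral_sub_left_eq_self g x] at h2
    calc (∫⁻ y, f y * g (x - y)) ^ 2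
        ≤ ((∫⁻ y, f y ^ 2 * g (x - y)) ^ (1 / 2 : ℝ) * (∫⁻ y, g y) ^ (1 / 2 : ℝ)) ^ 2 := by
          gcongr
      _ = _ := by
          rw [← ENNReal.mul_rpow_of_nonneg _ _ (by norm_num), ← ENNReal.rpow_natCast,
            ← ENNReal.rpow_mul]
          norm_num
  calc ∫⁻ x, (∫⁻ y, f y * g (x - y)) ^ 2
      ≤ ∫⁻ x, (∫⁻ y, f y ^ 2 * g (x - y)) * ∫⁻ y, g y := lintegral_mono h1
    _ = (∫⁻ x, ∫⁻ y, f y ^ 2 * g (x - y)) * ∫⁻ y, g y :=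
        lintegral_mul_const _ (Measurable.lintegral_prod_right' (by fun_prop :
          Measurable fun p : RSpace N × RSpace N => f p.2 ^ 2 * g (p.1 - p.2)))
    _ = (∫⁻ y, ∫⁻ x, f y ^ 2 * g (x - y)) * ∫⁻ y, g y := by
        rw [lintegral_lintegral_swap]
        exact (by fun_prop :
          Measurable fun p : RSpace N × RSpace N => f p.2 ^ 2 * g (p.1 - p.2)).aemeasurable
    _ = (∫⁻ y, f y ^ 2 * ∫⁻ x, g x) * ∫⁻ y, g y := by
        congr 2
        ext y
        rw [lintegral_const_mul _ (by fun_prop), lintegral_sub_right_eq_self g y]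
    _ = _ := by
        rw [lintegral_mul_const _ (by fun_prop)]
        ring

/-! ### Products of Sobolev functions -/

theorem ENNReal.add_sq_le (x y : ℝ≥0∞) : (x + y) ^ 2 ≤ 2 * (x ^ 2 + y ^ 2) := by
  have h := ENNReal.rpow_add_le_mul_rpow_add_rpow x y (p := 2) (by norm_num)
  norm_num at h
  exact h

/-- From `|ξ| ≤ 2 max(|y|, |ξ - y|)` one gets `1 + |ξ|² ≤ 4 (1 + max²)`, and `4^{q/2} = 2^q`. -/
theorem sobWeight_le (q : ℕ) (ξ y : RSpace N) :
    sobWeight q ξ ≤ 2 ^ q * (sobWeight q y + sobWeight q (ξ - y)) := by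
  have hq : (0 : ℝ) ≤ (q : ℝ) / 2 := by positivity
  have h0 : ‖ξ‖ ≤ ‖y‖ + ‖ξ - y‖ := by simpa using norm_add_le y (ξ - y)
  have hpow : ∀ c : ℝ, 0 ≤ c → (4 * c) ^ ((q : ℝ) / 2) = 2 ^ q * c ^ ((q : ℝ) / 2) := by
    intro c hc
    rw [Real.mul_rpow (by norm_num) hc, show (4 : ℝ) = 2 ^ (2 : ℝ) by norm_num,
      ← Real.rpow_mul (by norm_num), mul_div_cancel₀ _ (by norm_num), Real.rpow_natCast]
  rcases le_total ‖y‖ ‖ξ - y‖ with h | h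
  · have h1 : sobWeight q ξ ≤ 2 ^ q * sobWeight q (ξ - y) := by
      unfold sobWeight
      rw [← hpow _ (by positivity)]
      apply Real.rpow_le_rpow (by positivity) _ hq
      nlinarith [norm_nonneg ξ, norm_nonneg y]
    refine h1.trans ?_
    gcongr
    linarith [sobWeight_pos q y]
  · have h1 : sobWeight q ξ ≤ 2 ^ q * sobWeight q y := by
      unfold sobWeight
      rw [← hpow _ (by positivity)]
      apply Real.rpow_le_rpow (by positivity) _ hq
      nlinarith [norm_nonneg ξ, norm_nonneg (ξ - y)]
    refine h1.trans ?_
    gcongr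
    linarith [sobWeight_pos q (ξ - y)]

/-- The Fourier coordinate of a product of two Sobolev functions. -/
def convCoord (q : ℕ) (A B : L2Space N) (ξ : RSpace N) : ℂ :=
  (sobWeight q ξ : ℂ) * ∫ y, (invWeight N q y * A y) * (invWeight N q (ξ - y) * B (ξ - y))

theorem enorm_sobWeight_mul_invWeight (q : ℕ) (A : L2Space N) (y : RSpace N) :
    ENNReal.ofReal (sobWeight q y) * ‖invWeight N q y * A y‖ₑ = ‖A y‖ₑ := by
  rw [enorm_mul, ← ofReal_norm (invWeight N q y), norm_invWeight, ← mul_assoc,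
    ← ENNReal.ofReal_mul (sobWeight_pos q y).le, mul_inv_cancel₀ (sobWeight_pos q y).ne',
    ENNReal.ofReal_one, one_mul]

theorem lintegral_enorm_sq (A : L2Space N) : ∫⁻ x, ‖A x‖ₑ ^ 2 = ‖A‖ₑ ^ 2 := by
  rw [Lp.enorm_def, eLpNorm_eq_lintegral_rpow_enorm_toReal (by norm_num) (by norm_num),
    ← ENNReal.rpow_natCast, ← ENNReal.rpow_mul]
  simp

theorem lintegral_enorm_invWeight_mul_le (q : ℕ) (A : L2Space N) :
    ∫⁻ ξ, ‖invWeight N q ξ * A ξ‖ₑ ≤ eLpNorm (invWeight N q) 2 volume * ‖A‖ₑ := by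
  rw [← eLpNorm_one_eq_lintegral_enorm, Lp.enorm_def]
  have h := eLpNorm_smul_le_mul_eLpNorm (p := 2) (q := 2) (r := 1) (Lp.aestronglyMeasurable A)
    (invWeight N q).continuous.aestronglyMeasurable (μ := volume)
  exact h

/-- By `sobWeight_le` the outer weight falls on one of the two factors and cancels its reciprocal
weight there. That factor is then merely in `L²`, while the other keeps its reciprocal weight and is
in `L¹`, which is what Young's inequality needs. -/
theorem enorm_convCoord_sq_le (q : ℕ) (A B : L2Space N) (ξ : RSpace N) :
    ‖convCoord q A B ξ‖ₑ ^ 2 ≤ 2 * (2 ^ q) ^ 2 *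
      ((∫⁻ y, ‖A y‖ₑ * ‖invWeight N q (ξ - y) * B (ξ - y)‖ₑ) ^ 2 +
        (∫⁻ y, ‖B y‖ₑ * ‖invWeight N q (ξ - y) * A (ξ - y)‖ₑ) ^ 2) := by
  have hA := (Lp.stronglyMeasurable A).measurable
  have hB := (Lp.stronglyMeasurable B).measurable
  have hw := (invWeight N q).continuous.measurable
  have h2 : ∫⁻ y, ‖B y‖ₑ * ‖invWeight N q (ξ - y) * A (ξ - y)‖ₑ
      = ∫⁻ y, ‖invWeight N q y * A y‖ₑ * ‖B (ξ - y)‖ₑ := by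
    rw [← lintegral_sub_left_eq_self (fun y => ‖B y‖ₑ * ‖invWeight N q (ξ - y) * A (ξ - y)‖ₑ) ξ]
    congr 1
    ext y
    rw [sub_sub_cancel, mul_comm]
  have h1 : ‖convCoord q A B ξ‖ₑ ≤ 2 ^ q *
      ((∫⁻ y, ‖A y‖ₑ * ‖invWeight N q (ξ - y) * B (ξ - y)‖ₑ) +
        ∫⁻ y, ‖B y‖ₑ * ‖invWeight N q (ξ - y) * A (ξ - y)‖ₑ) := by
    rw [h2, ← lintegral_add_left (by fun_prop), ← lintegral_const_mul _ (by fun_prop), convCoord,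
      enorm_mul]
    have h3 : ‖((sobWeight q ξ : ℝ) : ℂ)‖ₑ = ENNReal.ofReal (sobWeight q ξ) := by
      rw [← ofReal_norm, Complex.norm_real, Real.norm_of_nonneg (sobWeight_pos q ξ).le]
    rw [h3]
    calc _ ≤ ENNReal.ofReal (sobWeight q ξ) *
          ∫⁻ y, ‖(invWeight N q y * A y) * (invWeight N q (ξ - y) * B (ξ - y))‖ₑ := by
          gcongr
          exact enorm_integral_le_lintegral_enorm _
      _ = ∫⁻ y, ENNReal.ofReal (sobWeight q ξ) *
            ‖(invWeight N q y * A y) * (invWeight N q (ξ - y) * B (ξ - y))‖ₑ :=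
          (lintegral_const_mul _ (by fun_prop)).symm
      _ ≤ _ := by
          apply lintegral_mono
          intro y
          have h4 : ENNReal.ofReal (sobWeight q ξ) ≤ 2 ^ q * (ENNReal.ofReal (sobWeight q y) +
              ENNReal.ofReal (sobWeight q (ξ - y))) := by
            rw [← ENNReal.ofReal_add (sobWeight_pos _ _).le (sobWeight_pos _ _).le]
            refine (ENNReal.ofReal_le_ofReal (sobWeight_le q ξ y)).trans ?_
            rw [ENNReal.ofReal_mul (by positivity), ENNReal.ofReal_pow (by norm_num)]
            simp
          calc _ ≤ (2 ^ q * (ENNReal.ofReal (sobWeight q y) +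
              ENNReal.ofReal (sobWeight q (ξ - y)))) *
              ‖(invWeight N q y * A y) * (invWeight N q (ξ - y) * B (ξ - y))‖ₑ := by
                exact mul_le_mul' h4 le_rfl
            _ = 2 ^ q * ((ENNReal.ofReal (sobWeight q y) * ‖invWeight N q y * A y‖ₑ) *
                  ‖invWeight N q (ξ - y) * B (ξ - y)‖ₑ + ‖invWeight N q y * A y‖ₑ *
                  (ENNReal.ofReal (sobWeight q (ξ - y)) *
                    ‖invWeight N q (ξ - y) * B (ξ - y)‖ₑ)) := by
                rw [enorm_mul (invWeight N q y * A y)]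
                ring
            _ = _ := by rw [enorm_sobWeight_mul_invWeight, enorm_sobWeight_mul_invWeight]
  calc ‖convCoord q A B ξ‖ₑ ^ 2 ≤ _ := pow_le_pow_left' h1 2
    _ ≤ _ := by
      rw [mul_pow, mul_comm 2, mul_assoc]
      gcongr
      exact ENNReal.add_sq_le _ _

theorem lintegral_convCoord_sq_le (q : ℕ) (A B : L2Space N) :
    ∫⁻ ξ, ‖convCoord q A B ξ‖ₑ ^ 2 ≤
      (2 * 2 ^ q * eLpNorm (invWeight N q) 2 volume * ‖A‖ₑ * ‖B‖ₑ) ^ 2 := by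
  have hA := (Lp.stronglyMeasurable A).measurable
  have hB := (Lp.stronglyMeasurable B).measurable
  have hw := (invWeight N q).continuous.measurable
  have key : ∀ A B : L2Space N,
      ∫⁻ ξ, (∫⁻ y, ‖A y‖ₑ * ‖invWeight N q (ξ - y) * B (ξ - y)‖ₑ) ^ 2 ≤
        ‖A‖ₑ ^ 2 * (eLpNorm (invWeight N q) 2 volume * ‖B‖ₑ) ^ 2 := by
    intro A B
    have hA := (Lp.stronglyMeasurable A).measurable
    have hB := (Lp.stronglyMeasurable B).measurable
    refine (lintegral_convolution_sq_le (f := fun y => ‖A y‖ₑ)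
      (g := fun y => ‖invWeight N q y * B y‖ₑ) (by fun_prop) (by fun_prop)).trans ?_
    rw [lintegral_enorm_sq]
    gcongr
    exact lintegral_enorm_invWeight_mul_le q B
  have hmeas : ∀ A B : L2Space N, Measurable fun ξ =>
      (∫⁻ y, ‖A y‖ₑ * ‖invWeight N q (ξ - y) * B (ξ - y)‖ₑ) ^ 2 := by
    intro A B
    have hA := (Lp.stronglyMeasurable A).measurable
    have hB := (Lp.stronglyMeasurable B).measurable
    exact (Measurable.lintegral_prod_right' (by fun_prop : Measurable fun p : RSpace N × RSpace N =>
      ‖A p.2‖ₑ * ‖invWeight N q (p.1 - p.2) * B (p.1 - p.2)‖ₑ)).pow_const 2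
  calc _ ≤ ∫⁻ ξ, 2 * (2 ^ q) ^ 2 *
      ((∫⁻ y, ‖A y‖ₑ * ‖invWeight N q (ξ - y) * B (ξ - y)‖ₑ) ^ 2 +
        (∫⁻ y, ‖B y‖ₑ * ‖invWeight N q (ξ - y) * A (ξ - y)‖ₑ) ^ 2) :=
        lintegral_mono (enorm_convCoord_sq_le q A B)
    _ = 2 * (2 ^ q) ^ 2 * ((∫⁻ ξ, (∫⁻ y, ‖A y‖ₑ * ‖invWeight N q (ξ - y) * B (ξ - y)‖ₑ) ^ 2) +
        ∫⁻ ξ, (∫⁻ y, ‖B y‖ₑ * ‖invWeight N q (ξ - y) * A (ξ - y)‖ₑ) ^ 2) := by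
        rw [lintegral_const_mul _ (by exact (hmeas A B).add (hmeas B A)),
          lintegral_add_left (hmeas A B)]
    _ ≤ 2 * (2 ^ q) ^ 2 * (‖A‖ₑ ^ 2 * (eLpNorm (invWeight N q) 2 volume * ‖B‖ₑ) ^ 2 +
        ‖B‖ₑ ^ 2 * (eLpNorm (invWeight N q) 2 volume * ‖A‖ₑ) ^ 2) := by
        gcongr
        · exact key A B
        · exact key B A
    _ = _ := by ring

theorem memLp_convCoord {q : ℕ} (hq : (N : ℝ) / 2 < q) (A B : L2Space N) :
    MemLp (convCoord q A B) 2 := by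
  have hA := Lp.stronglyMeasurable A
  have hB := Lp.stronglyMeasurable B
  have hw := (invWeight N q).continuous.stronglyMeasurable
  have hmeas : AEStronglyMeasurable (convCoord q A B) volume := by
    refine (Complex.continuous_ofReal.comp
      (continuous_sobWeight q)).stronglyMeasurable.mul ?_ |>.aestronglyMeasurable
    refine StronglyMeasurable.integral_prod_right'
      (f := fun p : RSpace N × RSpace N => (invWeight N q p.2 * A p.2) *
        (invWeight N q (p.1 - p.2) * B (p.1 - p.2))) ?_
    exact ((hw.comp_measurable measurable_snd).mul (hA.comp_measurable measurable_snd)).mul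
      ((hw.comp_measurable (by fun_prop)).mul (hB.comp_measurable (by fun_prop)))
  refine ⟨hmeas, ?_⟩
  rw [eLpNorm_lt_top_iff_lintegral_rpow_enorm_lt_top (by norm_num) (by norm_num)]
  have h := lintegral_convCoord_sq_le q A B
  simp only [ENNReal.toReal_ofNat, ENNReal.rpow_ofNat]
  refine h.trans_lt ?_
  have := (memLp_two_invWeight hq).2
  finiteness

theorem integrable_convCoord (q : ℕ) (A B : L2Space N) (ξ : RSpace N) :
    Integrable fun y => (invWeight N q y * A y) * (invWeight N q (ξ - y) * B (ξ - y)) := by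
  have h1 := memLp_invWeight_mul q A
  have h2 := (memLp_invWeight_mul q B).comp_measurePreserving
    (Measure.measurePreserving_sub_left volume ξ)
  exact h1.integrable_mul h2

/-- The product of Sobolev functions, in Fourier coordinates. -/
def prodCoord {q : ℕ} (hq : (N : ℝ) / 2 < q) : L2Space N →L[ℂ] L2Space N →L[ℂ] L2Space N :=
  LinearMap.mkContinuous₂
    (LinearMap.mk₂ ℂ (fun A B => (memLp_convCoord hq A B).toLp (convCoord q A B))
      (fun A₁ A₂ B => by
        rw [← MemLp.toLp_add]
        apply MemLp.toLp_congr
        refine ae_of_all _ fun ξ => ?_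
        simp only [convCoord, Pi.add_apply]
        rw [← mul_add, ← integral_add (integrable_convCoord q A₁ B ξ)
          (integrable_convCoord q A₂ B ξ)]
        congr 1
        apply integral_congr_ae
        filter_upwards [Lp.coeFn_add A₁ A₂] with y hy
        rw [hy, Pi.add_apply]; ring)
      (fun c A B => by
        rw [← MemLp.toLp_const_smul]
        apply MemLp.toLp_congr
        refine ae_of_all _ fun ξ => ?_
        simp only [convCoord, Pi.smul_apply, smul_eq_mul]
        rw [mul_left_comm c, ← integral_const_mul c]
        congr 1
        apply integral_congr_ae
        filter_upwards [Lp.coeFn_smul c A] with y hy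
        rw [hy, Pi.smul_apply, smul_eq_mul]; ring)
      (fun A B₁ B₂ => by
        rw [← MemLp.toLp_add]
        apply MemLp.toLp_congr
        refine ae_of_all _ fun ξ => ?_
        simp only [convCoord, Pi.add_apply]
        rw [← mul_add, ← integral_add (integrable_convCoord q A B₁ ξ)
          (integrable_convCoord q A B₂ ξ)]
        congr 1
        apply integral_congr_ae
        filter_upwards [(quasiMeasurePreserving_sub_left volume ξ).ae (Lp.coeFn_add B₁ B₂)]
          with y hy
        rw [hy, Pi.add_apply]; ring)
      (fun c A B => by
        rw [← MemLp.toLp_const_smul]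
        apply MemLp.toLp_congr
        refine ae_of_all _ fun ξ => ?_
        simp only [convCoord, Pi.smul_apply, smul_eq_mul]
        rw [mul_left_comm c, ← integral_const_mul c]
        congr 1
        apply integral_congr_ae
        filter_upwards [(quasiMeasurePreserving_sub_left volume ξ).ae (Lp.coeFn_smul c B)]
          with y hy
        rw [hy, Pi.smul_apply, smul_eq_mul]; ring))
    (2 * 2 ^ q * (eLpNorm (invWeight N q) 2 volume).toReal)
    (fun A B => by
      rw [LinearMap.mk₂_apply, Lp.norm_toLp]
      have h : eLpNorm (convCoord q A B) 2 volume ≤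
          2 * 2 ^ q * eLpNorm (invWeight N q) 2 volume * ‖A‖ₑ * ‖B‖ₑ := by
        rw [eLpNorm_eq_lintegral_rpow_enorm_toReal (by norm_num) (by norm_num)]
        simp only [ENNReal.toReal_ofNat, ENNReal.rpow_ofNat]
        refine (ENNReal.rpow_le_rpow (lintegral_convCoord_sq_le q A B) (by norm_num)).trans ?_
        rw [← ENNReal.rpow_natCast, ← ENNReal.rpow_mul]
        norm_num
      have hfin := (memLp_two_invWeight hq).2
      refine (ENNReal.toReal_mono (by finiteness) h).trans_eq ?_
      simp [ENNReal.toReal_mul])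

theorem coeFn_prodCoord {q : ℕ} (hq : (N : ℝ) / 2 < q) (A B : L2Space N) :
    prodCoord hq A B =ᵐ[volume] convCoord q A B :=
  (memLp_convCoord hq A B).coeFn_toLp

/-- The Fourier transform carries convolutions to products, and the weight built into `convCoord`
cancels the reciprocal weight of `contRep`. Hence `prodCoord` really is the coordinate of the
pointwise product. -/
theorem contRep_prodCoord {q : ℕ} (hq : (N : ℝ) / 2 < q) (A B : L2Space N) (x : RSpace N) :
    contRep hq (prodCoord hq A B) x = contRep hq A x * contRep hq B x := by
  simp only [contRep_apply]
  have h := Real.fourier_mul_convolution_eq (integrable_invWeight_mul hq A)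
    (integrable_invWeight_mul hq B) (-x)
  simp only [Real.fourierInv_eq_fourier_neg]
  rw [← h]
  apply Real.fourier_congr_ae
  filter_upwards [coeFn_prodCoord hq A B] with ξ hξ
  rw [hξ, convCoord, invWeight_apply, ← mul_assoc]
  have : (((sobWeight q ξ)⁻¹ : ℝ) : ℂ) * (sobWeight q ξ : ℂ) = 1 := by
    rw [← Complex.ofReal_mul, inv_mul_cancel₀ (sobWeight_pos q ξ).ne', Complex.ofReal_one]
  rw [this, one_mul]
  rfl

/-! ### The nonlinearity in Fourier coordinates -/

/-- Complex conjugation of functions, in Fourier coordinates. -/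
def conjCoord : L2Space N →L[ℝ] L2Space N :=
  ContinuousLinearMap.compLpL 2 volume (Complex.conjCLE : ℂ →L[ℝ] ℂ) ∘L
    (Lp.compMeasurePreservingₗᵢ ℝ (fun x : RSpace N => -x)
      (Measure.measurePreserving_neg volume)).toContinuousLinearMap

theorem coeFn_conjCoord (A : L2Space N) :
    conjCoord A =ᵐ[volume] fun ξ => (starRingEnd ℂ) (A (-ξ)) := by
  have h1 := ContinuousLinearMap.coeFn_compLpL (p := 2) (μ := volume)
    (Complex.conjCLE : ℂ →L[ℝ] ℂ) (Lp.compMeasurePreservingₗᵢ ℝ (fun x : RSpace N => -x)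
      (Measure.measurePreserving_neg volume) A)
  have h2 := Lp.coeFn_compMeasurePreserving A
    (Measure.measurePreserving_neg (volume : Measure (RSpace N)))
  filter_upwards [h1, h2] with ξ h3 h4
  refine h3.trans ?_
  exact congrArg (starRingEnd ℂ) h4

theorem sobWeight_neg (q : ℕ) (ξ : RSpace N) : sobWeight q (-ξ) = sobWeight q ξ := by
  simp [sobWeight]

theorem contRep_conjCoord {q : ℕ} (hq : (N : ℝ) / 2 < q) (A : L2Space N) (x : RSpace N) :
    contRep hq (conjCoord A) x = (starRingEnd ℂ) (contRep hq A x) := by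
  rw [contRep_apply, contRep_apply, Real.fourierInv_eq, Real.fourierInv_eq, ← integral_conj,
    ← integral_neg_eq_self (fun ξ => (starRingEnd ℂ)
      (Real.fourierChar (inner ℝ ξ x) • (invWeight N q ξ * A ξ)))]
  apply integral_congr_ae
  filter_upwards [coeFn_conjCoord A] with ξ hξ
  rw [hξ, Circle.smul_def, Circle.smul_def, invWeight_apply, invWeight_apply, sobWeight_neg,
    inner_neg_left, AddChar.map_neg_eq_inv, Circle.coe_inv_eq_conj, smul_eq_mul, smul_eq_mul,
    map_mul, map_mul, Complex.conj_conj, Complex.conj_ofReal]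

/-- The map `f ↦ |f|^{2k} f` in Fourier coordinates. -/
def powCoord {q : ℕ} (hq : (N : ℝ) / 2 < q) : ℕ → L2Space N → L2Space N
  | 0, A => A
  | k + 1, A => prodCoord hq A (prodCoord hq (conjCoord A) (powCoord hq k A))

theorem contRep_powCoord {q : ℕ} (hq : (N : ℝ) / 2 < q) (k : ℕ) (A : L2Space N) (x : RSpace N) :
    contRep hq (powCoord hq k A) x
      = ((‖contRep hq A x‖ ^ (2 * k) : ℝ) : ℂ) * contRep hq A x := by
  induction k with
  | zero => simp [powCoord]
  | succ k ih =>
    rw [powCoord, contRep_prodCoord, contRep_prodCoord, ih, contRep_conjCoord, ← mul_assoc,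
      Complex.mul_conj, Complex.normSq_eq_norm_sq]
    push_cast
    ring

theorem powerNonlinearity_ofCoord {q : ℕ} (hq : (N : ℝ) / 2 < q) (k : ℕ) (A : L2Space N) :
    powerNonlinearity k (ofCoord q A) = ofCoord q (powCoord hq k A) := by
  have h : (fun x => ((‖ofCoord q A x‖ ^ (2 * k) : ℝ) : ℂ) * ofCoord q A x)
      =ᵐ[volume] ofCoord q (powCoord hq k A) := by
    filter_upwards [coeFn_ofCoord hq A, coeFn_ofCoord hq (powCoord hq k A)] with x h1 h2
    rw [h1, h2, contRep_powCoord]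
  have hm := (memLp_congr_ae h).2 (Lp.memLp _)
  rw [powerNonlinearity, dif_pos hm]
  exact Lp.ext (hm.coeFn_toLp.trans h)

/-- Lipschitz continuity on balls. -/
def LipOnBalls {E F : Type*} [NormedAddCommGroup E] [NormedAddCommGroup F] (f : E → F) : Prop :=
  ∀ R : ℝ, ∃ K : NNReal, LipschitzOnWith K f (Metric.closedBall 0 R)

theorem LipOnBalls.exists_bound {E F : Type*} [NormedAddCommGroup E] [NormedAddCommGroup F]
    {f : E → F} (hf : LipOnBalls f) (R : ℝ) :
    ∃ M : NNReal, ∀ x ∈ Metric.closedBall (0 : E) R, ‖f x‖ ≤ M := by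
  obtain ⟨K, hK⟩ := hf R
  refine ⟨K * R.toNNReal + ‖f 0‖₊, fun x hx => ?_⟩
  have hx' : ‖x‖ ≤ R := by simpa using hx
  have hR : 0 ≤ R := (norm_nonneg x).trans hx'
  have h1 := hK.norm_sub_le hx (by simpa using hR : (0 : E) ∈ Metric.closedBall (0 : E) R)
  have h2 : ‖f x‖ ≤ ‖f x - f 0‖ + ‖f 0‖ := by simpa using norm_add_le (f x - f 0) (f 0)
  push_cast
  rw [Real.coe_toNNReal _ hR]
  rw [sub_zero] at h1
  have : (K : ℝ) * ‖x‖ ≤ K * R := by gcongr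
  linarith

theorem LipOnBalls.bilin {E F₁ F₂ G : Type*} [NormedAddCommGroup E]
    [NormedAddCommGroup F₁] [NormedAddCommGroup F₂] [NormedAddCommGroup G] [NormedSpace ℂ F₁]
    [NormedSpace ℂ F₂] [NormedSpace ℂ G] (B : F₁ →L[ℂ] F₂ →L[ℂ] G) {f : E → F₁} {g : E → F₂}
    (hf : LipOnBalls f) (hg : LipOnBalls g) : LipOnBalls fun x => B (f x) (g x) := by
  intro R
  obtain ⟨K₁, h₁⟩ := hf R
  obtain ⟨K₂, h₂⟩ := hg R
  obtain ⟨M₁, b₁⟩ := hf.exists_bound R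
  obtain ⟨M₂, b₂⟩ := hg.exists_bound R
  refine ⟨‖B‖₊ * K₁ * M₂ + ‖B‖₊ * M₁ * K₂, LipschitzOnWith.of_dist_le_mul fun x hx y hy => ?_⟩
  rw [dist_eq_norm, dist_eq_norm]
  have e : B (f x) (g x) - B (f y) (g y) = B (f x - f y) (g x) + B (f y) (g x - g y) := by
    simp
  have l₁ := h₁.norm_sub_le hx hy
  have l₂ := h₂.norm_sub_le hx hy
  rw [e]
  calc _ ≤ ‖B‖ * ‖f x - f y‖ * ‖g x‖ + ‖B‖ * ‖f y‖ * ‖g x - g y‖ :=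
        (norm_add_le _ _).trans (add_le_add (B.le_opNorm₂ _ _) (B.le_opNorm₂ _ _))
    _ ≤ ‖B‖ * (K₁ * ‖x - y‖) * M₂ + ‖B‖ * M₁ * (K₂ * ‖x - y‖) := by
        gcongr
        · exact b₂ x hx
        · exact b₁ y hy
    _ = _ := by push_cast; ring

theorem LipschitzWith.lipOnBalls {E F : Type*} [NormedAddCommGroup E] [NormedAddCommGroup F]
    {K : NNReal} {f : E → F} (hf : LipschitzWith K f) : LipOnBalls f :=
  fun _ => ⟨K, hf.lipschitzOnWith⟩

/-- Conjugation is only real linear, but it is Lipschitz, so bounded bilinear products preserve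
Lipschitz continuity on balls along the recursion. -/
theorem lipOnBalls_powCoord {q : ℕ} (hq : (N : ℝ) / 2 < q) (k : ℕ) :
    LipOnBalls (powCoord hq k : L2Space N → L2Space N) := by
  induction k with
  | zero => exact LipschitzWith.id.lipOnBalls
  | succ k ih =>
    exact LipOnBalls.bilin (prodCoord hq) LipschitzWith.id.lipOnBalls
      (LipOnBalls.bilin (prodCoord hq) conjCoord.lipschitz.lipOnBalls ih)

theorem LipOnBalls.continuous {E F : Type*} [NormedAddCommGroup E] [NormedAddCommGroup F]
    {f : E → F} (hf : LipOnBalls f) : Continuous f := by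
  rw [continuous_iff_continuousAt]
  intro x
  obtain ⟨K, hK⟩ := hf (‖x‖ + 1)
  refine hK.continuousOn.continuousAt (Metric.closedBall_mem_nhds_of_mem ?_)
  simp

/-! ### The differential equation in the interaction picture -/

/-- The vector field of the equation for `Y(t) = e^{-itΔ} ψ(t)`, in Fourier coordinates. -/
def interactionField {q : ℕ} (hq : (N : ℝ) / 2 < q) (η : ℕ) (lam : ℝ) (t : ℝ) (Y : L2Space N) :
    L2Space N :=
  -(Complex.I * (lam : ℂ)) • bmul (symB N (-t)) (powCoord hq η (bmul (symB N t) Y))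

theorem norm_I_mul_ofReal (lam : ℝ) : ‖Complex.I * (lam : ℂ)‖ = |lam| := by simp

theorem norm_interactionField {q : ℕ} (hq : (N : ℝ) / 2 < q) (η : ℕ) (lam : ℝ) (t : ℝ)
    (Y : L2Space N) :
    ‖interactionField hq η lam t Y‖ = |lam| * ‖powCoord hq η (bmul (symB N t) Y)‖ := by
  rw [interactionField, norm_smul, norm_neg, norm_I_mul_ofReal, norm_bmul_symB]

/-- The field is the nonlinearity conjugated by unitary multipliers. These preserve balls and
distances, so the constant does not depend on time. -/
theorem exists_lipschitzOnWith_interactionField {q : ℕ} (hq : (N : ℝ) / 2 < q) (η : ℕ) (lam : ℝ)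
    (R : ℝ) : ∃ K : NNReal, ∀ t,
      LipschitzOnWith K (interactionField hq η lam t) (Metric.closedBall (0 : L2Space N) R) := by
  obtain ⟨K, hK⟩ := lipOnBalls_powCoord (N := N) hq η R
  refine ⟨‖lam‖₊ * K, fun t => LipschitzOnWith.of_dist_le_mul fun x hx y hy => ?_⟩
  have hmem : ∀ x ∈ Metric.closedBall (0 : L2Space N) R,
      bmul (symB N t) x ∈ Metric.closedBall (0 : L2Space N) R := by
    intro x hx
    simpa [norm_bmul_symB] using hx
  have h := hK.norm_sub_le (hmem x hx) (hmem y hy)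
  rw [dist_eq_norm, dist_eq_norm, interactionField, interactionField, ← smul_sub, ← map_sub,
    norm_smul, norm_neg, norm_I_mul_ofReal, norm_bmul_symB]
  rw [← map_sub, norm_bmul_symB] at h
  push_cast
  rw [mul_assoc, Real.norm_eq_abs]
  gcongr

/-- The symbols depend on time continuously only in the strong sense; joint strong continuity is
enough along a continuous curve. -/
theorem continuousOn_interactionField {q : ℕ} (hq : (N : ℝ) / 2 < q) (η : ℕ) (lam : ℝ)
    {S : Set ℝ} {Y : ℝ → L2Space N} (hY : ContinuousOn Y S) :
    ContinuousOn (fun t => interactionField hq η lam t (Y t)) S := by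
  have h1 : ContinuousOn (fun t => bmul (symB N t) (Y t)) S :=
    ContinuousOn.bmul_symB (s := fun t => t) continuousOn_id hY
  have h2 : ContinuousOn
      (fun t => bmul (symB N (-t)) (powCoord hq η (bmul (symB N t) (Y t)))) S :=
    ContinuousOn.bmul_symB (s := fun t => -t) continuousOn_id.neg
      ((lipOnBalls_powCoord hq η).continuous.comp_continuousOn h1)
  exact h2.const_smul (-(Complex.I * (lam : ℂ)))

/-- Local existence for the equation in the interaction picture. -/
theorem exists_interaction_solution {q : ℕ} (hq : (N : ℝ) / 2 < q) (η : ℕ) (lam : ℝ)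
    (A₀ : L2Space N) : ∃ T : ℝ, 0 < T ∧ ∃ Y : ℝ → L2Space N, Y 0 = A₀ ∧
      ∀ t ∈ Icc 0 T, HasDerivWithinAt Y (interactionField hq η lam t (Y t)) (Icc 0 T) t := by
  obtain ⟨K, hK⟩ := exists_lipschitzOnWith_interactionField (N := N) hq η lam (‖A₀‖ + 1)
  obtain ⟨M, hM⟩ := (lipOnBalls_powCoord (N := N) hq η).exists_bound (‖A₀‖ + 1)
  have hsub : Metric.closedBall A₀ 1 ⊆ Metric.closedBall (0 : L2Space N) (‖A₀‖ + 1) := by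
    apply Metric.closedBall_subset_closedBall'
    simp [add_comm]
  set L : NNReal := ‖lam‖₊ * M with hL
  -- `L` bounds the field on the unit ball about `A₀`, and `L * T ≤ 1` keeps the solution in that
  -- ball.
  set T : ℝ := 1 / (L + 1) with hT
  have hT0 : 0 < T := by positivity
  have hP : IsPicardLindelof (interactionField hq η lam) (tmin := 0) (tmax := T)
      ⟨0, left_mem_Icc.2 hT0.le⟩ A₀ 1 0 L K := by
    refine ⟨fun t _ => (hK t).mono hsub, fun x _ => ?_, fun t _ x hx => ?_, ?_⟩
    · exact continuousOn_interactionField hq η lam continuousOn_const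
    · rw [norm_interactionField, hL]
      push_cast
      rw [Real.norm_eq_abs]
      gcongr
      apply hM
      have := hsub (by simpa using hx)
      simpa [norm_bmul_symB] using this
    · simp only [sub_zero, sub_self, max_eq_left hT0.le, NNReal.coe_one, NNReal.coe_zero]
      rw [hT, mul_one_div, div_le_one (by positivity)]
      linarith
  obtain ⟨Y, h0, h1⟩ := hP.exists_eq_forall_mem_Icc_hasDerivWithinAt₀
  exact ⟨T, hT0, Y, h0, h1⟩

/-- Uniqueness for the equation in the interaction picture. -/
theorem interaction_solution_unique {q : ℕ} (hq : (N : ℝ) / 2 < q) (η : ℕ) (lam : ℝ)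
    {T : ℝ} {Y Z : ℝ → L2Space N} (h0 : Y 0 = Z 0)
    (hY : ∀ t ∈ Icc 0 T, HasDerivWithinAt Y (interactionField hq η lam t (Y t)) (Icc 0 T) t)
    (hZ : ∀ t ∈ Icc 0 T, HasDerivWithinAt Z (interactionField hq η lam t (Z t)) (Icc 0 T) t) :
    EqOn Y Z (Icc 0 T) := by
  have cY : ContinuousOn Y (Icc 0 T) := fun t ht => (hY t ht).continuousWithinAt
  have cZ : ContinuousOn Z (Icc 0 T) := fun t ht => (hZ t ht).continuousWithinAt
  obtain ⟨R₁, hR₁⟩ := isCompact_Icc.exists_bound_of_continuousOn cY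
  obtain ⟨R₂, hR₂⟩ := isCompact_Icc.exists_bound_of_continuousOn cZ
  -- Both trajectories are bounded by compactness, so one ball with one Lipschitz constant contains
  -- them.
  obtain ⟨K, hK⟩ := exists_lipschitzOnWith_interactionField (N := N) hq η lam (max R₁ R₂)
  refine ODE_solution_unique_of_mem_Icc_right (fun t _ => hK t) cY ?_ ?_ cZ ?_ ?_ h0
  · exact fun t ht => ((hY t (Ico_subset_Icc_self ht)).mono_of_mem_nhdsWithin
      (Icc_mem_nhdsGE_of_mem ht))
  · intro t ht
    simpa using Or.inl (hR₁ t (Ico_subset_Icc_self ht))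
  · exact fun t ht => ((hZ t (Ico_subset_Icc_self ht)).mono_of_mem_nhdsWithin
      (Icc_mem_nhdsGE_of_mem ht))
  · intro t ht
    simpa using Or.inr (hR₂ t (Ico_subset_Icc_self ht))

/-! ### Mild solutions -/

theorem continuous_bmul_symB : Continuous fun p : ℝ × L2Space N => bmul (symB N p.1) p.2 :=
  continuous_iff_continuousAt.2 fun p =>
    (continuous_fst.tendsto p).bmul_symB (continuous_snd.tendsto p)

theorem ofCoord_interactionField {q : ℕ} (hq : (N : ℝ) / 2 < q) (η : ℕ) (lam t s : ℝ)
    (Y : L2Space N) :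
    ofCoord q (bmul (symB N t) (interactionField hq η lam s Y)) =
      -((Complex.I * (lam : ℂ)) • freePropagator (t - s)
        (powerNonlinearity η (ofCoord q (bmul (symB N s) Y)))) := by
  rw [powerNonlinearity_ofCoord hq, freePropagator_ofCoord, interactionField, map_smul,
    bmul_symB_symB, map_smul, neg_smul, sub_eq_add_neg]

/-- Applying the free evolution to the integrated equation for `Y` turns it into Duhamel's formula,
because `e^{itΔ} e^{-isΔ} = e^{i(t-s)Δ}`. -/
theorem isMildSolution_of_interaction {q : ℕ} (hq : (N : ℝ) / 2 < q) (η : ℕ) (lam : ℝ)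
    {T : ℝ} {Y : ℝ → L2Space N}
    (hY : ∀ t ∈ Icc 0 T, HasDerivWithinAt Y (interactionField hq η lam t (Y t)) (Icc 0 T) t) :
    IsMildSolution η q lam (ofCoord q (Y 0)) T (fun t => ofCoord q (bmul (symB N t) (Y t))) ∧
      InCSobolev q T (fun t => ofCoord q (bmul (symB N t) (Y t))) := by
  have cY : ContinuousOn Y (Icc 0 T) := fun t ht => (hY t ht).continuousWithinAt
  have cA : ContinuousOn (fun t => bmul (symB N t) (Y t)) (Icc 0 T) :=
    ContinuousOn.bmul_symB (s := fun t => t) continuousOn_id cY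
  have cG : ContinuousOn (fun t => (𝓕⁻ (bmul (symB N t) (Y t)) : L2Space N)) (Icc 0 T) :=
    (Lp.fourierTransformₗᵢ (RSpace N) ℂ).symm.continuous.comp_continuousOn cA
  have hG : ∀ t, besselPotential (RSpace N) ℂ (q : ℝ)
      (ofCoord q (bmul (symB N t) (Y t)) : 𝓢'(RSpace N, ℂ)) =
      ((𝓕⁻ (bmul (symB N t) (Y t)) : L2Space N) : 𝓢'(RSpace N, ℂ)) := by
    intro t
    rw [besselPotential_eq_iff, fourier_fourierInv_eq]
  have cF : ContinuousOn (fun t => interactionField hq η lam t (Y t)) (Icc 0 T) :=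
    continuousOn_interactionField hq η lam cY
  have hint : ∀ t ∈ Icc 0 T, IntervalIntegrable (fun s => interactionField hq η lam s (Y s))
      volume 0 t := by
    intro t ht
    refine (cF.mono ?_).intervalIntegrable
    rw [uIcc_of_le ht.1]
    exact Icc_subset_Icc_right ht.2
  refine ⟨⟨⟨fun t => 𝓕⁻ (bmul (symB N t) (Y t)), ?_, ae_of_all _ hG⟩, ?_, ?_⟩,
    ⟨fun t => 𝓕⁻ (bmul (symB N t) (Y t)), cG, fun t _ => hG t⟩⟩
  · obtain ⟨C, hC⟩ := isCompact_Icc.exists_bound_of_continuousOn cG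
    refine memLp_top_of_bound
      ((cG.mono Ioo_subset_Icc_self).aestronglyMeasurable measurableSet_Ioo) C ?_
    filter_upwards [ae_restrict_mem measurableSet_Ioo] with t ht
    exact hC t (Ioo_subset_Icc_self ht)
  · intro t ht
    have cP : ContinuousOn
        (fun s => ofCoord q (bmul (symB N (t - s)) (powCoord hq η (bmul (symB N s) (Y s)))))
        (Icc 0 T) :=
      (ofCoord q).continuous.comp_continuousOn (ContinuousOn.bmul_symB (s := fun s => t - s)
        (by fun_prop) ((lipOnBalls_powCoord hq η).continuous.comp_continuousOn cA))
    have h : IntervalIntegrable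
      (fun s => ofCoord q (bmul (symB N (t - s)) (powCoord hq η (bmul (symB N s) (Y s)))))
        volume 0 t := by
      refine (cP.mono ?_).intervalIntegrable
      rw [uIcc_of_le ht.1]
      exact Icc_subset_Icc_right ht.2
    refine h.congr fun s _ => ?_
    simp only [powerNonlinearity_ofCoord hq, freePropagator_ofCoord]
  · intro t ht
    have h1 : ∫ s in (0 : ℝ)..t, interactionField hq η lam s (Y s) = Y t - Y 0 := by
      apply intervalIntegral.integral_eq_sub_of_hasDeriv_right_of_le ht.1
        (cY.mono (Icc_subset_Icc_right ht.2)) _ (hint t ht)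
      intro s hs
      exact (hY s ⟨hs.1.le, hs.2.le.trans ht.2⟩).mono_of_mem_nhdsWithin
        (mem_of_superset (Icc_mem_nhdsGT_of_mem ⟨hs.1.le, hs.2.trans_le ht.2⟩) subset_rfl)
    have h2 : Y t = Y 0 + ∫ s in (0 : ℝ)..t, interactionField hq η lam s (Y s) := by
      rw [h1]; abel
    rw [h2, map_add, map_add, freePropagator_ofCoord, sub_eq_add_neg]
    congr 1
    have h3 := (ofCoord q ∘L bmul (symB N t)).intervalIntegral_comp_comm (hint t ht)
    simp only [ContinuousLinearMap.comp_apply, ofCoord_interactionField] at h3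
    rw [← h3, intervalIntegral.integral_neg, intervalIntegral.integral_smul]

/-- A bootstrap in time. The nonlinearity of a merely bounded measurable solution is integrable, so
its primitive `Y` is continuous. Duhamel's formula identifies `ψ(t)` with the evolution of `Y(t)` at
every time, hence the integrand agrees almost everywhere with a continuous function of time and `Y`
solves the differential equation. -/
theorem IsMildSolution.exists_interaction {q : ℕ} (hq : (N : ℝ) / 2 < q) {η : ℕ} {lam : ℝ}
    {T : ℝ} {A₀ : L2Space N} {ψ : ℝ → L2Space N}
    (h : IsMildSolution η q lam (ofCoord q A₀) T ψ) :
    ∃ Y : ℝ → L2Space N, Y 0 = A₀ ∧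
      (∀ t ∈ Icc 0 T, HasDerivWithinAt Y (interactionField hq η lam t (Y t)) (Icc 0 T) t) ∧
      ∀ t ∈ Icc 0 T, ψ t = ofCoord q (bmul (symB N t) (Y t)) := by
  obtain ⟨G, hG, hGψ⟩ := h.memLinfty
  set μ := (volume : Measure ℝ).restrict (Ioo 0 T) with hμ
  -- The vector field along `ψ`, written through the measurable representative `G`, since `ψ` agrees
  -- with it only at almost every time.
  set g : ℝ → L2Space N := fun s =>
    -(Complex.I * (lam : ℂ)) • bmul (symB N (-s)) (powCoord hq η (𝓕 (G s))) with hg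
  have hmeas : AEStronglyMeasurable g μ := by
    have h1 : AEStronglyMeasurable (fun s => powCoord hq η (𝓕 (G s) : L2Space N)) μ :=
      ((lipOnBalls_powCoord hq η).continuous.comp
        (Lp.fourierTransformₗᵢ (RSpace N) ℂ).continuous).comp_aestronglyMeasurable hG.1
    have h2 : AEStronglyMeasurable (fun s : ℝ => -s) μ := by fun_prop
    exact (continuous_bmul_symB.comp_aestronglyMeasurable (h2.prodMk h1)).const_smul
      (-(Complex.I * (lam : ℂ)))
  have hgint : Integrable g μ := by
    set R : ℝ := (eLpNorm G ⊤ μ).toReal with hR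
    obtain ⟨M, hM⟩ := (lipOnBalls_powCoord (N := N) hq η).exists_bound R
    refine Integrable.of_bound hmeas (|lam| * M) ?_
    have hGb : ∀ᵐ s ∂μ, ‖G s‖ ≤ R := by
      filter_upwards [enorm_ae_le_eLpNormEssSup G μ] with s hs
      rw [hR, eLpNorm_exponent_top, ← toReal_enorm]
      exact ENNReal.toReal_mono (by simpa using hG.2.ne) hs
    filter_upwards [hGb] with s hs
    rw [hg]
    simp only [norm_smul, norm_neg, norm_I_mul_ofReal, norm_bmul_symB]
    gcongr
    apply hM
    simpa using hs
  have hgI : ∀ t ∈ Icc 0 T, IntervalIntegrable g volume 0 t := by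
    intro t ht
    rw [intervalIntegrable_iff_integrableOn_Ioo_of_le ht.1]
    exact IntegrableOn.mono_set (t := Ioo 0 T) hgint (Ioo_subset_Ioo_right ht.2)
  have hψG : ∀ᵐ s ∂μ, ψ s = ofCoord q (𝓕 (G s)) := by
    filter_upwards [hGψ] with s hs
    exact (besselPotential_eq_iff q _ _).1 hs
  set Y : ℝ → L2Space N := fun t => A₀ + ∫ s in (0 : ℝ)..t, g s with hYdef
  have hψY : ∀ t ∈ Icc 0 T, ψ t = ofCoord q (bmul (symB N t) (Y t)) := by
    intro t ht
    rw [h.duhamel t ht, hYdef]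
    simp only [map_add]
    rw [freePropagator_ofCoord, sub_eq_add_neg]
    congr 1
    have h3 := (ofCoord q ∘L bmul (symB N t)).intervalIntegral_comp_comm (hgI t ht)
    simp only [ContinuousLinearMap.comp_apply] at h3
    rw [← h3, ← intervalIntegral.integral_smul, ← intervalIntegral.integral_neg]
    apply intervalIntegral.integral_congr_ae
    rw [uIoc_of_le ht.1]
    have h4 : ∀ᵐ s ∂volume.restrict (Ioc 0 t), ψ s = ofCoord q (𝓕 (G s)) := by
      rw [Measure.restrict_congr_set Ioo_ae_eq_Ioc.symm]
      exact ae_restrict_of_ae_restrict_of_subset (Ioo_subset_Ioo_right ht.2) hψG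
    filter_upwards [(ae_restrict_iff' measurableSet_Ioc).1 h4] with s hs hs'
    rw [hs hs', powerNonlinearity_ofCoord hq, freePropagator_ofCoord, hg]
    simp only [neg_smul, map_neg, map_smul, bmul_symB_symB, ← sub_eq_add_neg]
  have hcY : ContinuousOn Y (Icc 0 T) := by
    rcases le_or_gt 0 T with hT | hT
    · refine continuousOn_const.add ?_
      have := intervalIntegral.continuousOn_primitive_interval' (hgI T ⟨hT, le_rfl⟩)
        (left_mem_uIcc)
      rwa [uIcc_of_le hT] at this
    · simp [Icc_eq_empty_of_lt hT]
  -- At almost every time both `𝓕 (G s)` and the evolved `Y s` are coordinates of `ψ s`; injectivity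
  -- of `ofCoord` makes them equal.
  have hgY : ∀ᵐ s ∂μ, g s = interactionField hq η lam s (Y s) := by
    filter_upwards [hψG, ae_restrict_mem measurableSet_Ioo] with s hs hs'
    have h5 := hs.symm.trans (hψY s (Ioo_subset_Icc_self hs'))
    rw [hg, interactionField, ← ofCoord_injective q h5]
  have hcF := continuousOn_interactionField hq η lam hcY
  have hYeq : ∀ t ∈ Icc 0 T, Y t = A₀ + ∫ s in (0 : ℝ)..t, interactionField hq η lam s (Y s) := by
    intro t ht
    rw [hYdef]
    simp only
    congr 1
    apply intervalIntegral.integral_congr_ae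
    rw [uIoc_of_le ht.1]
    have h4 : ∀ᵐ s ∂volume.restrict (Ioc 0 t), g s = interactionField hq η lam s (Y s) := by
      rw [Measure.restrict_congr_set Ioo_ae_eq_Ioc.symm]
      exact ae_restrict_of_ae_restrict_of_subset (Ioo_subset_Ioo_right ht.2) hgY
    exact (ae_restrict_iff' measurableSet_Ioc).1 h4
  refine ⟨Y, by simp [hYdef], fun t ht => ?_, hψY⟩
  have hT : 0 ≤ T := ht.1.trans ht.2
  have h6 : HasDerivWithinAt (fun t => ∫ s in (0 : ℝ)..t, interactionField hq η lam s (Y s))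
      (interactionField hq η lam t (Y t)) (Icc 0 T) t := by
    have : Fact (t ∈ Icc 0 T) := ⟨ht⟩
    apply intervalIntegral.integral_hasDerivWithinAt_right
    · refine (hcF.mono ?_).intervalIntegrable
      rw [uIcc_of_le ht.1]
      exact Icc_subset_Icc_right ht.2
    · exact hcF.stronglyMeasurableAtFilter_nhdsWithin measurableSet_Icc t
    · exact hcF t ht
  exact (h6.const_add A₀).congr hYeq (hYeq t ht)

theorem MemSobolev.exists_ofCoord {q : ℕ} {f : L2Space N}
    (h : MemSobolev (q : ℝ) 2 (f : 𝓢'(RSpace N, ℂ))) : ∃ A, f = ofCoord q A := by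
  obtain ⟨G, hG⟩ := h
  exact ⟨𝓕 G, (besselPotential_eq_iff q f G).1 hG⟩

theorem isMildSolution_unique {q : ℕ} (hq : (N : ℝ) / 2 < q) {η : ℕ} {lam : ℝ}
    {T : ℝ} {A₀ : L2Space N} {ψ₁ ψ₂ : ℝ → L2Space N}
    (h₁ : IsMildSolution η q lam (ofCoord q A₀) T ψ₁)
    (h₂ : IsMildSolution η q lam (ofCoord q A₀) T ψ₂) : ∀ t ∈ Icc 0 T, ψ₁ t = ψ₂ t := by
  obtain ⟨Y, hY0, hY, hψY⟩ := h₁.exists_interaction hq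
  obtain ⟨Z, hZ0, hZ, hψZ⟩ := h₂.exists_interaction hq
  intro t ht
  rw [hψY t ht, hψZ t ht, interaction_solution_unique hq η lam (hY0.trans hZ0.symm) hY hZ ht]

/-! ### Derivatives in `L^p` -/

/-- The standard basis vectors of `ℝ^N`. -/
def basisVec (i : Fin N) : RSpace N := EuclideanSpace.single i 1

theorem norm_basisVec (i : Fin N) : ‖basisVec i‖ = 1 := by simp [basisVec]

theorem inner_basisVec (i : Fin N) (x : RSpace N) : inner ℝ x (basisVec i) = x i := by
  simp [basisVec, EuclideanSpace.inner_single_right]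

section

variable {F : Type*} [NormedAddCommGroup F]

theorem aestronglyMeasurable_shift {u : RSpace N → F} (hu : AEStronglyMeasurable u volume)
    (a : RSpace N) : AEStronglyMeasurable (fun x => u (x + a)) volume :=
  hu.comp_measurePreserving (measurePreserving_add_const a)

theorem eLpNorm_shift {p : ℝ≥0∞} {u : RSpace N → F} (hu : AEStronglyMeasurable u volume)
    (a : RSpace N) : eLpNorm (fun x => u (x + a)) p volume = eLpNorm u p volume :=
  eLpNorm_comp_measurePreserving hu (measurePreserving_add_const a)

theorem MeasureTheory.MemLp.shift {p : ℝ≥0∞} {u : RSpace N → F} (hu : MemLp u p)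
    (a : RSpace N) : MemLp (fun x => u (x + a)) p :=
  hu.comp_measurePreserving (measurePreserving_add_const a)

theorem tendsto_eLpNorm_add_zero {ι : Type*} {l : Filter ι} {p : ℝ≥0∞} (hp : 1 ≤ p)
    {f g : ι → RSpace N → F} (hf : ∀ᶠ n in l, AEStronglyMeasurable (f n) volume)
    (hg : ∀ᶠ n in l, AEStronglyMeasurable (g n) volume)
    (hf0 : Tendsto (fun n => eLpNorm (f n) p volume) l (𝓝 0))
    (hg0 : Tendsto (fun n => eLpNorm (g n) p volume) l (𝓝 0)) :
    Tendsto (fun n => eLpNorm (fun x => f n x + g n x) p volume) l (𝓝 0) := by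
  refine tendsto_of_tendsto_of_tendsto_of_le_of_le' tendsto_const_nhds
    (by simpa using hf0.add hg0) (Eventually.of_forall fun _ => zero_le) ?_
  filter_upwards [hf, hg] with n h1 h2
  exact eLpNorm_add_le h1 h2 hp

/-- Continuity of translations in `L^p`. -/
theorem tendsto_eLpNorm_shift_sub {p : ℝ≥0∞} (hp1 : 1 ≤ p) (hp : p ≠ ⊤) {u : RSpace N → F}
    (hu : MemLp u p) (e : RSpace N) :
    Tendsto (fun h : ℝ => eLpNorm (fun x => u (x + h • e) - u x) p volume) (𝓝 0) (𝓝 0) := by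
  have : Fact (1 ≤ p) := ⟨hp1⟩
  have hg : Continuous fun h : ℝ => (⟨fun x => x + h • e, by fun_prop⟩ : C(RSpace N, RSpace N)) :=
    ContinuousMap.continuous_of_continuous_uncurry _ (by
      simp only [Function.uncurry_def, ContinuousMap.coe_mk]; fun_prop)
  have h1 := Continuous.compMeasurePreservingLp (μ := volume) (ν := volume) (p := p)
    (f := fun _ : ℝ => hu.toLp u) continuous_const hg
    (fun h => measurePreserving_add_const (h • e)) hp
  have h2 := (Lp.tendsto_Lp_iff_tendsto_eLpNorm' _ _).1 (h1.tendsto 0)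
  refine h2.congr fun h => ?_
  apply eLpNorm_congr_ae
  simp only [Lp.toLp_compMeasurePreserving]
  filter_upwards [(hu.comp_measurePreserving (measurePreserving_add_const (h • e))).coeFn_toLp,
    (hu.comp_measurePreserving (measurePreserving_add_const ((0 : ℝ) • e))).coeFn_toLp]
    with x h3 h4
  rw [Pi.sub_apply]
  refine (congrArg₂ (· - ·) h3 h4).trans ?_
  simp

variable [NormedSpace ℝ F]

/-- `v` is the partial derivative `∂ᵢ u` as a limit of difference quotients in `L^p`. -/
structure HasLpPartial (p : ℝ≥0∞) (i : Fin N) (u v : RSpace N → F) : Prop where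
  memLp_left : MemLp u p
  memLp_right : MemLp v p
  tendsto : Tendsto (fun h : ℝ => eLpNorm
    (fun x => h⁻¹ • (u (x + h • basisVec i) - u x) - v x) p volume) (𝓝[≠] 0) (𝓝 0)

namespace HasLpPartial

variable {p : ℝ≥0∞} {i : Fin N} {u v : RSpace N → F}

theorem aestronglyMeasurable_quot (h : HasLpPartial p i u v) (t : ℝ) :
    AEStronglyMeasurable (fun x => t⁻¹ • (u (x + t • basisVec i) - u x)) volume :=
  ((aestronglyMeasurable_shift h.memLp_left.1 _).sub h.memLp_left.1).const_smul _

theorem memLp_quot (h : HasLpPartial p i u v) (t : ℝ) :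
    MemLp (fun x => t⁻¹ • (u (x + t • basisVec i) - u x)) p volume :=
  ((h.memLp_left.shift _).sub h.memLp_left).const_smul _

theorem congr {u' v' : RSpace N → F} (h : HasLpPartial p i u v) (hu : u =ᵐ[volume] u')
    (hv : v =ᵐ[volume] v') : HasLpPartial p i u' v' := by
  refine ⟨(memLp_congr_ae hu).1 h.memLp_left, (memLp_congr_ae hv).1 h.memLp_right,
    h.tendsto.congr fun t => eLpNorm_congr_ae ?_⟩
  filter_upwards [hu, hv,
    (measurePreserving_add_const (t • basisVec i)).quasiMeasurePreserving.ae hu] with x h1 h2 h3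
  rw [h1, h2, h3]

theorem clm_comp {G : Type*} [NormedAddCommGroup G] [NormedSpace ℝ G] (L : F →L[ℝ] G)
    (h : HasLpPartial p i u v) : HasLpPartial p i (fun x => L (u x)) (fun x => L (v x)) := by
  refine ⟨L.comp_memLp' h.memLp_left, L.comp_memLp' h.memLp_right, ?_⟩
  have h1 : Tendsto (fun t : ℝ => (‖L‖ₑ) * eLpNorm
      (fun x => t⁻¹ • (u (x + t • basisVec i) - u x) - v x) p volume) (𝓝[≠] 0) (𝓝 0) := by
    simpa using ENNReal.Tendsto.const_mul h.tendsto (Or.inr enorm_ne_top)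
  refine tendsto_of_tendsto_of_tendsto_of_le_of_le tendsto_const_nhds h1
    (fun _ => zero_le) fun t => ?_
  have h2 : ∀ x, t⁻¹ • (L (u (x + t • basisVec i)) - L (u x)) - L (v x)
      = L (t⁻¹ • (u (x + t • basisVec i) - u x) - v x) := fun x => by simp
  simp only [h2]
  rw [← ofReal_norm]
  exact eLpNorm_le_mul_eLpNorm_of_ae_le_mul (ae_of_all _ fun x => L.le_opNorm _) p

/-- A derivative in `L¹` has integral zero. -/
theorem integral_eq_zero [CompleteSpace F] (h : HasLpPartial 1 i u v) : ∫ x, v x = 0 := by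
  have hu : Integrable u := memLp_one_iff_integrable.1 h.memLp_left
  have hv : Integrable v := memLp_one_iff_integrable.1 h.memLp_right
  -- By translation invariance every difference quotient has integral zero, so the integral of `v`
  -- is controlled by the `L¹` distance of `v` from the quotient.
  have h1 : ∀ t : ℝ, ‖∫ x, v x‖ₑ ≤ eLpNorm
      (fun x => t⁻¹ • (u (x + t • basisVec i) - u x) - v x) 1 volume := by
    intro t
    have hq := memLp_one_iff_integrable.1 (h.memLp_quot t)
    have h2 : ∫ x, (t⁻¹ • (u (x + t • basisVec i) - u x) - v x) = - ∫ x, v x := by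
      rw [integral_sub hq hv, integral_smul, integral_sub (hu.comp_add_right _) hu,
        integral_add_right_eq_self u, sub_self, smul_zero, zero_sub]
    rw [eLpNorm_one_eq_lintegral_enorm, ← enorm_neg, ← h2]
    exact enorm_integral_le_lintegral_enorm _
  have h3 : ‖∫ x, v x‖ₑ ≤ 0 := ge_of_tendsto' h.tendsto h1
  simpa using h3

/-- The difference quotient is moved onto the test function, where it converges under a fixed
dominating function. The exponent `p' = ⊤` covers `p = 1`, and `p' = 2` covers `p = 2`. -/
theorem isWeakPartial [CompleteSpace F] {p' : ℝ≥0∞} [ENNReal.HolderConjugate p' p]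
    (h : HasLpPartial p i u v) : IsWeakPartial i u v := by
  have hp1 : 1 ≤ p := ENNReal.HolderConjugate.one_le p p'
  have lu : LocallyIntegrable u := h.memLp_left.locallyIntegrable hp1
  have lv : LocallyIntegrable v := h.memLp_right.locallyIntegrable hp1
  refine ⟨lu, lv, fun φ hφ hc => ?_⟩
  have hφm : MemLp φ p' (volume : Measure (RSpace N)) := hφ.continuous.memLp_of_hasCompactSupport hc
  have pair : ∀ w : RSpace N → F, MemLp w p → Integrable fun x => φ x • w x := fun w hw =>
    memLp_one_iff_integrable.1 (hw.smul hφm)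
  -- the pairing with the difference quotients converges
  have h1 : Tendsto (fun t : ℝ => ∫ x, φ x • (t⁻¹ • (u (x + t • basisVec i) - u x)))
      (𝓝[≠] 0) (𝓝 (∫ x, φ x • v x)) := by
    rw [tendsto_iff_edist_tendsto_0]
    have h2 : Tendsto (fun t : ℝ => eLpNorm φ p' volume * eLpNorm
        (fun x => t⁻¹ • (u (x + t • basisVec i) - u x) - v x) p volume) (𝓝[≠] 0) (𝓝 0) := by
      simpa using ENNReal.Tendsto.const_mul h.tendsto (Or.inr hφm.2.ne)
    refine tendsto_of_tendsto_of_tendsto_of_le_of_le tendsto_const_nhds h2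
      (fun _ => zero_le) fun t => ?_
    rw [edist_eq_enorm_sub, ← integral_sub (pair _ (h.memLp_quot t)) (pair _ h.memLp_right)]
    simp only [← smul_sub]
    refine (enorm_integral_le_lintegral_enorm _).trans ?_
    rw [← eLpNorm_one_eq_lintegral_enorm]
    exact eLpNorm_smul_le_mul_eLpNorm ((h.aestronglyMeasurable_quot t).sub h.memLp_right.1) hφm.1
  -- the discrete integration by parts
  have h3 : ∀ t : ℝ, ∫ x, φ x • (t⁻¹ • (u (x + t • basisVec i) - u x))
      = ∫ x, (t⁻¹ * (φ (x - t • basisVec i) - φ x)) • u x := by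
    intro t
    have i1 := pair _ (h.memLp_left.shift (t • basisVec i))
    have i2 := pair _ h.memLp_left
    have i3 : Integrable fun x => φ (x - t • basisVec i) • u x := by
      have := i1.comp_sub_right (t • basisVec i)
      simpa using this
    have e1 : ∫ x, φ x • u (x + t • basisVec i) = ∫ x, φ (x - t • basisVec i) • u x := by
      rw [← integral_sub_right_eq_self (fun x => φ x • u (x + t • basisVec i)) (t • basisVec i)]
      simp
    calc _ = ∫ x, t⁻¹ • (φ x • u (x + t • basisVec i) - φ x • u x) := by
          congr 1; ext x; rw [smul_comm, smul_sub]
      _ = t⁻¹ • ((∫ x, φ (x - t • basisVec i) • u x) - ∫ x, φ x • u x) := by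
          rw [integral_smul, integral_sub i1 i2, e1]
      _ = _ := by
          rw [← integral_sub i3 i2, ← integral_smul]
          congr 1; ext x; rw [mul_smul, sub_smul]
  obtain ⟨C, hC⟩ := hφ.lipschitzWith_of_hasCompactSupport hc (by simp)
  -- For `|t| ≤ 1` the quotients of `φ` vanish outside this compact set and are bounded by the
  -- Lipschitz constant `C`.
  set K := Metric.cthickening 1 (tsupport φ) with hK
  have hKc : IsCompact K := hc.isCompact.cthickening
  have h4 : Tendsto (fun t : ℝ => ∫ x, (t⁻¹ * (φ (x - t • basisVec i) - φ x)) • u x)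
      (𝓝[≠] 0) (𝓝 (∫ x, (-(fderiv ℝ φ x (basisVec i))) • u x)) := by
    refine tendsto_integral_filter_of_dominated_convergence
      (fun x => K.indicator (fun x => C * ‖u x‖) x) ?_ ?_ ?_ ?_
    · refine Eventually.of_forall fun t => ?_
      have := hφ.continuous
      exact (by fun_prop : Continuous fun x => t⁻¹ * (φ (x - t • basisVec i) - φ x)
        ).aestronglyMeasurable.smul lu.aestronglyMeasurable
    · have : ∀ᶠ t : ℝ in 𝓝[≠] 0, |t| ≤ 1 ∧ t ≠ 0 := by
        refine Filter.Eventually.and ?_ self_mem_nhdsWithin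
        apply eventually_nhdsWithin_of_eventually_nhds
        filter_upwards [Metric.closedBall_mem_nhds (0 : ℝ) one_pos] with t ht
        simpa using ht
      filter_upwards [this] with t ⟨ht, ht0⟩
      refine ae_of_all _ fun x => ?_
      have hd : dist x (x - t • basisVec i) ≤ 1 := by
        simpa [dist_eq_norm, norm_smul, norm_basisVec] using ht
      by_cases hx : x ∈ K
      · rw [indicator_of_mem hx, norm_smul, norm_mul, norm_inv]
        gcongr
        have := hC.dist_le_mul (x - t • basisVec i) x
        rw [dist_eq_norm, dist_eq_norm, sub_sub_cancel_left, norm_neg, norm_smul, norm_basisVec,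
          mul_one] at this
        rw [inv_mul_le_iff₀ (by positivity), mul_comm]
        exact this
      · have hx1 : x ∉ tsupport φ := fun h => hx (Metric.self_subset_cthickening _ h)
        have hx2 : x - t • basisVec i ∉ tsupport φ := fun h =>
          hx (Metric.mem_cthickening_of_dist_le x _ 1 _ h hd)
        rw [indicator_of_notMem hx, image_eq_zero_of_notMem_tsupport hx1,
          image_eq_zero_of_notMem_tsupport hx2]
        simp
    · exact (integrable_indicator_iff hKc.measurableSet).2
        ((lu.integrableOn_isCompact hKc).norm.const_mul _)
    · refine ae_of_all _ fun x => Tendsto.smul_const ?_ _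
      have hd : HasDerivAt (fun t : ℝ => φ (x - t • basisVec i)) (-(fderiv ℝ φ x (basisVec i))) 0 := by
        have h5 : HasDerivAt (fun t : ℝ => x - t • basisVec i) (-(basisVec i)) 0 := by
          simpa using ((hasDerivAt_id (0 : ℝ)).smul_const (basisVec i)).const_sub x
        have h6 : HasFDerivAt φ (fderiv ℝ φ x) (x - (0 : ℝ) • basisVec i) := by
          simpa using (hφ.differentiable (by simp) x).hasFDerivAt
        simpa [Function.comp_def] using h6.comp_hasDerivAt (0 : ℝ) h5
      have := hd.tendsto_slope_zero
      simpa using this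
  have h5 := tendsto_nhds_unique (h1.congr h3) h4
  rw [h5]
  simp only [neg_smul, integral_neg, neg_neg]
  rfl

end HasLpPartial

end

/-! ### Products of functions with derivatives in `L^p` -/

theorem tendsto_eLpNorm_one_mul {ι : Type*} {l : Filter ι} {f g : ι → RSpace N → ℂ} {C : ℝ≥0∞}
    (hC : C ≠ ⊤) (hf : ∀ n, AEStronglyMeasurable (f n) volume)
    (hg : ∀ n, AEStronglyMeasurable (g n) volume)
    (hfC : ∀ n, eLpNorm (f n) 2 volume ≤ C)
    (hg0 : Tendsto (fun n => eLpNorm (g n) 2 volume) l (𝓝 0)) :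
    Tendsto (fun n => eLpNorm (fun x => f n x * g n x) 1 volume) l (𝓝 0) := by
  have h1 : Tendsto (fun n => C * eLpNorm (g n) 2 volume) l (𝓝 0) := by
    simpa using ENNReal.Tendsto.const_mul hg0 (Or.inr hC)
  refine tendsto_of_tendsto_of_tendsto_of_le_of_le tendsto_const_nhds h1
    (fun _ => zero_le) fun n => ?_
  refine (eLpNorm_smul_le_mul_eLpNorm (p := 2) (q := 2) (r := 1) (hg n) (hf n)).trans ?_
  gcongr
  exact hfC n

theorem tendsto_eLpNorm_bdd_mul {ι : Type*} {l : Filter ι} {f g : ι → RSpace N → ℂ} {M : ℝ}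
    (p : ℝ≥0∞) (hfM : ∀ n x, ‖f n x‖ ≤ M)
    (hg0 : Tendsto (fun n => eLpNorm (g n) p volume) l (𝓝 0)) :
    Tendsto (fun n => eLpNorm (fun x => f n x * g n x) p volume) l (𝓝 0) := by
  have h1 : Tendsto (fun n => ENNReal.ofReal M * eLpNorm (g n) p volume) l (𝓝 0) := by
    simpa using ENNReal.Tendsto.const_mul hg0 (Or.inr ENNReal.ofReal_ne_top)
  refine tendsto_of_tendsto_of_tendsto_of_le_of_le tendsto_const_nhds h1
    (fun _ => zero_le) fun n => ?_
  refine eLpNorm_le_mul_eLpNorm_of_ae_le_mul (ae_of_all _ fun x => ?_) p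
  rw [norm_mul]
  gcongr
  exact hfM n x

theorem MeasureTheory.MemLp.bdd_mul_two {u w : RSpace N → ℂ} {M : ℝ} {p : ℝ≥0∞}
    (hu : AEStronglyMeasurable u volume) (hM : ∀ x, ‖u x‖ ≤ M) (hw : MemLp w p) :
    MemLp (fun x => u x * w x) p :=
  MemLp.of_le_mul (c := M) hw (hu.mul hw.1) (ae_of_all _ fun x => by
    rw [norm_mul]; gcongr; exact hM x)

namespace HasLpPartial

variable {i : Fin N} {u u' w w' : RSpace N → ℂ}

theorem memLp_mul_one (hu : HasLpPartial 2 i u u') (hw : HasLpPartial 2 i w w') :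
    MemLp (fun x => u x * w x) 1 ∧ MemLp (fun x => u x * w' x + u' x * w x) 1 := by
  simp only [memLp_one_iff_integrable]
  exact ⟨hu.memLp_left.integrable_mul hw.memLp_left,
    (hu.memLp_left.integrable_mul hw.memLp_right).add (hu.memLp_right.integrable_mul hw.memLp_left)⟩

/-- Product rule for two functions with derivatives in `L²`. -/
theorem mul_one (hu : HasLpPartial 2 i u u') (hw : HasLpPartial 2 i w w') :
    HasLpPartial 1 i (fun x => u x * w x) (fun x => u x * w' x + u' x * w x) := by
  refine ⟨(memLp_mul_one hu hw).1, (memLp_mul_one hu hw).2, ?_⟩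
  have mu := hu.memLp_left.1
  have mw := hw.memLp_left.1
  have mu' := hu.memLp_right.1
  have mw' := hw.memLp_right.1
  -- With `D` the difference quotient and `u₊` the translate, the error of the product rule is `u₊
  -- (D w - w') + w' (u₊ - u) + w (D u - u')`; the three terms are treated in turn.
  have t1 := tendsto_eLpNorm_one_mul (l := 𝓝[≠] (0 : ℝ))
    (f := fun t x => u (x + t • basisVec i)) hu.memLp_left.2.ne
    (fun t => aestronglyMeasurable_shift mu _)
    (fun t => (hw.aestronglyMeasurable_quot t).sub mw') (fun t => (eLpNorm_shift mu _).le)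
    hw.tendsto
  have t2 := tendsto_eLpNorm_one_mul (l := 𝓝[≠] (0 : ℝ)) (f := fun _ => w') hw.memLp_right.2.ne
    (fun _ => mw') (fun t => (aestronglyMeasurable_shift mu (t • basisVec i)).sub mu)
    (fun _ => le_rfl) ((tendsto_eLpNorm_shift_sub (by norm_num) (by norm_num) hu.memLp_left
      (basisVec i)).mono_left nhdsWithin_le_nhds)
  have t3 := tendsto_eLpNorm_one_mul (l := 𝓝[≠] (0 : ℝ)) (f := fun _ => w) hw.memLp_left.2.ne
    (fun _ => mw) (fun t => (hu.aestronglyMeasurable_quot t).sub mu') (fun _ => le_rfl) hu.tendsto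
  have m1 : ∀ t : ℝ, AEStronglyMeasurable (fun x => u (x + t • basisVec i) *
      (t⁻¹ • (w (x + t • basisVec i) - w x) - w' x)) volume := fun t =>
    (aestronglyMeasurable_shift mu _).mul ((hw.aestronglyMeasurable_quot t).sub mw')
  have m2 : ∀ t : ℝ, AEStronglyMeasurable (fun x => w' x * (u (x + t • basisVec i) - u x)) volume :=
    fun t => mw'.mul ((aestronglyMeasurable_shift mu _).sub mu)
  have m3 : ∀ t : ℝ, AEStronglyMeasurable (fun x => w x *
      (t⁻¹ • (u (x + t • basisVec i) - u x) - u' x)) volume := fun t =>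
    mw.mul ((hu.aestronglyMeasurable_quot t).sub mu')
  have := tendsto_eLpNorm_add_zero le_rfl (Eventually.of_forall fun t => (m1 t).add (m2 t))
    (Eventually.of_forall m3) (tendsto_eLpNorm_add_zero le_rfl (Eventually.of_forall m1)
      (Eventually.of_forall m2) t1 t2) t3
  refine this.congr fun t => ?_
  congr 1
  ext x
  simp only [Pi.add_apply, Complex.real_smul]
  ring

/-- Product rule for two bounded functions with derivatives in `L²`. -/
theorem mul_bdd (hu : HasLpPartial 2 i u u') (hw : HasLpPartial 2 i w w') {M : ℝ}
    (cu : Continuous u) (bu : ∀ x, ‖u x‖ ≤ M) (bw : ∀ x, ‖w x‖ ≤ M) :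
    HasLpPartial 2 i (fun x => u x * w x) (fun x => u x * w' x + u' x * w x) := by
  have mu := hu.memLp_left.1
  have mw := hw.memLp_left.1
  have mu' := hu.memLp_right.1
  have mw' := hw.memLp_right.1
  refine ⟨hw.memLp_left.bdd_mul_two mu bu, (hw.memLp_right.bdd_mul_two mu bu).add ?_, ?_⟩
  · simpa only [mul_comm] using hu.memLp_right.bdd_mul_two mw bw
  have t1 := tendsto_eLpNorm_bdd_mul (l := 𝓝[≠] (0 : ℝ)) 2
    (f := fun t x => u (x + t • basisVec i)) (fun t x => bu _) hw.tendsto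
  have t3 := tendsto_eLpNorm_bdd_mul (l := 𝓝[≠] (0 : ℝ)) 2 (f := fun _ => w) (fun _ => bw)
    hu.tendsto
  have m1 : ∀ t : ℝ, AEStronglyMeasurable (fun x => u (x + t • basisVec i) *
      (t⁻¹ • (w (x + t • basisVec i) - w x) - w' x)) volume := fun t =>
    (aestronglyMeasurable_shift mu _).mul ((hw.aestronglyMeasurable_quot t).sub mw')
  have m2 : ∀ t : ℝ, AEStronglyMeasurable (fun x => w' x * (u (x + t • basisVec i) - u x)) volume :=
    fun t => mw'.mul ((aestronglyMeasurable_shift mu _).sub mu)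
  have m3 : ∀ t : ℝ, AEStronglyMeasurable (fun x => w x *
      (t⁻¹ • (u (x + t • basisVec i) - u x) - u' x)) volume := fun t =>
    mw.mul ((hu.aestronglyMeasurable_quot t).sub mu')
  -- Here `w'` is not bounded, so continuity of translations in `L²` does not suffice. Pointwise
  -- continuity of `u` and the bound `2M|w'|` give dominated convergence.
  have t2 : Tendsto (fun t : ℝ => eLpNorm (fun x => w' x * (u (x + t • basisVec i) - u x)) 2 volume)
      (𝓝[≠] 0) (𝓝 0) := by
    refine tendsto_eLpNorm_zero_of_dominated (by norm_num) (by norm_num)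
      (bound := fun x => ‖w' x‖ * (M + M)) (hw.memLp_right.norm.mul_const _)
      (Eventually.of_forall m2) (Eventually.of_forall fun t => ae_of_all _ fun x => ?_)
      (ae_of_all _ fun x => ?_)
    · rw [norm_mul]
      gcongr
      exact (norm_sub_le _ _).trans (add_le_add (bu _) (bu _))
    · have hc : Continuous fun t : ℝ => w' x * (u (x + t • basisVec i) - u x) := by fun_prop
      have := hc.tendsto 0
      simp only [zero_smul, add_zero, sub_self, mul_zero] at this
      exact this.mono_left nhdsWithin_le_nhds
  have := tendsto_eLpNorm_add_zero (by norm_num) (Eventually.of_forall fun t => (m1 t).add (m2 t))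
    (Eventually.of_forall m3) (tendsto_eLpNorm_add_zero (by norm_num) (Eventually.of_forall m1)
      (Eventually.of_forall m2) t1 t2) t3
  refine this.congr fun t => ?_
  congr 1
  ext x
  simp only [Pi.add_apply, Complex.real_smul]
  ring

/-- Product rule with the a weight that is affine along the direction. -/
theorem weight_mul {c : RSpace N → ℂ} (hc : ∀ x (t : ℝ), c (x + t • basisVec i) = c x + t)
    (hu : HasLpPartial 2 i u u') (hw : HasLpPartial 2 i w w')
    (xu : MemLp (fun x => c x * u x) 2)
    (xw : MemLp (fun x => c x * w x) 2) :
    HasLpPartial 1 i (fun x => c x * u x * w x)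
      (fun x => c x * u x * w' x + c x * w x * u' x + u x * w x) := by
  have mu := hu.memLp_left.1
  have mw := hw.memLp_left.1
  have mu' := hu.memLp_right.1
  have mw' := hw.memLp_right.1
  refine ⟨memLp_one_iff_integrable.2 (xu.integrable_mul hw.memLp_left),
    memLp_one_iff_integrable.2 (((xu.integrable_mul hw.memLp_right).add
      (xw.integrable_mul hu.memLp_right)).add (hu.memLp_left.integrable_mul hw.memLp_left)), ?_⟩
  have nb : 𝓝[≠] (0 : ℝ) ≤ 𝓝 0 := nhdsWithin_le_nhds
  -- Since `c₊ = c + t`, the quotient of `c u w` equals `c₊ w₊ D u + c u D w + u w₊`. In each of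
  -- these terms the weight stands beside a function whose weighted version is in `L²`.
  have t1 := tendsto_eLpNorm_one_mul (l := 𝓝[≠] (0 : ℝ))
    (f := fun t x => c (x + t • basisVec i) * w (x + t • basisVec i)) xw.2.ne
    (fun t => aestronglyMeasurable_shift xw.1 _)
    (fun t => (hu.aestronglyMeasurable_quot t).sub mu') (fun t => (eLpNorm_shift xw.1 _).le)
    hu.tendsto
  have t2 := tendsto_eLpNorm_one_mul (l := 𝓝[≠] (0 : ℝ)) (f := fun _ => u') hu.memLp_right.2.ne
    (fun _ => mu') (fun t => (aestronglyMeasurable_shift xw.1 (t • basisVec i)).sub xw.1)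
    (fun _ => le_rfl) ((tendsto_eLpNorm_shift_sub (by norm_num) (by norm_num) xw
      (basisVec i)).mono_left nb)
  have t3 := tendsto_eLpNorm_one_mul (l := 𝓝[≠] (0 : ℝ)) (f := fun _ x => c x * u x)
    xu.2.ne (fun _ => xu.1) (fun t => (hw.aestronglyMeasurable_quot t).sub mw') (fun _ => le_rfl)
    hw.tendsto
  have t4 := tendsto_eLpNorm_one_mul (l := 𝓝[≠] (0 : ℝ)) (f := fun _ => u) hu.memLp_left.2.ne
    (fun _ => mu) (fun t => (aestronglyMeasurable_shift mw (t • basisVec i)).sub mw)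
    (fun _ => le_rfl) ((tendsto_eLpNorm_shift_sub (by norm_num) (by norm_num) hw.memLp_left
      (basisVec i)).mono_left nb)
  have m1 : ∀ t : ℝ, AEStronglyMeasurable (fun x => c (x + t • basisVec i) *
      w (x + t • basisVec i) * (t⁻¹ • (u (x + t • basisVec i) - u x) - u' x)) volume := fun t =>
    (aestronglyMeasurable_shift xw.1 _).mul ((hu.aestronglyMeasurable_quot t).sub mu')
  have m2 : ∀ t : ℝ, AEStronglyMeasurable (fun x => u' x * (c (x + t • basisVec i) *
      w (x + t • basisVec i) - c x * w x)) volume :=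
    fun t => mu'.mul ((aestronglyMeasurable_shift xw.1 _).sub xw.1)
  have m3 : ∀ t : ℝ, AEStronglyMeasurable (fun x => c x * u x *
      (t⁻¹ • (w (x + t • basisVec i) - w x) - w' x)) volume := fun t =>
    xu.1.mul ((hw.aestronglyMeasurable_quot t).sub mw')
  have m4 : ∀ t : ℝ, AEStronglyMeasurable (fun x => u x * (w (x + t • basisVec i) - w x)) volume :=
    fun t => mu.mul ((aestronglyMeasurable_shift mw _).sub mw)
  have := tendsto_eLpNorm_add_zero le_rfl (Eventually.of_forall fun t => (m1 t).add (m2 t))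
    (Eventually.of_forall fun t => (m3 t).add (m4 t))
    (tendsto_eLpNorm_add_zero le_rfl (Eventually.of_forall m1) (Eventually.of_forall m2) t1 t2)
    (tendsto_eLpNorm_add_zero le_rfl (Eventually.of_forall m3) (Eventually.of_forall m4) t3 t4)
  clear t1 t2 t3 t4 m1 m2 m3 m4
  refine this.congr' ?_
  filter_upwards [self_mem_nhdsWithin] with t ht
  have ht' : (t : ℂ) ≠ 0 := by exact_mod_cast ht
  congr 1
  ext x
  simp only [Pi.add_apply, Complex.real_smul, hc, Complex.ofReal_inv]
  field_simp
  ring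

/-- Product rule with the weight `xᵢ`. -/
theorem coord_mul (hu : HasLpPartial 2 i u u') (hw : HasLpPartial 2 i w w')
    (xu : MemLp (fun x => ((x i : ℝ) : ℂ) * u x) 2)
    (xw : MemLp (fun x => ((x i : ℝ) : ℂ) * w x) 2) :
    HasLpPartial 1 i (fun x => ((x i : ℝ) : ℂ) * u x * w x)
      (fun x => ((x i : ℝ) : ℂ) * u x * w' x + ((x i : ℝ) : ℂ) * w x * u' x + u x * w x) :=
  weight_mul (fun x t => by simp [basisVec]) hu hw xu xw

/-- Powers of bounded functions with derivatives in `L²`. -/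
theorem pow_bdd (hu : HasLpPartial 2 i u u') {M : ℝ} (cu : Continuous u) (bu : ∀ x, ‖u x‖ ≤ M)
    (k : ℕ) : HasLpPartial 2 i (fun x => u x ^ (k + 1))
      (fun x => ((k : ℂ) + 1) * u x ^ k * u' x) := by
  induction k with
  | zero => simpa using hu
  | succ k ih =>
    have hM : 0 ≤ M := (norm_nonneg _).trans (bu 0)
    have bk : ∀ x, ‖u x ^ (k + 1)‖ ≤ M ^ (k + 1) := fun x => by
      rw [norm_pow]; exact pow_le_pow_left₀ (norm_nonneg _) (bu x) _
    have := mul_bdd (M := max M (M ^ (k + 1))) hu ih cu (fun x => (bu x).trans (le_max_left _ _))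
      (fun x => (bk x).trans (le_max_right _ _))
    refine this.congr (ae_of_all _ fun x => ?_) (ae_of_all _ fun x => ?_)
    · simp only; ring
    · simp only; push_cast; ring

/-- Integration by parts in `L²`. -/
theorem integral_mul_eq (hu : HasLpPartial 2 i u u') (hw : HasLpPartial 2 i w w') :
    ∫ x, u x * w' x = - ∫ x, u' x * w x := by
  have h := (mul_one hu hw).integral_eq_zero
  have i1 : Integrable fun x => u x * w' x := hu.memLp_left.integrable_mul hw.memLp_right
  have i2 : Integrable fun x => u' x * w x := hu.memLp_right.integrable_mul hw.memLp_left
  rw [integral_add i1 i2] at h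
  exact eq_neg_of_add_eq_zero_left h

theorem conj {p : ℝ≥0∞} (hu : HasLpPartial p i u u') :
    HasLpPartial p i (fun x => (starRingEnd ℂ) (u x)) (fun x => (starRingEnd ℂ) (u' x)) :=
  hu.clm_comp (Complex.conjCLE : ℂ →L[ℝ] ℂ)

end HasLpPartial

/-! ### Derivatives of Fourier multipliers -/

theorem norm_charB_sub_one_le (t : ℝ) (i : Fin N) (ξ : RSpace N) :
    ‖charB (t • basisVec i) ξ - 1‖ ≤ 2 * Real.pi * |ξ i| * |t| := by
  rw [charB_apply', inner_smul_right, inner_basisVec]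
  have := Real.norm_exp_I_mul_ofReal_sub_one_le (x := 2 * Real.pi * (t * ξ i))
  rw [show 2 * (Real.pi : ℂ) * ((t * ξ i : ℝ) : ℂ) * Complex.I
    = Complex.I * ((2 * Real.pi * (t * ξ i) : ℝ) : ℂ) by push_cast; ring]
  refine this.trans_eq ?_
  rw [Real.norm_eq_abs, abs_mul, abs_mul, abs_mul, abs_of_pos Real.pi_pos, abs_two]
  ring

theorem hasDerivAt_charB (i : Fin N) (ξ : RSpace N) :
    HasDerivAt (fun t : ℝ => charB (t • basisVec i) ξ) (2 * Real.pi * Complex.I * (ξ i : ℂ)) 0 := by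
  have h : ∀ t : ℝ, charB (t • basisVec i) ξ
      = Complex.exp ((t : ℂ) * (2 * Real.pi * Complex.I * (ξ i : ℂ))) := by
    intro t
    rw [charB_apply', inner_smul_right, inner_basisVec]
    congr 1
    push_cast
    ring
  simp only [h]
  have h1 : HasDerivAt (fun t : ℝ => (t : ℂ) * (2 * Real.pi * Complex.I * (ξ i : ℂ)))
      (2 * Real.pi * Complex.I * (ξ i : ℂ)) 0 := by
    simpa using (Complex.ofRealCLM.hasDerivAt (x := (0 : ℝ))).mul_const
      (2 * Real.pi * Complex.I * (ξ i : ℂ))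
  simpa using h1.cexp

/-- On the Fourier side the difference quotient is multiplication by `t⁻¹ (e^{2πi t ξᵢ} - 1) m(ξ)`.
This tends pointwise to `m'` and is dominated by it, as `|e^{iθ} - 1| ≤ |θ|`, so it converges
strongly. -/
theorem hasLpPartial_fourierInv {i : Fin N} {m m' : RSpace N →ᵇ ℂ}
    (hm : ∀ ξ, m' ξ = 2 * Real.pi * Complex.I * (ξ i : ℂ) * m ξ) (A : L2Space N) :
    HasLpPartial 2 i (𝓕⁻ (bmul m A) : L2Space N) (𝓕⁻ (bmul m' A) : L2Space N) := by
  refine ⟨Lp.memLp _, Lp.memLp _, ?_⟩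
  set M : ℝ → RSpace N →ᵇ ℂ := fun t => ((t⁻¹ : ℝ) : ℂ) • ((charB (t • basisVec i) - 1) * m) with hM
  have hMx : ∀ t ξ, M t ξ = ((t⁻¹ : ℝ) : ℂ) * ((charB (t • basisVec i) ξ - 1) * m ξ) :=
    fun t ξ => rfl
  have h1 : Tendsto (fun t => bmul (M t) A) (𝓝[≠] 0) (𝓝 (bmul m' A)) := by
    refine tendsto_bmul (C := ‖m'‖) ?_ ?_ A
    · filter_upwards [self_mem_nhdsWithin] with t ht ξ
      refine le_trans ?_ (m'.norm_coe_le_norm ξ)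
      have ht' : 0 < |t| := abs_pos.2 ht
      rw [hMx, hm, norm_mul, norm_mul, norm_mul, Complex.norm_real, norm_inv, Real.norm_eq_abs,
        ← mul_assoc]
      gcongr
      rw [inv_mul_le_iff₀ ht']
      refine (norm_charB_sub_one_le t i ξ).trans_eq ?_
      simp [abs_of_pos Real.pi_pos]
      ring
    · intro ξ
      have := (hasDerivAt_charB i ξ).tendsto_slope_zero.mul_const (m ξ)
      rw [hm]
      refine this.congr fun t => ?_
      rw [hMx, zero_smul, zero_add, Complex.real_smul, mul_assoc]
      congr 3
      simp [charB_apply]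
  have h2 := ((Lp.fourierTransformₗᵢ (RSpace N) ℂ).symm.continuous.tendsto _).comp h1
  have h3 := (Lp.tendsto_Lp_iff_tendsto_eLpNorm' _ _).1 h2
  refine h3.congr fun t => eLpNorm_congr_ae ?_
  have h4 : bmul (M t) A = (t⁻¹ : ℝ) • (bmul (charB (t • basisVec i)) (bmul m A) - bmul m A) := by
    apply Lp.ext
    filter_upwards [coeFn_bmul (M t) A, coeFn_bmul (charB (t • basisVec i)) (bmul m A),
      coeFn_bmul m A, Lp.coeFn_smul (t⁻¹ : ℝ)
        (bmul (charB (t • basisVec i)) (bmul m A) - bmul m A),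
      Lp.coeFn_sub (bmul (charB (t • basisVec i)) (bmul m A)) (bmul m A)] with ξ e1 e2 e3 e4 e5
    rw [e1, e4, Pi.smul_apply, e5, Pi.sub_apply, e2, e3, hMx, Complex.real_smul]
    ring
  have h5 : (𝓕⁻ (bmul (M t) A) : L2Space N)
      = (t⁻¹ : ℝ) • (shiftL2 (t • basisVec i) (𝓕⁻ (bmul m A)) - 𝓕⁻ (bmul m A)) := by
    rw [h4, ← fourierInv_bmul_charB]
    have := (Lp.fourierTransformₗᵢ (RSpace N) ℂ).symm.map_smul ((t⁻¹ : ℝ) : ℂ)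
      (bmul (charB (t • basisVec i)) (bmul m A) - bmul m A)
    rw [map_sub] at this
    exact this
  change (⇑(𝓕⁻ (bmul (M t) A) : L2Space N) - ⇑(𝓕⁻ (bmul m' A) : L2Space N)) =ᵐ[volume] _
  rw [h5]
  filter_upwards [Lp.coeFn_smul (t⁻¹ : ℝ)
      (shiftL2 (t • basisVec i) (𝓕⁻ (bmul m A)) - 𝓕⁻ (bmul m A)),
    Lp.coeFn_sub (shiftL2 (t • basisVec i) (𝓕⁻ (bmul m A))) (𝓕⁻ (bmul m A)),
    coeFn_shiftL2 (t • basisVec i) (𝓕⁻ (bmul m A))] with x e1 e2 e3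
  rw [Pi.sub_apply, e1, Pi.smul_apply, e2, Pi.sub_apply, e3]

/-! ### Galilean boosts -/

/-- Multiplication by a bounded continuous function of modulus one. -/
def bmulLI (m : RSpace N →ᵇ ℂ) (hm : ∀ x, ‖m x‖ = 1) : L2Space N →ₗᵢ[ℂ] L2Space N :=
  ⟨bmul m, norm_bmul_of_norm_eq_one m hm⟩

/-- The free Schrödinger group as a linear isometry. -/
def freeLI (t : ℝ) : L2Space N →ₗᵢ[ℂ] L2Space N :=
  (Lp.fourierTransformₗᵢ (RSpace N) ℂ).symm.toLinearIsometry.comp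
    ((bmulLI (symB N t) (norm_symB t)).comp (Lp.fourierTransformₗᵢ (RSpace N) ℂ).toLinearIsometry)

theorem freeLI_fourierInv (t : ℝ) (f : L2Space N) :
    freeLI t (𝓕⁻ f : L2Space N) = 𝓕⁻ (bmul (symB N t) f) :=
  freePropagator_fourierInv t f

theorem freeLI_ofCoord (q : ℕ) (t : ℝ) (A : L2Space N) :
    freeLI t (ofCoord q A) = ofCoord q (bmul (symB N t) A) :=
  freePropagator_ofCoord q t A

/-- The boost `e^{itΔ} e^{2πi b xᵢ} e^{-itΔ}`. -/
def boost (t b : ℝ) (i : Fin N) : L2Space N →ₗᵢ[ℂ] L2Space N :=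
  (freeLI t).comp ((bmulLI (charB (b • basisVec i)) (norm_charB _)).comp (freeLI (-t)))

/-- The factor `exp (i (2π b xᵢ - 4π² t b²))` of a boost. -/
def boostFactor (t b : ℝ) (i : Fin N) (x : RSpace N) : ℂ :=
  Complex.exp (Complex.I * ((2 * Real.pi * b * x i - 4 * Real.pi ^ 2 * t * b ^ 2 : ℝ) : ℂ))

theorem norm_boostFactor (t b : ℝ) (i : Fin N) (x : RSpace N) : ‖boostFactor t b i x‖ = 1 := by
  rw [boostFactor, mul_comm, Complex.norm_exp_ofReal_mul_I]

theorem boost_fourierInv (t b : ℝ) (i : Fin N) (B : L2Space N) :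
    boost t b i (𝓕⁻ B : L2Space N) =
      𝓕⁻ (bmul (symB N t) (shiftL2 (-(b • basisVec i)) (bmul (symB N (-t)) B))) := by
  change freeLI t (bmul (charB (b • basisVec i)) (freeLI (-t) (𝓕⁻ B : L2Space N))) = _
  rw [freeLI_fourierInv, bmul_charB_fourierInv, freeLI_fourierInv]

/-- The difference `|ξ - b eᵢ|² - |ξ|² = -2b ξᵢ + b²` is affine in `ξ`. Conjugating a frequency
shift by the quadratic phase therefore adds only a character and a constant phase. -/
theorem bmul_symB_shift (t b : ℝ) (i : Fin N) (B : L2Space N) :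
    bmul (symB N t) (shiftL2 (-(b • basisVec i)) (bmul (symB N (-t)) B)) =
      Complex.exp (Complex.I * ((4 * Real.pi ^ 2 * t * b ^ 2 : ℝ) : ℂ)) •
        bmul (charB ((-(4 * Real.pi * t) * b) • basisVec i)) (shiftL2 (-(b • basisVec i)) B) := by
  apply Lp.ext
  filter_upwards [coeFn_bmul (symB N t) (shiftL2 (-(b • basisVec i)) (bmul (symB N (-t)) B)),
    coeFn_shiftL2 (-(b • basisVec i)) (bmul (symB N (-t)) B),
    (measurePreserving_add_const (-(b • basisVec i))).quasiMeasurePreserving.ae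
      (coeFn_bmul (symB N (-t)) B),
    Lp.coeFn_smul (Complex.exp (Complex.I * ((4 * Real.pi ^ 2 * t * b ^ 2 : ℝ) : ℂ)))
      (bmul (charB ((-(4 * Real.pi * t) * b) • basisVec i)) (shiftL2 (-(b • basisVec i)) B)),
    coeFn_bmul (charB ((-(4 * Real.pi * t) * b) • basisVec i)) (shiftL2 (-(b • basisVec i)) B),
    coeFn_shiftL2 (-(b • basisVec i)) B] with ξ h1 h2 h3 h4 h5 h6
  rw [h1, h2, h3, h4, Pi.smul_apply, h5, h6, smul_eq_mul, ← mul_assoc, ← mul_assoc]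
  congr 1
  rw [symB_apply, symB_apply, charB_apply', schrodingerSymbol, schrodingerSymbol,
    ← Complex.exp_add, ← Complex.exp_add, inner_smul_right, inner_basisVec]
  congr 1
  have hn : ‖ξ + -(b • basisVec i)‖ ^ 2 = ‖ξ‖ ^ 2 - 2 * b * ξ i + b ^ 2 := by
    rw [← sub_eq_add_neg, norm_sub_sq_real, inner_smul_right, inner_basisVec, norm_smul,
      norm_basisVec, mul_one, Real.norm_eq_abs, sq_abs]
    ring
  rw [mul_pow (2 * Real.pi) ‖ξ + _‖, hn]
  push_cast
  ring

/-- The character produced on the Fourier side by `bmul_symB_shift` is a translation in space by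
`-4πtb`. This explicit form is what makes boosts compatible with pointwise nonlinearities. -/
theorem coeFn_boost (t b : ℝ) (i : Fin N) (f : L2Space N) :
    boost t b i f =ᵐ[volume]
      fun x => boostFactor t b i x * f (x + (-(4 * Real.pi * t) * b) • basisVec i) := by
  obtain ⟨B, rfl⟩ : ∃ B : L2Space N, f = 𝓕⁻ B := ⟨𝓕 f, (fourierInv_fourier_eq f).symm⟩
  set h : ℝ := -(4 * Real.pi * t) * b with hh
  have h1 : boost t b i (𝓕⁻ B : L2Space N) =
      Complex.exp (Complex.I * ((4 * Real.pi ^ 2 * t * b ^ 2 : ℝ) : ℂ)) •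
        shiftL2 (h • basisVec i) (bmul (charB (b • basisVec i)) (𝓕⁻ B)) := by
    rw [boost_fourierInv, bmul_symB_shift, bmul_charB_fourierInv, ← fourierInv_bmul_charB]
    exact (Lp.fourierTransformₗᵢ (RSpace N) ℂ).symm.map_smul _ _
  rw [h1]
  filter_upwards [Lp.coeFn_smul (Complex.exp (Complex.I * ((4 * Real.pi ^ 2 * t * b ^ 2 : ℝ) : ℂ)))
      (shiftL2 (h • basisVec i) (bmul (charB (b • basisVec i)) (𝓕⁻ B))),
    coeFn_shiftL2 (h • basisVec i) (bmul (charB (b • basisVec i)) (𝓕⁻ B)),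
    (measurePreserving_add_const (h • basisVec i)).quasiMeasurePreserving.ae
      (coeFn_bmul (charB (b • basisVec i)) (𝓕⁻ B))] with x h2 h3 h4
  rw [h2, Pi.smul_apply, h3, h4, smul_eq_mul, ← mul_assoc]
  congr 1
  rw [charB_apply', ← Complex.exp_add, inner_smul_right, inner_basisVec, boostFactor]
  congr 1
  have : (x + h • basisVec i) i = x i + h := by simp [basisVec]
  rw [this, hh]
  push_cast
  ring

/-! ### Boosts and the nonlinearity -/

/-- The pointwise nonlinearity `z ↦ |z|^{2k} z`. -/
def powMap (k : ℕ) (z : ℂ) : ℂ := ((‖z‖ ^ (2 * k) : ℝ) : ℂ) * z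

theorem lipOnBalls_powMap (k : ℕ) : LipOnBalls (powMap k) := by
  induction k with
  | zero =>
    have : powMap 0 = fun z => z := by ext z; simp [powMap]
    rw [this]
    exact LipschitzWith.id.lipOnBalls
  | succ k ih =>
    have : powMap (k + 1) = fun z => ContinuousLinearMap.mul ℂ ℂ z
        (ContinuousLinearMap.mul ℂ ℂ ((starRingEnd ℂ) z) (powMap k z)) := by
      ext z
      rw [ContinuousLinearMap.mul_apply', ContinuousLinearMap.mul_apply', ← mul_assoc,
        Complex.mul_conj, Complex.normSq_eq_norm_sq, powMap, powMap]
      push_cast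
      ring
    rw [this]
    exact LipOnBalls.bilin _ LipschitzWith.id.lipOnBalls
      (LipOnBalls.bilin _ (Complex.conjCLE : ℂ →L[ℝ] ℂ).lipschitz.lipOnBalls ih)

theorem powMap_mul_of_norm_eq_one {c : ℂ} (hc : ‖c‖ = 1) (k : ℕ) (z : ℂ) :
    powMap k (c * z) = c * powMap k z := by
  rw [powMap, powMap, norm_mul, hc, one_mul]
  ring

section

variable {q : ℕ} (hq : (N : ℝ) / 2 < q) (t b : ℝ) (i : Fin N) (A : L2Space N)

theorem coeFn_boost_ofCoord : boost t b i (ofCoord q A) =ᵐ[volume] fun x =>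
    boostFactor t b i x * contRep hq A (x + (-(4 * Real.pi * t) * b) • basisVec i) := by
  filter_upwards [coeFn_boost t b i (ofCoord q A),
    (measurePreserving_add_const ((-(4 * Real.pi * t) * b) • basisVec i)).quasiMeasurePreserving.ae
      (coeFn_ofCoord hq A)] with x h1 h2
  rw [h1, h2]

/-- Gauge covariance: the unimodular factor passes through `powMap`, and translations commute with
pointwise maps. -/
theorem coeFn_boost_powCoord_sub (k : ℕ) :
    (boost t b i (ofCoord q (powCoord hq k A)) - ofCoord q (powCoord hq k A) : L2Space N)
      =ᵐ[volume] fun x => powMap k (boostFactor t b i x *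
        contRep hq A (x + (-(4 * Real.pi * t) * b) • basisVec i)) - powMap k (contRep hq A x) := by
  filter_upwards [coeFn_boost_ofCoord hq t b i (powCoord hq k A),
    coeFn_ofCoord hq (powCoord hq k A), Lp.coeFn_sub (boost t b i (ofCoord q (powCoord hq k A)))
      (ofCoord q (powCoord hq k A))] with x h1 h2 h3
  rw [h3, Pi.sub_apply, h1, h2, contRep_powCoord, contRep_powCoord,
    powMap_mul_of_norm_eq_one (norm_boostFactor t b i x)]
  rfl

theorem coeFn_boost_sub :
    (boost t b i (ofCoord q A) - ofCoord q A : L2Space N) =ᵐ[volume] fun x => boostFactor t b i x *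
        contRep hq A (x + (-(4 * Real.pi * t) * b) • basisVec i) - contRep hq A x := by
  filter_upwards [coeFn_boost_ofCoord hq t b i A, coeFn_ofCoord hq A,
    Lp.coeFn_sub (boost t b i (ofCoord q A)) (ofCoord q A)] with x h1 h2 h3
  rw [h3, Pi.sub_apply, h1, h2]

/-- The Lipschitz bound for `powMap` on a disc is applied at every point, so only the supremum norm
of the solution enters and the constant does not depend on `b`. -/
theorem norm_boost_powCoord_sub_le {k : ℕ} {M : ℝ} {K : NNReal}
    (hK : LipschitzOnWith K (powMap k) (Metric.closedBall 0 M)) (hM : ‖contRep hq A‖ ≤ M) :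
    ‖boost t b i (ofCoord q (powCoord hq k A)) - ofCoord q (powCoord hq k A)‖
      ≤ K * ‖boost t b i (ofCoord q A) - ofCoord q A‖ := by
  refine Lp.norm_le_mul_norm_of_ae_le_mul ?_
  filter_upwards [coeFn_boost_powCoord_sub hq t b i A k, coeFn_boost_sub hq t b i A] with x h1 h2
  rw [h1, h2]
  have h3 : ∀ y, ‖contRep hq A y‖ ≤ M := fun y => ((contRep hq A).norm_coe_le_norm y).trans hM
  refine hK.norm_sub_le ?_ (by simpa using h3 x)
  simpa [norm_boostFactor] using h3 _

/-- Let `z` be the boosted value and `w` the original one. In `|z|^{2k}z - |w|^{2k}w = |z|^{2k}(z -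
w) + (|z|^{2k} - |w|^{2k})w` the first part is a real multiple of `z - w`, and the factor `i`
removes it from the real part. What remains is a product of two differences, the form needed for a
limit after division by `b²`. -/
theorem re_inner_boost_sub (k : ℕ) (lam : ℝ) :
    (inner ℂ (-(Complex.I * (lam : ℂ)) • (boost t b i (ofCoord q (powCoord hq k A))
        - ofCoord q (powCoord hq k A))) (boost t b i (ofCoord q A) - ofCoord q A)).re
      = -lam * (∫ x, ((‖contRep hq A (x + (-(4 * Real.pi * t) * b) • basisVec i)‖ ^ (2 * k)
          - ‖contRep hq A x‖ ^ (2 * k) : ℝ) : ℂ) * ((starRingEnd ℂ) (contRep hq A x) *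
          (boost t b i (ofCoord q A) - ofCoord q A : L2Space N) x)).im := by
  have hint := L2.integrable_inner (𝕜 := ℂ) (-(Complex.I * (lam : ℂ)) •
    (boost t b i (ofCoord q (powCoord hq k A)) - ofCoord q (powCoord hq k A)))
    (boost t b i (ofCoord q A) - ofCoord q A)
  have bdd : ∀ x, ‖((‖contRep hq A (x + (-(4 * Real.pi * t) * b) • basisVec i)‖ ^ (2 * k)
          - ‖contRep hq A x‖ ^ (2 * k) : ℝ) : ℂ)‖ ≤ 2 * ‖contRep hq A‖ ^ (2 * k) := by
    intro x
    have : ∀ y, ‖contRep hq A y‖ ^ (2 * k) ≤ ‖contRep hq A‖ ^ (2 * k) := fun y =>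
      pow_le_pow_left₀ (norm_nonneg _) ((contRep hq A).norm_coe_le_norm y) _
    rw [Complex.norm_real, Real.norm_eq_abs, abs_le]
    have h1 := this x
    have h2 := this (x + (-(4 * Real.pi * t) * b) • basisVec i)
    constructor <;> nlinarith [pow_nonneg (norm_nonneg (contRep hq A x)) (2 * k), pow_nonneg
      (norm_nonneg (contRep hq A (x + (-(4 * Real.pi * t) * b) • basisVec i))) (2 * k)]
  have i2 : Integrable fun x => ((‖contRep hq A (x + (-(4 * Real.pi * t) * b) • basisVec i)‖
      ^ (2 * k) - ‖contRep hq A x‖ ^ (2 * k) : ℝ) : ℂ) * ((starRingEnd ℂ) (contRep hq A x) *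
          (boost t b i (ofCoord q A) - ofCoord q A : L2Space N) x) := by
    have i3 : Integrable fun x => (starRingEnd ℂ) (contRep hq A x) *
        (boost t b i (ofCoord q A) - ofCoord q A : L2Space N) x := by
      have := (memLp_contRep hq A).star.integrable_mul
        (Lp.memLp (boost t b i (ofCoord q A) - ofCoord q A))
      exact this
    exact i3.bdd_mul (c := 2 * ‖contRep hq A‖ ^ (2 * k))
      (Continuous.aestronglyMeasurable (by fun_prop)) (ae_of_all _ bdd)
  rw [L2.inner_def]
  have e1 := integral_re (𝕜 := ℂ) hint
  have e2 := integral_im (𝕜 := ℂ) i2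
  simp only [RCLike.re_eq_complex_re, RCLike.im_eq_complex_im] at e1 e2
  rw [← e1, ← e2, ← integral_const_mul]
  apply integral_congr_ae
  filter_upwards [coeFn_boost_powCoord_sub hq t b i A k, coeFn_boost_sub hq t b i A,
    Lp.coeFn_smul (-(Complex.I * (lam : ℂ))) (boost t b i (ofCoord q (powCoord hq k A))
        - ofCoord q (powCoord hq k A))] with x h1 h2 h3
  rw [h3, Pi.smul_apply, h1, h2]
  have hθ := norm_boostFactor t b i x
  generalize contRep hq A x = w
  generalize boostFactor t b i x = θ at hθ
  generalize contRep hq A (x + (-(4 * Real.pi * t) * b) • basisVec i) = z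
  have hz : ‖z‖ = ‖θ * z‖ := by rw [norm_mul, hθ, one_mul]
  rw [hz]
  generalize θ * z = z
  simp only [RCLike.inner_apply, powMap]
  simp [Complex.mul_re, Complex.mul_im, -Complex.ofReal_pow]
  ring

end

/-! ### The infinitesimal generator of the boosts -/

namespace HasLpPartial

theorem tendsto_scale {F : Type*} [NormedAddCommGroup F] [NormedSpace ℝ F] {p : ℝ≥0∞} {i : Fin N}
    {u v : RSpace N → F} (h : HasLpPartial p i u v) (k : ℝ) :
    Tendsto (fun b : ℝ => eLpNorm
      (fun x => b⁻¹ • (u (x + (k * b) • basisVec i) - u x) - k • v x) p volume)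
      (𝓝[≠] 0) (𝓝 0) := by
  -- The factor is `k = -4πt` for boosts, so the degenerate case occurs at `t = 0`.
  rcases eq_or_ne k 0 with rfl | hk
  · simp
  have h1 : Tendsto (fun b : ℝ => k * b) (𝓝[≠] 0) (𝓝[≠] 0) := by
    refine tendsto_nhdsWithin_iff.2 ⟨?_, ?_⟩
    · have : Tendsto (fun b : ℝ => k * b) (𝓝 0) (𝓝 (k * 0)) := (continuous_const_mul k).tendsto 0
      rw [mul_zero] at this
      exact this.mono_left nhdsWithin_le_nhds
    · filter_upwards [self_mem_nhdsWithin] with b hb using mul_ne_zero hk hb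
  have h2 : Tendsto (fun b : ℝ => ‖k‖ₑ * eLpNorm (fun x =>
      (k * b)⁻¹ • (u (x + (k * b) • basisVec i) - u x) - v x) p volume) (𝓝[≠] 0) (𝓝 0) := by
    simpa using ENNReal.Tendsto.const_mul (h.tendsto.comp h1) (Or.inr enorm_ne_top)
  refine h2.congr fun b => ?_
  rw [← eLpNorm_const_smul]
  congr 1
  ext x
  simp only [Pi.smul_apply, smul_sub, smul_smul]
  congr 3 <;> field_simp

end HasLpPartial

theorem norm_boostFactor_sub_one_le (t b : ℝ) (i : Fin N) (x : RSpace N) :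
    ‖boostFactor t b i x - 1‖ ≤ |b| * (2 * Real.pi * |x i| + 4 * Real.pi ^ 2 * |t| * |b|) := by
  have h := Real.norm_exp_I_mul_ofReal_sub_one_le
    (x := 2 * Real.pi * b * x i - 4 * Real.pi ^ 2 * t * b ^ 2)
  refine h.trans ?_
  rw [Real.norm_eq_abs]
  refine (abs_sub _ _).trans_eq ?_
  simp only [abs_mul, abs_pow, abs_two, abs_of_pos Real.pi_pos, abs_of_pos (zero_lt_four' ℝ)]
  ring

theorem continuous_boostFactor (t b : ℝ) (i : Fin N) : Continuous (boostFactor t b i) := by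
  unfold boostFactor
  fun_prop

theorem hasDerivAt_boostFactor (t : ℝ) (i : Fin N) (x : RSpace N) :
    HasDerivAt (fun b => boostFactor t b i x) (2 * Real.pi * Complex.I * (x i : ℂ)) 0 := by
  have h1 : HasDerivAt (fun b : ℝ => 2 * Real.pi * b * x i - 4 * Real.pi ^ 2 * t * b ^ 2)
      (2 * Real.pi * x i) 0 := by
    have h2 := ((hasDerivAt_id (0 : ℝ)).const_mul (2 * Real.pi)).mul_const (x i)
    have h3 := ((hasDerivAt_id (0 : ℝ)).pow 2).const_mul (4 * Real.pi ^ 2 * t)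
    refine (h2.sub h3).congr_deriv ?_
    simp
  have h4 := (h1.ofReal_comp.const_mul Complex.I).cexp
  refine h4.congr_deriv ?_
  simp
  ring

theorem tendsto_boostFactor_slope (t : ℝ) (i : Fin N) (x : RSpace N) :
    Tendsto (fun b : ℝ => ((b⁻¹ : ℝ) : ℂ) * (boostFactor t b i x - 1)) (𝓝[≠] 0)
      (𝓝 (2 * Real.pi * Complex.I * (x i : ℂ))) := by
  refine (hasDerivAt_boostFactor t i x).tendsto_slope_zero.congr fun b => ?_
  rw [zero_add, Complex.real_smul]
  congr 2
  simp [boostFactor]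

theorem tendsto_boostFactor (t : ℝ) (i : Fin N) (x : RSpace N) :
    Tendsto (fun b : ℝ => boostFactor t b i x) (𝓝[≠] 0) (𝓝 1) := by
  have h := (hasDerivAt_boostFactor t i x).continuousAt.tendsto
  have h0 : boostFactor t 0 i x = 1 := by simp [boostFactor]
  rw [h0] at h
  exact h.mono_left nhdsWithin_le_nhds

section

variable {u d : RSpace N → ℂ} {i : Fin N} (t : ℝ)

theorem aestronglyMeasurable_boostFactor_mul (b : ℝ) (hu : AEStronglyMeasurable u volume) :
    AEStronglyMeasurable (fun x => boostFactor t b i x * u x) volume :=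
  (continuous_boostFactor t b i).aestronglyMeasurable.mul hu

theorem aestronglyMeasurable_boostFactor_sub_one_mul (b : ℝ)
    (hu : AEStronglyMeasurable u volume) :
    AEStronglyMeasurable (fun x => (boostFactor t b i x - 1) * u x) volume :=
  ((continuous_boostFactor t b i).sub continuous_const).aestronglyMeasurable.mul hu

theorem tendsto_boostFactor_sub_one_mul (hu : MemLp u 2) :
    Tendsto (fun b : ℝ => eLpNorm (fun x => (boostFactor t b i x - 1) * u x) 2 volume)
      (𝓝[≠] 0) (𝓝 0) := by
  refine tendsto_eLpNorm_zero_of_dominated (by norm_num) (by norm_num)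
    (bound := fun x => 2 * ‖u x‖) (hu.norm.const_mul _)
    (Eventually.of_forall fun b => aestronglyMeasurable_boostFactor_sub_one_mul t b hu.1)
    (Eventually.of_forall fun b => ae_of_all _ fun x => ?_) (ae_of_all _ fun x => ?_)
  · rw [norm_mul]
    gcongr
    refine (norm_sub_le _ _).trans ?_
    rw [norm_boostFactor, norm_one]
    norm_num
  · simpa using ((tendsto_boostFactor t i x).sub_const 1).mul_const (u x)

/-- With `θ` the boost factor, `b⁻¹ (θ u(· + kb) - u)` splits into `θ b⁻¹ (u(· + kb) - u)`, treated
here, and `b⁻¹ (θ - 1) u`, treated in `tendsto_boost_phase`. Only the second part needs the first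
moment of `u`. -/
theorem tendsto_boost_transport (k : ℝ) (hu : HasLpPartial 2 i u d) :
    Tendsto (fun b : ℝ => eLpNorm (fun x => boostFactor t b i x *
      (((b⁻¹ : ℝ) : ℂ) * (u (x + (k * b) • basisVec i) - u x)) - (k : ℂ) * d x) 2 volume)
      (𝓝[≠] 0) (𝓝 0) := by
  have t1 := tendsto_eLpNorm_bdd_mul (l := 𝓝[≠] (0 : ℝ)) 2
    (f := fun b x => boostFactor t b i x) (fun b x => (norm_boostFactor t b i x).le)
    (hu.tendsto_scale k)
  have t2 := tendsto_boostFactor_sub_one_mul (i := i) t (hu.memLp_right.const_mul (k : ℂ))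
  have m2 : ∀ b : ℝ, AEStronglyMeasurable (fun x => (boostFactor t b i x - 1) *
      ((k : ℂ) * d x)) volume := fun b =>
    aestronglyMeasurable_boostFactor_sub_one_mul t b (hu.memLp_right.1.const_mul (k : ℂ))
  have m1 : ∀ b : ℝ, AEStronglyMeasurable (fun x => boostFactor t b i x *
      (b⁻¹ • (u (x + (k * b) • basisVec i) - u x) - k • d x)) volume := fun b =>
    aestronglyMeasurable_boostFactor_mul t b
      ((((aestronglyMeasurable_shift hu.memLp_left.1 _).sub hu.memLp_left.1).const_smul b⁻¹).sub
        (hu.memLp_right.1.const_smul k))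
  refine (tendsto_eLpNorm_add_zero one_le_two (Eventually.of_forall m1)
    (Eventually.of_forall m2) t1 t2).congr fun b => ?_
  congr 1
  ext x
  rw [Complex.real_smul, Complex.real_smul]
  ring

theorem tendsto_boost_phase (hu : MemLp u 2) (xu : MemLp (fun x => ((x i : ℝ) : ℂ) * u x) 2) :
    Tendsto (fun b : ℝ => eLpNorm (fun x => ((b⁻¹ : ℝ) : ℂ) * (boostFactor t b i x - 1) * u x
      - 2 * Real.pi * Complex.I * (((x i : ℝ) : ℂ) * u x)) 2 volume) (𝓝[≠] 0) (𝓝 0) := by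
  refine tendsto_eLpNorm_zero_of_dominated (by norm_num) (by norm_num)
    (bound := fun x => 4 * Real.pi * ‖((x i : ℝ) : ℂ) * u x‖ + 4 * Real.pi ^ 2 * |t| * ‖u x‖)
    ((xu.norm.const_mul _).add (hu.norm.const_mul _)) (Eventually.of_forall fun b => ?_) ?_
    (ae_of_all _ fun x => ?_)
  · exact ((continuous_const.mul ((continuous_boostFactor t b i).sub
      continuous_const)).aestronglyMeasurable.mul hu.1).sub (xu.1.const_mul _)
  · have : ∀ᶠ b : ℝ in 𝓝[≠] 0, |b| ≤ 1 ∧ b ≠ 0 := by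
      refine Filter.Eventually.and ?_ self_mem_nhdsWithin
      apply eventually_nhdsWithin_of_eventually_nhds
      filter_upwards [Metric.closedBall_mem_nhds (0 : ℝ) one_pos] with t ht
      simpa using ht
    filter_upwards [this] with b ⟨hb, hb0⟩
    refine ae_of_all _ fun x => (norm_sub_le _ _).trans ?_
    have hb' : 0 < |b| := abs_pos.2 hb0
    have h1 : ‖((b⁻¹ : ℝ) : ℂ) * (boostFactor t b i x - 1)‖
        ≤ 2 * Real.pi * |x i| + 4 * Real.pi ^ 2 * |t| := by
      rw [norm_mul, Complex.norm_real, norm_inv, Real.norm_eq_abs, inv_mul_le_iff₀ hb']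
      refine (norm_boostFactor_sub_one_le t b i x).trans ?_
      have h4 : 4 * Real.pi ^ 2 * |t| * |b| ≤ 4 * Real.pi ^ 2 * |t| :=
        mul_le_of_le_one_right (by positivity) hb
      exact mul_le_mul_of_nonneg_left (by linarith) hb'.le
    have h2 : ‖2 * Real.pi * Complex.I * (((x i : ℝ) : ℂ) * u x)‖
        = 2 * Real.pi * ‖((x i : ℝ) : ℂ) * u x‖ := by
      simp [abs_of_pos Real.pi_pos]
    have h3 : ‖((x i : ℝ) : ℂ) * u x‖ = |x i| * ‖u x‖ := by simp
    rw [norm_mul, h2, h3]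
    have := mul_le_mul_of_nonneg_right h1 (norm_nonneg (u x))
    linarith
  · have := ((tendsto_boostFactor_slope t i x).mul_const (u x)).sub_const
      (2 * Real.pi * Complex.I * (((x i : ℝ) : ℂ) * u x))
    refine this.trans_eq ?_
    congr 1
    ring

/-- The boosts are generated by `2πi (xᵢ + 2it∂ᵢ)`. -/
theorem tendsto_boost_quot (hu : HasLpPartial 2 i u d)
    (xu : MemLp (fun x => ((x i : ℝ) : ℂ) * u x) 2) :
    Tendsto (fun b : ℝ => eLpNorm (fun x => ((b⁻¹ : ℝ) : ℂ) * (boostFactor t b i x *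
      u (x + (-(4 * Real.pi * t) * b) • basisVec i) - u x)
        - 2 * Real.pi * Complex.I * (((x i : ℝ) : ℂ) * u x + 2 * Complex.I * t * d x)) 2 volume)
      (𝓝[≠] 0) (𝓝 0) := by
  refine (tendsto_eLpNorm_add_zero (by norm_num) (Eventually.of_forall fun b => ?_)
    (Eventually.of_forall fun b => ?_) (tendsto_boost_transport t (-(4 * Real.pi * t)) hu)
    (tendsto_boost_phase t hu.memLp_left xu)).congr fun b => ?_
  · exact ((continuous_boostFactor t b i).aestronglyMeasurable.mul
      (((aestronglyMeasurable_shift hu.memLp_left.1 _).sub hu.memLp_left.1).const_mul _)).sub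
        (hu.memLp_right.1.const_mul _)
  · exact ((continuous_const.mul ((continuous_boostFactor t b i).sub
      continuous_const)).aestronglyMeasurable.mul hu.memLp_left.1).sub (xu.1.const_mul _)
  · congr 1
    ext x
    push_cast
    -- The translation speed matches the generator: `-4πt = 2πi · 2it`.
    linear_combination (4 * Real.pi * t * d x) * Complex.I_sq

/-- A function whose boosts differ from it by `O(b)` has a first moment. -/
theorem memLp_coord_mul_of_boost_le (hu : HasLpPartial 2 i u d) {C : ℝ}
    (hC : ∀ b : ℝ, eLpNorm (fun x => boostFactor t b i x *
      u (x + (-(4 * Real.pi * t) * b) • basisVec i) - u x) 2 volume ≤ ENNReal.ofReal (C * |b|)) :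
    MemLp (fun x => ((x i : ℝ) : ℂ) * u x) 2 := by
  have mu := hu.memLp_left.1
  have mT : ∀ b : ℝ, AEStronglyMeasurable (fun x => boostFactor t b i x *
      (((b⁻¹ : ℝ) : ℂ) * (u (x + (-(4 * Real.pi * t) * b) • basisVec i) - u x))
        - ((-(4 * Real.pi * t) : ℝ) : ℂ) * d x) volume := fun b =>
    ((continuous_boostFactor t b i).aestronglyMeasurable.mul
      (((aestronglyMeasurable_shift mu _).sub mu).const_mul _)).sub (hu.memLp_right.1.const_mul _)
  have mB : ∀ b : ℝ, AEStronglyMeasurable (fun x => ((b⁻¹ : ℝ) : ℂ) * (boostFactor t b i x *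
      u (x + (-(4 * Real.pi * t) * b) • basisVec i) - u x)) volume := fun b =>
    (((continuous_boostFactor t b i).aestronglyMeasurable.mul
      (aestronglyMeasurable_shift mu _)).sub mu).const_mul _
  have mP : ∀ b : ℝ, AEStronglyMeasurable
      (fun x => ((b⁻¹ : ℝ) : ℂ) * (boostFactor t b i x - 1) * u x) volume := fun b =>
    (continuous_const.mul ((continuous_boostFactor t b i).sub
      continuous_const)).aestronglyMeasurable.mul mu
  set D := eLpNorm (fun x => ((-(4 * Real.pi * t) : ℝ) : ℂ) * d x) 2 volume with hD
  have hD' : D < ⊤ := (hu.memLp_right.const_mul _).2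
  -- The transport part converges without any moment of `u`; subtracting it from the bounded boost
  -- quotient bounds the phase quotient in `L²`.
  have hev : ∀ᶠ b : ℝ in 𝓝[≠] 0, eLpNorm
      (fun x => ((b⁻¹ : ℝ) : ℂ) * (boostFactor t b i x - 1) * u x) 2 volume
        ≤ ENNReal.ofReal C + (1 + D) := by
    filter_upwards [(tendsto_order.1 (tendsto_boost_transport t (-(4 * Real.pi * t)) hu)).2 1 one_pos,
      self_mem_nhdsWithin] with b hb hb0
    have e : (fun x => ((b⁻¹ : ℝ) : ℂ) * (boostFactor t b i x - 1) * u x) =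
        (fun x => ((b⁻¹ : ℝ) : ℂ) * (boostFactor t b i x *
          u (x + (-(4 * Real.pi * t) * b) • basisVec i) - u x)) -
        ((fun x => boostFactor t b i x *
          (((b⁻¹ : ℝ) : ℂ) * (u (x + (-(4 * Real.pi * t) * b) • basisVec i) - u x))
          - ((-(4 * Real.pi * t) : ℝ) : ℂ) * d x) +
          fun x => ((-(4 * Real.pi * t) : ℝ) : ℂ) * d x) := by
      ext x
      simp only [Pi.sub_apply, Pi.add_apply]
      ring
    rw [e]
    refine (eLpNorm_sub_le (mB b) ((mT b).add (hu.memLp_right.1.const_mul _)) (by norm_num)).trans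
      (add_le_add ?_ ((eLpNorm_add_le (mT b) (hu.memLp_right.1.const_mul _) (by norm_num)).trans
        (add_le_add hb.le le_rfl)))
    have hb' : 0 < |b| := abs_pos.2 hb0
    refine (eLpNorm_const_smul ((b⁻¹ : ℝ) : ℂ) _ 2 volume).trans_le ?_
    refine (mul_le_mul_right (hC b) _).trans_eq ?_
    rw [← ofReal_norm, Complex.norm_real, norm_inv, Real.norm_eq_abs, ← ENNReal.ofReal_mul
      (by positivity)]
    congr 1
    field_simp
  obtain ⟨b, hb⟩ := exists_seq_tendsto (𝓝[≠] (0 : ℝ))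
  have hlim : ∀ᵐ x : RSpace N, Tendsto (fun n => ((((b n)⁻¹ : ℝ) : ℂ) *
      (boostFactor t (b n) i x - 1) * u x)) atTop
      (𝓝 (2 * Real.pi * Complex.I * (x i : ℂ) * u x)) :=
    ae_of_all _ fun x => ((tendsto_boostFactor_slope t i x).comp hb).mul_const (u x)
  -- Fatou along a sequence `b n → 0`: the phase quotients tend pointwise to `2πi xᵢ u`.
  have hle := Lp.eLpNorm_lim_le_liminf_eLpNorm (p := 2) (fun n => mP (b n)) _ hlim
  have hle2 : liminf (fun n => eLpNorm (fun x => (((b n)⁻¹ : ℝ) : ℂ) *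
      (boostFactor t (b n) i x - 1) * u x) 2 volume) atTop ≤ ENNReal.ofReal C + (1 + D) :=
    liminf_le_of_frequently_le' (hb.eventually hev).frequently
  have hm : MemLp (fun x => 2 * Real.pi * Complex.I * (x i : ℂ) * u x) 2 :=
    ⟨(by fun_prop : Continuous fun x : RSpace N =>
      2 * Real.pi * Complex.I * ((x i : ℝ) : ℂ)).aestronglyMeasurable.mul mu,
      (hle.trans hle2).trans_lt (ENNReal.add_lt_top.2
        ⟨ENNReal.ofReal_lt_top, ENNReal.add_lt_top.2 ⟨ENNReal.one_lt_top, hD'⟩⟩)⟩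
  refine (hm.const_mul (2 * Real.pi * Complex.I)⁻¹).congr_norm ?_ (ae_of_all _ fun x => ?_)
  · exact (by fun_prop : Continuous fun x : RSpace N => ((x i : ℝ) : ℂ)).aestronglyMeasurable.mul mu
  · have : (2 * Real.pi * Complex.I : ℂ) ≠ 0 := Complex.two_pi_I_ne_zero
    congr 1
    field_simp

end

/-! ### Derivatives in Fourier coordinates -/

theorem norm_pow_le_sobWeight {k q : ℕ} (hk : k ≤ q) (ξ : RSpace N) : ‖ξ‖ ^ k ≤ sobWeight q ξ := by
  have h1 : (1 : ℝ) ≤ 1 + ‖ξ‖ ^ 2 := by simp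
  calc ‖ξ‖ ^ k = (‖ξ‖ ^ 2) ^ ((k : ℝ) / 2) := by
        rw [← Real.rpow_natCast (‖ξ‖) 2, ← Real.rpow_mul (norm_nonneg _), ← Real.rpow_natCast]
        congr 1
        push_cast
        ring
    _ ≤ (1 + ‖ξ‖ ^ 2) ^ ((k : ℝ) / 2) := by
        gcongr
        linarith
    _ ≤ sobWeight q ξ := Real.rpow_le_rpow_of_exponent_le h1 (by gcongr)

/-- The multiplier `(2πi ξᵢ)^k (1 + |ξ|²)^{-q/2}`. -/
def derivWeight {k q : ℕ} (hk : k ≤ q) (i : Fin N) : RSpace N →ᵇ ℂ :=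
  BoundedContinuousFunction.ofNormedAddCommGroup
    (fun ξ => (2 * Real.pi * Complex.I * (ξ i : ℂ)) ^ k * invWeight N q ξ)
    (by fun_prop) ((2 * Real.pi) ^ k) fun ξ => by
      rw [norm_mul, norm_invWeight, norm_pow, ← div_eq_mul_inv, div_le_iff₀ (sobWeight_pos q ξ)]
      have h1 : ‖2 * Real.pi * Complex.I * (ξ i : ℂ)‖ = 2 * Real.pi * |ξ i| := by
        simp [abs_of_pos Real.pi_pos]
      have h2 : |ξ i| ≤ ‖ξ‖ := EuclideanSpace.norm_eq ξ ▸ by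
        refine Real.le_sqrt_of_sq_le ?_
        rw [← Real.norm_eq_abs]
        exact Finset.single_le_sum (f := fun j => ‖ξ j‖ ^ 2) (fun _ _ => by positivity)
          (Finset.mem_univ i)
      rw [h1, mul_pow]
      gcongr
      exact (pow_le_pow_left₀ (abs_nonneg _) h2 k).trans (norm_pow_le_sobWeight hk ξ)

theorem derivWeight_apply {k q : ℕ} (hk : k ≤ q) (i : Fin N) (ξ : RSpace N) :
    derivWeight hk i ξ = (2 * Real.pi * Complex.I * (ξ i : ℂ)) ^ k * invWeight N q ξ := rfl

/-- The derivative `∂ᵢ^k` of the function with coordinates `A`. -/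
def derivCoord {k q : ℕ} (hk : k ≤ q) (i : Fin N) : L2Space N →L[ℂ] L2Space N :=
  ((Lp.fourierTransformₗᵢ (RSpace N) ℂ).symm.toContinuousLinearEquiv :
    L2Space N →L[ℂ] L2Space N) ∘L bmul (derivWeight hk i)

theorem hasLpPartial_derivCoord {k q : ℕ} (hk : k + 1 ≤ q) (i : Fin N) (A : L2Space N) :
    HasLpPartial 2 i (derivCoord (Nat.le_of_succ_le hk) i A) (derivCoord hk i A) :=
  hasLpPartial_fourierInv (fun ξ => by rw [derivWeight_apply, derivWeight_apply]; ring) A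

theorem derivCoord_zero {q : ℕ} (i : Fin N) (A : L2Space N) :
    derivCoord (Nat.zero_le q) i A = ofCoord q A := by
  have : derivWeight (Nat.zero_le q) i = invWeight N q := by
    ext ξ
    simp [derivWeight_apply]
  rw [ofCoord_apply, ← this]
  rfl

theorem hasLpPartial_contRep {q : ℕ} (hq : (N : ℝ) / 2 < q) (h1 : 1 ≤ q) (i : Fin N)
    (A : L2Space N) : HasLpPartial 2 i (contRep hq A) (derivCoord h1 i A) := by
  refine (hasLpPartial_derivCoord (k := 0) h1 i A).congr ?_ EventuallyEq.rfl
  rw [derivCoord_zero]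
  exact coeFn_ofCoord hq A

/-! ### Derivatives of powers of the density -/

/-- The derivative of `|u|^{2(k+1)}`, where `u'` is that of `u`. -/
def densDeriv (k : ℕ) (u u' : RSpace N → ℂ) (x : RSpace N) : ℝ :=
  (k + 1) * ‖u x‖ ^ (2 * k) * (2 * ((starRingEnd ℂ) (u x) * u' x).re)

namespace HasLpPartial

variable {i : Fin N} {u u' : RSpace N → ℂ} {M : ℝ}

theorem density (hu : HasLpPartial 2 i u u') (cu : Continuous u) (bu : ∀ x, ‖u x‖ ≤ M) :
    HasLpPartial 2 i (fun x => ((‖u x‖ ^ 2 : ℝ) : ℂ))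
      (fun x => ((2 * ((starRingEnd ℂ) (u x) * u' x).re : ℝ) : ℂ)) := by
  refine (mul_bdd hu.conj hu (M := M) (by fun_prop) (fun x => by simpa using bu x) bu).congr
    (ae_of_all _ fun x => ?_) (ae_of_all _ fun x => ?_)
  · simp only
    rw [mul_comm, Complex.mul_conj, Complex.normSq_eq_norm_sq]
  · simp only
    rw [← Complex.add_conj, map_mul, Complex.conj_conj]
    ring

theorem density_pow (hu : HasLpPartial 2 i u u') (cu : Continuous u) (bu : ∀ x, ‖u x‖ ≤ M)
    (k : ℕ) : HasLpPartial 2 i (fun x => ((‖u x‖ ^ (2 * (k + 1)) : ℝ) : ℂ))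
      (fun x => (densDeriv k u u' x : ℂ)) := by
  refine ((hu.density cu bu).pow_bdd (M := M ^ 2) (by fun_prop) (fun x => ?_) k).congr
    (ae_of_all _ fun x => ?_) (ae_of_all _ fun x => ?_)
  · rw [Complex.norm_real, Real.norm_of_nonneg (by positivity)]
    exact pow_le_pow_left₀ (norm_nonneg _) (bu x) 2
  · simp only
    rw [← Complex.ofReal_pow, ← pow_mul]
  · simp only [densDeriv]
    push_cast
    ring

end HasLpPartial

/-! ### Second order expansion of the boosts -/

theorem tendsto_integral_conj_mul {ι : Type*} {l : Filter ι} {f g : ι → RSpace N → ℂ}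
    {f₀ g₀ : RSpace N → ℂ} (hf : ∀ n, MemLp (f n) 2) (hg : ∀ n, MemLp (g n) 2) (hf₀ : MemLp f₀ 2)
    (hg₀ : MemLp g₀ 2) (tf : Tendsto (fun n => eLpNorm (fun x => f n x - f₀ x) 2 volume) l (𝓝 0))
    (tg : Tendsto (fun n => eLpNorm (fun x => g n x - g₀ x) 2 volume) l (𝓝 0)) :
    Tendsto (fun n => ∫ x, (starRingEnd ℂ) (f n x) * g n x) l
      (𝓝 (∫ x, (starRingEnd ℂ) (f₀ x) * g₀ x)) := by
  have h1 := (Lp.tendsto_Lp_iff_tendsto_eLpNorm'' f hf f₀ hf₀).2 tf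
  have h2 := (Lp.tendsto_Lp_iff_tendsto_eLpNorm'' g hg g₀ hg₀).2 tg
  have key : ∀ {a b : RSpace N → ℂ} (ha : MemLp a 2) (hb : MemLp b 2),
      inner ℂ (ha.toLp a) (hb.toLp b) = ∫ x, (starRingEnd ℂ) (a x) * b x := by
    intro a b ha hb
    rw [L2.inner_def]
    apply integral_congr_ae
    filter_upwards [ha.coeFn_toLp, hb.coeFn_toLp] with x e1 e2
    rw [e1, e2, RCLike.inner_apply, mul_comm]
  simpa only [key] using h1.inner (𝕜 := ℂ) h2

section

variable {q : ℕ} (hq : (N : ℝ) / 2 < q) (h1 : 1 ≤ q) (t : ℝ) (i : Fin N) (A : L2Space N)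

/-- The function `(xᵢ + 2it∂ᵢ) u`, where `u'` is the derivative of `u`. -/
def conformalPart (t : ℝ) (i : Fin N) (u u' : RSpace N → ℂ) (x : RSpace N) : ℂ :=
  ((x i : ℝ) : ℂ) * u x + 2 * Complex.I * t * u' x

theorem memLp_conformalPart {u u' : RSpace N → ℂ} {i : Fin N}
    (xu : MemLp (fun x => ((x i : ℝ) : ℂ) * u x) 2) (hu' : MemLp u' 2) (t : ℝ) :
    MemLp (conformalPart t i u u') 2 :=
  xu.add (hu'.const_mul _)

theorem tendsto_boost_sub_quot
    (xu : MemLp (fun x => ((x i : ℝ) : ℂ) * contRep hq A x) 2) :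
    Tendsto (fun b : ℝ => eLpNorm (fun x => ((b⁻¹ : ℝ) : ℂ) *
      (boost t b i (ofCoord q A) - ofCoord q A : L2Space N) x - 2 * Real.pi * Complex.I *
        conformalPart t i (contRep hq A) (derivCoord h1 i A) x) 2 volume) (𝓝[≠] 0) (𝓝 0) := by
  refine (tendsto_boost_quot t (hasLpPartial_contRep hq h1 i A) xu).congr fun b =>
    eLpNorm_congr_ae ?_
  filter_upwards [coeFn_boost_sub hq t b i A] with x hx
  rw [hx]
  rfl

theorem tendsto_norm_boost_sub_quot
    (xu : MemLp (fun x => ((x i : ℝ) : ℂ) * contRep hq A x) 2) :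
    Tendsto (fun b : ℝ => (b ^ 2)⁻¹ * ‖boost t b i (ofCoord q A) - ofCoord q A‖ ^ 2) (𝓝[≠] 0)
      (𝓝 (4 * Real.pi ^ 2 *
        ∫ x, ‖conformalPart t i (contRep hq A) (derivCoord h1 i A) x‖ ^ 2)) := by
  have hJ := memLp_conformalPart xu (Lp.memLp (derivCoord h1 i A)) t
  have hD : ∀ b : ℝ, MemLp (fun x => ((b⁻¹ : ℝ) : ℂ) *
      (boost t b i (ofCoord q A) - ofCoord q A : L2Space N) x) 2 := fun b =>
    (Lp.memLp _).const_mul _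
  have h := tendsto_integral_conj_mul hD hD (hJ.const_mul _) (hJ.const_mul _)
    (tendsto_boost_sub_quot hq h1 t i A xu) (tendsto_boost_sub_quot hq h1 t i A xu)
  have h2 := (Complex.continuous_re.tendsto _).comp h
  have e : ∀ f : RSpace N → ℂ, (∫ x, (starRingEnd ℂ) (f x) * f x).re = ∫ x, ‖f x‖ ^ 2 := by
    intro f
    have : ∀ x, (starRingEnd ℂ) (f x) * f x = ((‖f x‖ ^ 2 : ℝ) : ℂ) := fun x => by
      rw [mul_comm, Complex.mul_conj, Complex.normSq_eq_norm_sq]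
    simp only [this]
    have := integral_ofReal (𝕜 := ℂ) (μ := volume) (f := fun x => ‖f x‖ ^ 2)
    exact (congrArg Complex.re this).trans (Complex.ofReal_re _)
  simp only [Function.comp_def, e] at h2
  have e2 : ∫ x, ‖2 * Real.pi * Complex.I *
      conformalPart t i (contRep hq A) (derivCoord h1 i A) x‖ ^ 2 = 4 * Real.pi ^ 2 *
        ∫ x, ‖conformalPart t i (contRep hq A) (derivCoord h1 i A) x‖ ^ 2 := by
    rw [← integral_const_mul]
    congr 1
    ext x
    rw [norm_mul, mul_pow]
    congr 1
    simp [mul_pow]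
    ring
  rw [e2] at h2
  refine h2.congr fun b => ?_
  have e3 : ‖boost t b i (ofCoord q A) - ofCoord q A‖ ^ 2
      = ∫ x, ‖(boost t b i (ofCoord q A) - ofCoord q A : L2Space N) x‖ ^ 2 := by
    have := L2.inner_def (𝕜 := ℂ) (boost t b i (ofCoord q A) - ofCoord q A)
      (boost t b i (ofCoord q A) - ofCoord q A)
    rw [← inner_self_eq_norm_sq (𝕜 := ℂ), this, ← e]
    simp only [RCLike.inner_apply, RCLike.re_eq_complex_re]
    simp_rw [mul_comm]
  rw [e3, ← integral_const_mul]
  congr 1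
  ext x
  rw [norm_mul, mul_pow, Complex.norm_real, norm_inv, inv_pow, Real.norm_eq_abs, sq_abs]

/-- One factor `b⁻¹` goes to each difference. The quotient of the density power tends to `-4πt`
times its derivative, and the boost quotient tends to `2πi` times the conformal field, both in `L²`;
the imaginary part of `i z` is the real part of `z`. -/
theorem tendsto_boost_interaction (k : ℕ)
    (xu : MemLp (fun x => ((x i : ℝ) : ℂ) * contRep hq A x) 2) :
    Tendsto (fun b : ℝ => (b ^ 2)⁻¹ *
      (∫ x, ((‖contRep hq A (x + (-(4 * Real.pi * t) * b) • basisVec i)‖ ^ (2 * (k + 1))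
          - ‖contRep hq A x‖ ^ (2 * (k + 1)) : ℝ) : ℂ) * ((starRingEnd ℂ) (contRep hq A x) *
          (boost t b i (ofCoord q A) - ofCoord q A : L2Space N) x)).im) (𝓝[≠] 0)
      (𝓝 (-(8 * Real.pi ^ 2 * t) * ∫ x, densDeriv k (contRep hq A) (derivCoord h1 i A) x *
        ((starRingEnd ℂ) (contRep hq A x) *
          conformalPart t i (contRep hq A) (derivCoord h1 i A) x).re)) := by
  set φ := contRep hq A with hφ
  set d := derivCoord h1 i A with hd
  have hu : HasLpPartial 2 i φ d := hasLpPartial_contRep hq h1 i A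
  have bφ : ∀ x, ‖φ x‖ ≤ ‖φ‖ := φ.norm_coe_le_norm
  have bφ' : ∀ x, ‖(starRingEnd ℂ) (φ x)‖ ≤ ‖φ‖ := fun x => by simpa using bφ x
  have mφ' : AEStronglyMeasurable (fun x => (starRingEnd ℂ) (φ x)) volume :=
    Continuous.aestronglyMeasurable (by fun_prop)
  have hρ := hu.density_pow φ.continuous bφ k
  have hJ := memLp_conformalPart xu (Lp.memLp d) t
  have hD : ∀ b : ℝ, MemLp (fun x => ((b⁻¹ : ℝ) : ℂ) *
      (boost t b i (ofCoord q A) - ofCoord q A : L2Space N) x) 2 := fun b =>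
    (Lp.memLp _).const_mul _
  have t2 := tendsto_eLpNorm_bdd_mul 2 (f := fun (_ : ℝ) x => (starRingEnd ℂ) (φ x))
    (fun _ => bφ') (tendsto_boost_sub_quot hq h1 t i A xu)
  simp only [mul_sub] at t2
  have hquot : ∀ b : ℝ, MemLp (fun x => b⁻¹ •
      (((‖φ (x + (-(4 * Real.pi * t) * b) • basisVec i)‖ ^ (2 * (k + 1)) : ℝ) : ℂ)
        - ((‖φ x‖ ^ (2 * (k + 1)) : ℝ) : ℂ))) 2 := fun b =>
    ((hρ.memLp_left.shift ((-(4 * Real.pi * t) * b) • basisVec i)).sub hρ.memLp_left).const_smul b⁻¹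
  have h := tendsto_integral_conj_mul hquot (fun b => (hD b).bdd_mul_two mφ' bφ')
    (hρ.memLp_right.const_smul (-(4 * Real.pi * t)))
    ((hJ.const_mul (2 * Real.pi * Complex.I)).bdd_mul_two mφ' bφ')
    (hρ.tendsto_scale (-(4 * Real.pi * t))) t2
  have h2 := (Complex.continuous_im.tendsto _).comp h
  have e2 : (∫ x, (starRingEnd ℂ) (((-(4 * Real.pi * t)) • fun x => (densDeriv k φ d x : ℂ)) x) *
      ((starRingEnd ℂ) (φ x) * (2 * Real.pi * Complex.I * conformalPart t i φ d x))).im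
      = -(8 * Real.pi ^ 2 * t) * ∫ x, densDeriv k φ d x *
        ((starRingEnd ℂ) (φ x) * conformalPart t i φ d x).re := by
    have hint : Integrable fun x =>
        (starRingEnd ℂ) (((-(4 * Real.pi * t)) • fun x => (densDeriv k φ d x : ℂ)) x) *
      ((starRingEnd ℂ) (φ x) * (2 * Real.pi * Complex.I * conformalPart t i φ d x)) :=
      (hρ.memLp_right.const_smul (-(4 * Real.pi * t))).star.integrable_mul
        ((hJ.const_mul (2 * Real.pi * Complex.I)).bdd_mul_two mφ' bφ')
    have e3 := integral_im (𝕜 := ℂ) hint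
    simp only [RCLike.im_eq_complex_im] at e3
    rw [← e3, ← integral_const_mul]
    congr 1
    ext x
    generalize conformalPart t i φ d x = J
    simp only [Pi.smul_apply, Complex.real_smul, map_mul, Complex.conj_ofReal]
    generalize densDeriv k φ d x = r
    simp
    ring
  rw [e2] at h2
  refine h2.congr fun b => ?_
  have e4 : ∀ z : ℂ, (b ^ 2)⁻¹ * z.im = ((((b ^ 2)⁻¹ : ℝ) : ℂ) * z).im := fun z =>
    (Complex.im_ofReal_mul _ z).symm
  simp only [Function.comp_apply]
  rw [e4, ← integral_const_mul]
  congr 2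
  ext x
  simp only [Complex.real_smul, map_mul, map_sub, Complex.conj_ofReal]
  push_cast
  ring

end

/-! ### Propagation of the first moments -/

/-- The operator of multiplication by `e^{2πi b xᵢ} - 1`. -/
def modSub (b : ℝ) (i : Fin N) : L2Space N →L[ℂ] L2Space N :=
  bmul (charB (b • basisVec i)) - ContinuousLinearMap.id ℂ _

/-- The free evolution is unitary, so the boost difference of `ψ(t)` has the norm of `(e^{2πi b xᵢ}
- 1) e^{-itΔ}ψ(t)`. The operator acting there is bounded and independent of time, hence commutes
with the time derivative. -/
theorem freeLI_modSub (q : ℕ) (t b : ℝ) (i : Fin N) (Z : L2Space N) :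
    freeLI t (modSub b i (ofCoord q Z)) =
      boost t b i (ofCoord q (bmul (symB N t) Z)) - ofCoord q (bmul (symB N t) Z) := by
  have h : ofCoord q Z = freeLI (-t) (ofCoord q (bmul (symB N t) Z)) := by
    rw [freeLI_ofCoord, bmul_symB_symB, neg_add_cancel, bmul_symB_zero]
  change freeLI t (bmul (charB (b • basisVec i)) (ofCoord q Z) - ofCoord q Z) = _
  rw [map_sub, freeLI_ofCoord, h]
  rfl

theorem freeLI_modSub_interactionField {q : ℕ} (hq : (N : ℝ) / 2 < q) (η : ℕ) (lam t b : ℝ)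
    (i : Fin N) (Z : L2Space N) :
    freeLI t (modSub b i (ofCoord q (interactionField hq η lam t Z))) =
      -(Complex.I * (lam : ℂ)) • (boost t b i (ofCoord q (powCoord hq η (bmul (symB N t) Z)))
        - ofCoord q (powCoord hq η (bmul (symB N t) Z))) := by
  rw [freeLI_modSub, interactionField, map_smul, bmul_symB_symB, add_neg_cancel, bmul_symB_zero,
    map_smul, map_smul, smul_sub]

theorem norm_modSub_le {i : Fin N} {f : L2Space N}
    (hf : MemLp (fun x => ((x i : ℝ) : ℂ) * f x) 2) (b : ℝ) :
    ‖modSub b i f‖ ≤ 2 * Real.pi * ‖hf.toLp _‖ * |b| := by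
  have h : ‖modSub b i f‖ ≤ 2 * Real.pi * |b| * ‖hf.toLp _‖ := by
    refine Lp.norm_le_mul_norm_of_ae_le_mul ?_
    have h1 : (modSub b i f : L2Space N) = bmul (charB (b • basisVec i)) f - f := rfl
    rw [h1]
    filter_upwards [Lp.coeFn_sub (bmul (charB (b • basisVec i)) f) f,
      coeFn_bmul (charB (b • basisVec i)) f, hf.coeFn_toLp] with x e1 e2 e3
    rw [e1, Pi.sub_apply, e2, e3, ← sub_one_mul, norm_mul, norm_mul, Complex.norm_real,
      Real.norm_eq_abs, ← mul_assoc]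
    gcongr
    refine (norm_charB_sub_one_le b i x).trans_eq ?_
    ring
  linarith

section

variable {q : ℕ} (hq : (N : ℝ) / 2 < q) {η : ℕ} {lam T : ℝ} {Y : ℝ → L2Space N}

theorem continuousOn_state
    (hY : ∀ t ∈ Icc 0 T, HasDerivWithinAt Y (interactionField hq η lam t (Y t)) (Icc 0 T) t) :
    ContinuousOn (fun t => bmul (symB N t) (Y t)) (Icc 0 T) :=
  ContinuousOn.bmul_symB (s := fun t => t) continuousOn_id
    fun t ht => (hY t ht).continuousWithinAt

/-- The free evolution turns both sides into boost differences, which are compared by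
`norm_boost_powCoord_sub_le`. The supremum of `ψ` over `[0,T]` is finite by compactness, so one
constant serves all `t`, `b` and `i`. -/
theorem exists_norm_modSub_interactionField_le
    (hY : ∀ t ∈ Icc 0 T, HasDerivWithinAt Y (interactionField hq η lam t (Y t)) (Icc 0 T) t) :
    ∃ K : ℝ, 0 ≤ K ∧ ∀ t ∈ Icc 0 T, ∀ b i,
      ‖modSub b i (ofCoord q (interactionField hq η lam t (Y t)))‖
        ≤ K * ‖modSub b i (ofCoord q (Y t))‖ := by
  obtain ⟨M, hM⟩ := isCompact_Icc.exists_bound_of_continuousOn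
    ((contRep hq).continuous.comp_continuousOn (continuousOn_state hq hY))
  obtain ⟨K, hK⟩ := lipOnBalls_powMap η M
  refine ⟨|lam| * K, by positivity, fun t ht b i => ?_⟩
  rw [← (freeLI t).norm_map (modSub b i (ofCoord q (interactionField hq η lam t (Y t)))),
    freeLI_modSub_interactionField, norm_smul, norm_neg, norm_I_mul_ofReal, mul_assoc,
    ← (freeLI t).norm_map (modSub b i (ofCoord q (Y t))), freeLI_modSub]
  gcongr
  exact norm_boost_powCoord_sub_le hq t b i _ hK (hM t ht)

theorem hasDerivWithinAt_modSub (b : ℝ) (i : Fin N)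
    (hY : ∀ t ∈ Icc 0 T, HasDerivWithinAt Y (interactionField hq η lam t (Y t)) (Icc 0 T) t) :
    ∀ t ∈ Icc 0 T, HasDerivWithinAt (fun t => modSub b i (ofCoord q (Y t)))
      (modSub b i (ofCoord q (interactionField hq η lam t (Y t)))) (Icc 0 T) t := fun t ht =>
  (((modSub b i ∘L ofCoord q).restrictScalars ℝ).hasFDerivAt.comp_hasDerivWithinAt t (hY t ht))

/-- Gronwall's inequality with a rate independent of `b`. The first moment of the data makes the
initial value `O(|b|)`, and this order survives. -/
theorem exists_norm_modSub_le {i : Fin N}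
    (hY : ∀ t ∈ Icc 0 T, HasDerivWithinAt Y (interactionField hq η lam t (Y t)) (Icc 0 T) t)
    (h0 : MemLp (fun x => ((x i : ℝ) : ℂ) * ofCoord q (Y 0) x) 2) :
    ∃ C : ℝ, 0 ≤ C ∧ ∀ t ∈ Icc 0 T, ∀ b, ‖modSub b i (ofCoord q (Y t))‖ ≤ C * |b| := by
  obtain ⟨K, hK0, hK⟩ := exists_norm_modSub_interactionField_le hq hY
  refine ⟨2 * Real.pi * ‖h0.toLp _‖ * Real.exp (K * T), by positivity, fun t ht b => ?_⟩
  have hd := hasDerivWithinAt_modSub hq b i hY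
  have h := norm_le_gronwallBound_of_norm_deriv_right_le (ε := 0)
    (fun t ht => (hd t ht).continuousWithinAt)
    (fun s hs => (hd s (Ico_subset_Icc_self hs)).mono_of_mem_nhdsWithin
      (Icc_mem_nhdsGE_of_mem hs)) (norm_modSub_le h0 b)
    (fun s hs => by simpa using hK s (Ico_subset_Icc_self hs) b i) t ht
  rw [gronwallBound_ε0, sub_zero] at h
  refine h.trans ?_
  rw [mul_right_comm]
  have : Real.exp (K * t) ≤ Real.exp (K * T) :=
    Real.exp_le_exp.2 (mul_le_mul_of_nonneg_left ht.2 hK0)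
  gcongr

theorem norm_boost_sub_eq (t b : ℝ) (i : Fin N) :
    ‖boost t b i (ofCoord q (bmul (symB N t) (Y t))) - ofCoord q (bmul (symB N t) (Y t))‖
      = ‖modSub b i (ofCoord q (Y t))‖ := by
  rw [← (freeLI t).norm_map (modSub b i (ofCoord q (Y t))), freeLI_modSub]

/-- First moments stay finite. -/
theorem memLp_coord_mul_contRep (hq1 : 1 ≤ q) {i : Fin N}
    (hY : ∀ t ∈ Icc 0 T, HasDerivWithinAt Y (interactionField hq η lam t (Y t)) (Icc 0 T) t)
    (h0 : MemLp (fun x => ((x i : ℝ) : ℂ) * ofCoord q (Y 0) x) 2) {t : ℝ} (ht : t ∈ Icc 0 T) :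
    MemLp (fun x => ((x i : ℝ) : ℂ) * contRep hq (bmul (symB N t) (Y t)) x) 2 := by
  obtain ⟨C, -, hC⟩ := exists_norm_modSub_le hq hY h0
  refine memLp_coord_mul_of_boost_le t (hasLpPartial_contRep hq hq1 i _) (C := C) fun b => ?_
  rw [← eLpNorm_congr_ae (coeFn_boost_sub hq t b i (bmul (symB N t) (Y t))), ← Lp.enorm_def,
    ← ofReal_norm, norm_boost_sub_eq]
  exact ENNReal.ofReal_le_ofReal (hC t ht b)

theorem norm_modSub_sq_eq (b : ℝ) (i : Fin N)
    (hY : ∀ t ∈ Icc 0 T, HasDerivWithinAt Y (interactionField hq η lam t (Y t)) (Icc 0 T) t)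
    {t : ℝ} (ht : t ∈ Icc 0 T) :
    (∫ s in (0 : ℝ)..t, 2 * (inner ℂ (modSub b i (ofCoord q (interactionField hq η lam s (Y s))))
      (modSub b i (ofCoord q (Y s)))).re) =
      ‖modSub b i (ofCoord q (Y t))‖ ^ 2 - ‖modSub b i (ofCoord q (Y 0))‖ ^ 2 := by
  have hd := hasDerivWithinAt_modSub hq b i hY
  have cY : ContinuousOn Y (Icc 0 T) := fun t ht => (hY t ht).continuousWithinAt
  have c1 : ContinuousOn (fun t => modSub b i (ofCoord q (Y t))) (Icc 0 T) :=
    fun t ht => (hd t ht).continuousWithinAt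
  have c2 : ContinuousOn (fun t => modSub b i (ofCoord q (interactionField hq η lam t (Y t))))
      (Icc 0 T) := (modSub b i ∘L ofCoord q).continuous.comp_continuousOn
    (continuousOn_interactionField hq η lam cY)
  have c3 : ContinuousOn (fun s => 2 * (inner ℂ (modSub b i (ofCoord q
      (interactionField hq η lam s (Y s)))) (modSub b i (ofCoord q (Y s)))).re) (Icc 0 T) :=
    (Complex.continuous_re.comp_continuousOn (c2.inner (𝕜 := ℂ) c1)).const_mul 2
  have hsq : ∀ s ∈ Icc 0 T, HasDerivWithinAt (fun t => ‖modSub b i (ofCoord q (Y t))‖ ^ 2)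
      (2 * (inner ℂ (modSub b i (ofCoord q (interactionField hq η lam s (Y s))))
        (modSub b i (ofCoord q (Y s)))).re) (Icc 0 T) s := by
    intro s hs
    have h1 := (hd s hs).inner ℂ (hd s hs)
    have h2 := Complex.reCLM.hasFDerivAt.comp_hasDerivWithinAt s h1
    refine (h2.congr_deriv ?_).congr (fun r _ => ?_) ?_
    · simp only [Complex.reCLM_apply, Complex.add_re]
      rw [← inner_conj_symm, Complex.conj_re, two_mul]
    · exact (inner_self_eq_norm_sq (𝕜 := ℂ) _).symm
    · exact (inner_self_eq_norm_sq (𝕜 := ℂ) _).symm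
  have hsub : Icc 0 t ⊆ Icc 0 T := Icc_subset_Icc_right ht.2
  apply intervalIntegral.integral_eq_sub_of_hasDeriv_right_of_le ht.1
    (fun s hs => ((hsq s (hsub hs)).continuousWithinAt).mono hsub)
  · intro s hs
    exact (hsq s ⟨hs.1.le, hs.2.le.trans ht.2⟩).mono_of_mem_nhdsWithin
      (Icc_mem_nhdsGT_of_mem ⟨hs.1.le, hs.2.trans_le ht.2⟩)
  · refine (c3.mono ?_).intervalIntegrable
    rwa [uIcc_of_le ht.1]

theorem re_inner_modSub (s b : ℝ) (i : Fin N) :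
    (inner ℂ (modSub b i (ofCoord q (interactionField hq η lam s (Y s))))
      (modSub b i (ofCoord q (Y s)))).re
    = -lam * (∫ x, ((‖contRep hq (bmul (symB N s) (Y s))
            (x + (-(4 * Real.pi * s) * b) • basisVec i)‖ ^ (2 * η)
          - ‖contRep hq (bmul (symB N s) (Y s)) x‖ ^ (2 * η) : ℝ) : ℂ) *
        ((starRingEnd ℂ) (contRep hq (bmul (symB N s) (Y s)) x) *
          (boost s b i (ofCoord q (bmul (symB N s) (Y s)))
            - ofCoord q (bmul (symB N s) (Y s)) : L2Space N) x)).im := by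
  rw [← (freeLI s).inner_map_map, freeLI_modSub_interactionField, freeLI_modSub,
    re_inner_boost_sub]

/-- The evolution of `‖(xᵢ + 2it∂ᵢ)ψ‖²`. -/
theorem integral_norm_conformalPart_sq (hq1 : 1 ≤ q) {k : ℕ} {i : Fin N}
    (hY : ∀ t ∈ Icc 0 T, HasDerivWithinAt Y (interactionField hq (k + 1) lam t (Y t)) (Icc 0 T) t)
    (h0 : MemLp (fun x => ((x i : ℝ) : ℂ) * ofCoord q (Y 0) x) 2) {t : ℝ} (ht : t ∈ Icc 0 T) :
    IntervalIntegrable (fun s => 4 * lam * (s * ∫ x, densDeriv k (contRep hq (bmul (symB N s) (Y s)))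
        (derivCoord hq1 i (bmul (symB N s) (Y s))) x *
        ((starRingEnd ℂ) (contRep hq (bmul (symB N s) (Y s)) x) *
          conformalPart s i (contRep hq (bmul (symB N s) (Y s)))
            (derivCoord hq1 i (bmul (symB N s) (Y s))) x).re)) volume 0 t ∧
    ∫ x, ‖conformalPart t i (contRep hq (bmul (symB N t) (Y t)))
        (derivCoord hq1 i (bmul (symB N t) (Y t))) x‖ ^ 2 =
      (∫ x, ‖conformalPart 0 i (contRep hq (bmul (symB N 0) (Y 0)))
        (derivCoord hq1 i (bmul (symB N 0) (Y 0))) x‖ ^ 2) +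
      ∫ s in (0 : ℝ)..t, 4 * lam * (s * ∫ x, densDeriv k (contRep hq (bmul (symB N s) (Y s)))
        (derivCoord hq1 i (bmul (symB N s) (Y s))) x *
        ((starRingEnd ℂ) (contRep hq (bmul (symB N s) (Y s)) x) *
          conformalPart s i (contRep hq (bmul (symB N s) (Y s)))
            (derivCoord hq1 i (bmul (symB N s) (Y s))) x).re) := by
  have h0T : (0 : ℝ) ∈ Icc 0 T := ⟨le_rfl, ht.1.trans ht.2⟩
  have hx : ∀ s ∈ Icc 0 T, MemLp (fun x => ((x i : ℝ) : ℂ) *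
      contRep hq (bmul (symB N s) (Y s)) x) 2 := fun s hs => memLp_coord_mul_contRep hq hq1 hY h0 hs
  set J : ℝ → ℝ := fun s => ∫ x, ‖conformalPart s i (contRep hq (bmul (symB N s) (Y s)))
        (derivCoord hq1 i (bmul (symB N s) (Y s))) x‖ ^ 2 with hJ
  set G : ℝ → ℝ := fun s => ∫ x, densDeriv k (contRep hq (bmul (symB N s) (Y s)))
        (derivCoord hq1 i (bmul (symB N s) (Y s))) x *
        ((starRingEnd ℂ) (contRep hq (bmul (symB N s) (Y s)) x) *
          conformalPart s i (contRep hq (bmul (symB N s) (Y s)))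
            (derivCoord hq1 i (bmul (symB N s) (Y s))) x).re with hG
  obtain ⟨K, hK0, hK⟩ := exists_norm_modSub_interactionField_le hq hY
  obtain ⟨C, hC0, hC⟩ := exists_norm_modSub_le hq hY h0
  -- The time derivative of `b⁻² ‖(e^{2πi b xᵢ} - 1) e^{-isΔ}ψ(s)‖²`.
  set f : ℝ → ℝ → ℝ := fun b s => (b ^ 2)⁻¹ * (2 * (inner ℂ (modSub b i (ofCoord q
    (interactionField hq (k + 1) lam s (Y s)))) (modSub b i (ofCoord q (Y s)))).re) with hf
  have hsub : uIoc 0 t ⊆ Icc 0 T := by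
    rw [uIoc_of_le ht.1]
    exact Ioc_subset_Icc_self.trans (Icc_subset_Icc_right ht.2)
  have flim : ∀ s ∈ Icc 0 T, Tendsto (fun b => f b s) (𝓝[≠] 0)
      (𝓝 (4 * Real.pi ^ 2 * (4 * lam * (s * G s)))) := by
    intro s hs
    have h := (tendsto_boost_interaction hq hq1 s i (bmul (symB N s) (Y s)) k (hx s hs)).const_mul
      (-2 * lam)
    have e : 4 * Real.pi ^ 2 * (4 * lam * (s * G s))
        = -2 * lam * (-(8 * Real.pi ^ 2 * s) * G s) := by ring
    rw [e]
    refine h.congr fun b => ?_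
    rw [hf]
    simp only
    rw [re_inner_modSub]
    ring
  -- Both entries of the inner product are `O(|b|)` uniformly in time, which compensates `b⁻²` and
  -- provides the dominating constant.
  have fbd : ∀ b ≠ 0, ∀ s ∈ Icc 0 T, ‖f b s‖ ≤ 2 * (K * C * C) := by
    intro b hb s hs
    have h1 := (Complex.abs_re_le_norm _).trans (norm_inner_le_norm (𝕜 := ℂ) (modSub b i (ofCoord q
      (interactionField hq (k + 1) lam s (Y s)))) (modSub b i (ofCoord q (Y s))))
    have h2 := hC s hs b
    have h3 := hK s hs b i
    rw [hf, norm_mul, norm_mul, norm_inv, norm_pow, Real.norm_eq_abs, Real.norm_eq_abs,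
      Real.norm_eq_abs, abs_two, inv_mul_le_iff₀ (by positivity)]
    have h4 : ‖modSub b i (ofCoord q (interactionField hq (k + 1) lam s (Y s)))‖
        * ‖modSub b i (ofCoord q (Y s))‖ ≤ (K * (C * |b|)) * (C * |b|) := by
      gcongr
      exact h3.trans (by gcongr)
    linarith
  have cY : ContinuousOn Y (Icc 0 T) := fun t ht => (hY t ht).continuousWithinAt
  have cf : ∀ b, ContinuousOn (f b) (Icc 0 T) := by
    intro b
    have c1 : ContinuousOn (fun t => modSub b i (ofCoord q (Y t))) (Icc 0 T) :=
      (modSub b i ∘L ofCoord q).continuous.comp_continuousOn cY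
    have c2 : ContinuousOn (fun t => modSub b i (ofCoord q
        (interactionField hq (k + 1) lam t (Y t))))
        (Icc 0 T) := (modSub b i ∘L ofCoord q).continuous.comp_continuousOn
      (continuousOn_interactionField hq _ lam cY)
    exact ((Complex.continuous_re.comp_continuousOn (c2.inner (𝕜 := ℂ) c1)).const_mul 2).const_mul _
  have fm : ∀ b, AEStronglyMeasurable (f b) (volume.restrict (uIoc 0 t)) := fun b =>
    ((cf b).mono hsub).aestronglyMeasurable measurableSet_uIoc
  have fI := intervalIntegral.tendsto_integral_filter_of_dominated_convergence (μ := volume)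
    (a := 0) (b := t) (l := 𝓝[≠] (0 : ℝ)) (F := f)
    (f := fun s => 4 * Real.pi ^ 2 * (4 * lam * (s * G s))) (fun _ => 2 * (K * C * C))
    (Eventually.of_forall fm)
    (by
      filter_upwards [self_mem_nhdsWithin] with b hb
      exact ae_of_all _ fun s hs => fbd b hb s (hsub hs))
    intervalIntegrable_const (ae_of_all _ fun s hs => flim s (hsub hs))
  -- Measurability and boundedness of the limit integrand are inherited from the approximations, so
  -- its continuity in time is never needed.
  have gm : AEStronglyMeasurable (fun s => 4 * Real.pi ^ 2 * (4 * lam * (s * G s)))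
      (volume.restrict (uIoc 0 t)) := by
    refine aestronglyMeasurable_of_tendsto_ae (𝓝[≠] (0 : ℝ)) fm ?_
    exact (ae_restrict_iff' measurableSet_uIoc).2 (ae_of_all _ fun s hs => flim s (hsub hs))
  have gb : ∀ s ∈ uIoc 0 t, ‖4 * Real.pi ^ 2 * (4 * lam * (s * G s))‖ ≤ 2 * (K * C * C) := by
    intro s hs
    refine le_of_tendsto (flim s (hsub hs)).norm ?_
    filter_upwards [self_mem_nhdsWithin] with b hb using fbd b hb s (hsub hs)
  have gI : IntervalIntegrable (fun s => 4 * Real.pi ^ 2 * (4 * lam * (s * G s))) volume 0 t := by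
    rw [intervalIntegrable_iff]
    have : IsFiniteMeasure (volume.restrict (uIoc 0 t)) := ⟨by simp [uIoc]⟩
    exact Integrable.of_bound gm (2 * (K * C * C)) ((ae_restrict_iff' measurableSet_uIoc).2 (ae_of_all _ gb))
  have hpi : (4 * Real.pi ^ 2 : ℝ) ≠ 0 := by positivity
  refine ⟨?_, ?_⟩
  · refine (gI.const_mul (4 * Real.pi ^ 2)⁻¹).congr fun s _ => ?_
    rw [inv_mul_cancel_left₀ hpi]
  · have hN : ∀ s ∈ Icc 0 T, Tendsto (fun b : ℝ => (b ^ 2)⁻¹ * ‖modSub b i (ofCoord q (Y s))‖ ^ 2)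
        (𝓝[≠] 0) (𝓝 (4 * Real.pi ^ 2 * J s)) := by
      intro s hs
      refine (tendsto_norm_boost_sub_quot hq hq1 s i (bmul (symB N s) (Y s)) (hx s hs)).congr
        fun b => ?_
      rw [norm_boost_sub_eq]
    have hlim := (hN t ht).sub (hN 0 h0T)
    have e := tendsto_nhds_unique (fI.congr fun b => ?_) hlim
    · rw [intervalIntegral.integral_const_mul, ← mul_sub] at e
      have := mul_left_cancel₀ hpi e
      linarith
    · rw [hf]
      simp only
      rw [intervalIntegral.integral_const_mul, norm_modSub_sq_eq hq b i hY ht, mul_sub]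

end

/-! ### Integrations by parts -/

namespace HasLpPartial

variable {i : Fin N} {u u' u'' : RSpace N → ℂ} {M : ℝ}

theorem memLp_densDeriv (hu : HasLpPartial 2 i u u') (cu : Continuous u) (bu : ∀ x, ‖u x‖ ≤ M)
    (k : ℕ) : MemLp (densDeriv k u u') 2 :=
  (hu.density_pow cu bu k).memLp_right.re

theorem memLp_conj_mul (cu : Continuous u) (bu : ∀ x, ‖u x‖ ≤ M)
    {w : RSpace N → ℂ} (hw : MemLp w 2) : MemLp (fun x => (starRingEnd ℂ) (u x) * w x) 2 :=
  hw.bdd_mul_two (by fun_prop) (M := M) (fun x => by simpa using bu x)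

/-- With `ρ = |u|²`, the integral of `∂ᵢ(xᵢ ρ · ρ^{k+1})` vanishes. Expanded, this derivative is
`(k+2)/(k+1)` times the integrand on the left plus `ρ^{k+2}`. -/
theorem integral_coord_mul_densDeriv (hu : HasLpPartial 2 i u u') (cu : Continuous u)
    (bu : ∀ x, ‖u x‖ ≤ M) (xu : MemLp (fun x => ((x i : ℝ) : ℂ) * u x) 2) (k : ℕ) :
    ∫ x, densDeriv k u u' x * (x i * ‖u x‖ ^ 2) =
      -((k + 1) / (k + 2)) * ∫ x, ‖u x‖ ^ (2 * (k + 2)) := by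
  have hM : 0 ≤ M := (norm_nonneg _).trans (bu 0)
  -- Boundedness of `u` absorbs all but one power of `|u|`, so the first moment of `u` suffices.
  have hp : ∀ n : ℕ, MemLp (fun x => ((x i : ℝ) : ℂ) * ((‖u x‖ ^ (2 * (n + 1)) : ℝ) : ℂ)) 2 := by
    intro n
    refine MemLp.of_le_mul (c := M ^ (2 * n + 1)) xu ?_ (ae_of_all _ fun x => ?_)
    · exact Continuous.aestronglyMeasurable (by fun_prop)
    · rw [norm_mul, norm_mul, Complex.norm_real (‖u x‖ ^ _), Real.norm_of_nonneg (by positivity),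
        show 2 * (n + 1) = 2 * n + 1 + 1 by ring, pow_succ _ (2 * n + 1)]
      have := pow_le_pow_left₀ (norm_nonneg _) (bu x) (2 * n + 1)
      calc _ = ‖u x‖ ^ (2 * n + 1) * (‖((x i : ℝ) : ℂ)‖ * ‖u x‖) := by ring
        _ ≤ _ := by gcongr
  have h1 := hu.density cu bu
  have h2 := hu.density_pow cu bu k
  have h3 := (coord_mul h1 h2 (by simpa using hp 0) (hp k)).integral_eq_zero
  have hr := hu.memLp_densDeriv cu bu k
  have hx0 : MemLp (fun x => x i * ‖u x‖ ^ 2) 2 := by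
    have := (hp 0).re
    simpa [← Complex.ofReal_pow, ← Complex.ofReal_mul] using this
  have i1 : Integrable fun x => densDeriv k u u' x * (x i * ‖u x‖ ^ 2) := hr.integrable_mul hx0
  have i2 : Integrable fun x => ‖u x‖ ^ (2 * (k + 2)) := by
    have := (h1.memLp_left.re).integrable_mul (h2.memLp_left.re)
    refine this.congr (ae_of_all _ fun x => ?_)
    simp only [Pi.mul_apply, RCLike.re_eq_complex_re, Complex.ofReal_re]
    ring
  have e : ∀ x, ((x i : ℝ) : ℂ) * ((‖u x‖ ^ 2 : ℝ) : ℂ) * (densDeriv k u u' x : ℂ)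
      + ((x i : ℝ) : ℂ) * ((‖u x‖ ^ (2 * (k + 1)) : ℝ) : ℂ) *
        ((2 * ((starRingEnd ℂ) (u x) * u' x).re : ℝ) : ℂ)
      + ((‖u x‖ ^ 2 : ℝ) : ℂ) * ((‖u x‖ ^ (2 * (k + 1)) : ℝ) : ℂ) =
      ((((k + 2) / (k + 1) : ℝ) * (densDeriv k u u' x * (x i * ‖u x‖ ^ 2))
        + ‖u x‖ ^ (2 * (k + 2)) : ℝ) : ℂ) := by
    intro x
    rw [← Complex.ofReal_mul, ← Complex.ofReal_mul, ← Complex.ofReal_mul, ← Complex.ofReal_mul,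
      ← Complex.ofReal_mul, ← Complex.ofReal_add, ← Complex.ofReal_add]
    congr 1
    unfold densDeriv
    field_simp
    ring
  simp only [e] at h3
  have h4 : (∫ x, (((k + 2) / (k + 1) : ℝ) * (densDeriv k u u' x * (x i * ‖u x‖ ^ 2))
        + ‖u x‖ ^ (2 * (k + 2)))) = 0 := by
    have := integral_ofReal (𝕜 := ℂ) (μ := volume) (f := fun x : RSpace N =>
      ((k + 2) / (k + 1) : ℝ) * (densDeriv k u u' x * (x i * ‖u x‖ ^ 2)) + ‖u x‖ ^ (2 * (k + 2)))
    exact Complex.ofReal_eq_zero.1 (this.symm.trans h3)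
  rw [integral_add (i1.const_mul _) i2, integral_const_mul] at h4
  have hk1 : (k + 1 : ℝ) ≠ 0 := by positivity
  have hk2 : (k + 2 : ℝ) ≠ 0 := by positivity
  field_simp at h4 ⊢
  linarith

/-- Pointwise, `Re(ū (xᵢ + 2is∂ᵢ)u) = xᵢ|u|² - 2s Im(ū ∂ᵢu)`; the first term is handled by
`integral_coord_mul_densDeriv`. -/
theorem integral_densDeriv_conformalPart (hu : HasLpPartial 2 i u u') (cu : Continuous u)
    (bu : ∀ x, ‖u x‖ ≤ M) (xu : MemLp (fun x => ((x i : ℝ) : ℂ) * u x) 2) (k : ℕ) (s : ℝ) :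
    ∫ x, densDeriv k u u' x * ((starRingEnd ℂ) (u x) * conformalPart s i u u' x).re =
      -((k + 1) / (k + 2)) * (∫ x, ‖u x‖ ^ (2 * (k + 2)))
      - 2 * s * ∫ x, densDeriv k u u' x * ((starRingEnd ℂ) (u x) * u' x).im := by
  rw [← hu.integral_coord_mul_densDeriv cu bu xu k, ← integral_const_mul, ← integral_sub]
  · congr 1
    ext x
    have : ((starRingEnd ℂ) (u x) * conformalPart s i u u' x).re
        = x i * ‖u x‖ ^ 2 - 2 * s * ((starRingEnd ℂ) (u x) * u' x).im := by
      rw [← Complex.normSq_eq_norm_sq, Complex.normSq_apply, conformalPart]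
      simp
      ring
    rw [this]
    ring
  · have h1 := (memLp_conj_mul cu bu xu).re
    refine ((hu.memLp_densDeriv cu bu k).integrable_mul h1).congr (ae_of_all _ fun x => ?_)
    simp only [Pi.mul_apply]
    congr 1
    rw [← Complex.normSq_eq_norm_sq, Complex.normSq_apply]
    simp
    ring
  · exact ((hu.memLp_densDeriv cu bu k).integrable_mul
      (memLp_conj_mul cu bu hu.memLp_right).im).const_mul _

/-- Integration by parts onto `|u|^{2k+2} ū`. When the derivative falls on `ū` the result is the
real function `|u|^{2k+2}|u'|²`, which the imaginary part discards. -/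
theorem im_integral_mul_second (hu : HasLpPartial 2 i u u') (hu' : HasLpPartial 2 i u' u'')
    (cu : Continuous u) (bu : ∀ x, ‖u x‖ ≤ M) (k : ℕ) :
    (∫ x, ((‖u x‖ ^ (2 * (k + 1)) : ℝ) : ℂ) * (starRingEnd ℂ) (u x) * u'' x).im =
      -∫ x, densDeriv k u u' x * ((starRingEnd ℂ) (u x) * u' x).im := by
  have hM : 0 ≤ M := (norm_nonneg _).trans (bu 0)
  have h1 := hu.density_pow cu bu k
  have h2 := mul_bdd (M := max (M ^ (2 * (k + 1))) M) h1 hu.conj (by fun_prop)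
    (fun x => by
      rw [Complex.norm_real, Real.norm_of_nonneg (by positivity)]
      exact (pow_le_pow_left₀ (norm_nonneg _) (bu x) _).trans (le_max_left _ _))
    (fun x => by simpa using Or.inr (bu x))
  have h3 := h2.integral_mul_eq hu'
  rw [h3, Complex.neg_im]
  congr 1
  have e := integral_im (𝕜 := ℂ) (h2.memLp_right.integrable_mul hu'.memLp_left)
  simp only [RCLike.im_eq_complex_im, Pi.mul_apply] at e
  rw [← e]
  congr 1
  ext x
  generalize densDeriv k u u' x = r
  generalize ‖u x‖ ^ (2 * (k + 1)) = p
  simp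
  ring

end HasLpPartial

/-! ### Time derivatives in `L²` -/

theorem bmul_add_left (m n : RSpace N →ᵇ ℂ) (f : L2Space N) :
    bmul (m + n) f = bmul m f + bmul n f := by
  apply Lp.ext
  filter_upwards [coeFn_bmul (m + n) f, coeFn_bmul m f, coeFn_bmul n f,
    Lp.coeFn_add (bmul m f) (bmul n f)] with x h1 h2 h3 h4
  rw [h1, h4, Pi.add_apply, h2, h3, BoundedContinuousFunction.add_apply, add_mul]

theorem bmul_smul_left (c : ℂ) (m : RSpace N →ᵇ ℂ) (f : L2Space N) :
    bmul (c • m) f = c • bmul m f := by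
  apply Lp.ext
  filter_upwards [coeFn_bmul (c • m) f, coeFn_bmul m f, Lp.coeFn_smul c (bmul m f)] with x h1 h2 h3
  rw [h1, h3, Pi.smul_apply, h2, BoundedContinuousFunction.smul_apply, smul_eq_mul, smul_eq_mul,
    mul_assoc]

theorem bmul_sub_left (m n : RSpace N →ᵇ ℂ) (f : L2Space N) :
    bmul (m - n) f = bmul m f - bmul n f := by
  rw [eq_sub_iff_add_eq, ← bmul_add_left, sub_add_cancel]

theorem bmul_sum_left {ι : Type*} (s : Finset ι) (m : ι → RSpace N →ᵇ ℂ) (f : L2Space N) :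
    bmul (∑ j ∈ s, m j) f = ∑ j ∈ s, bmul (m j) f :=
  map_sum (AddMonoidHom.mk' (fun m : RSpace N →ᵇ ℂ => bmul m f) fun m n => bmul_add_left m n f) m s

theorem Filter.Tendsto.bmul {ι : Type*} {l : Filter ι} {m : ι → RSpace N →ᵇ ℂ}
    {m₀ : RSpace N →ᵇ ℂ} {f : ι → L2Space N} {f₀ : L2Space N} (hm : Tendsto m l (𝓝 m₀))
    (hf : Tendsto f l (𝓝 f₀)) : Tendsto (fun n => bmul (m n) (f n)) l (𝓝 (bmul m₀ f₀)) := by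
  rw [tendsto_iff_norm_sub_tendsto_zero]
  have h1 : Tendsto (fun n => ‖m n - m₀‖ * ‖f n‖ + ‖m₀‖ * ‖f n - f₀‖) l (𝓝 0) := by
    simpa using ((tendsto_iff_norm_sub_tendsto_zero.1 hm).mul hf.norm).add
      ((tendsto_iff_norm_sub_tendsto_zero.1 hf).const_mul ‖m₀‖)
  refine squeeze_zero (fun _ => norm_nonneg _) (fun n => ?_) h1
  have e : _root_.bmul (m n) (f n) - _root_.bmul m₀ f₀
      = _root_.bmul (m n - m₀) (f n) + _root_.bmul m₀ (f n - f₀) := by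
    rw [bmul_sub_left, map_sub]; abel
  rw [e]
  exact (norm_add_le _ _).trans (add_le_add (norm_bmul_le _ _) (norm_bmul_le _ _))

/-- The pointwise identity `p(s)f(s) - p(t)f(t) = p(s)(f(s) - f(t)) + f(t)(p(s) - p(t))` asks only
for continuity of `p` in the supremum norm, while differentiability of `p` is used in `L²`, through
its class `g`. In this way powers of `ψ` can be differentiated. -/
theorem hasDerivWithinAt_bmul_mul {p u : ℝ → RSpace N →ᵇ ℂ} {f g : ℝ → L2Space N}
    {f' g' : L2Space N} {S : Set ℝ} {t : ℝ} (cp : ContinuousWithinAt p S t)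
    (hf : HasDerivWithinAt f f' S t) (hg : HasDerivWithinAt g g' S t)
    (ef : ∀ s, f s =ᵐ[volume] u s) (eg : ∀ s, g s =ᵐ[volume] p s) :
    HasDerivWithinAt (fun s => bmul (p s) (f s)) (bmul (p t) f' + bmul (u t) g') S t := by
  rw [hasDerivWithinAt_iff_tendsto_slope] at hf hg ⊢
  have cp' : Tendsto p (𝓝[S \ {t}] t) (𝓝 (p t)) := cp.mono_left (nhdsWithin_mono _ sdiff_subset)
  have h := (cp'.bmul hf).add (((bmul (u t)).continuous.tendsto _).comp hg)
  refine h.congr fun s => ?_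
  have e : bmul (p s) (f s) - bmul (p t) (f t)
      = bmul (p s) (f s - f t) + bmul (u t) (g s - g t) := by
    apply Lp.ext
    filter_upwards [Lp.coeFn_sub (bmul (p s) (f s)) (bmul (p t) (f t)),
      Lp.coeFn_add (bmul (p s) (f s - f t)) (bmul (u t) (g s - g t)), coeFn_bmul (p s) (f s),
      coeFn_bmul (p t) (f t), coeFn_bmul (p s) (f s - f t), coeFn_bmul (u t) (g s - g t),
      Lp.coeFn_sub (f s) (f t), Lp.coeFn_sub (g s) (g t), ef t, eg s, eg t]
      with x h1 h2 h3 h4 h5 h6 h7 h8 h9 h10 h11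
    rw [h1, h2, Pi.sub_apply, Pi.add_apply, h3, h4, h5, h6, h7, h8, Pi.sub_apply, Pi.sub_apply,
      h9, h10, h11]
    ring
  have e2 : ∀ (L : L2Space N →L[ℂ] L2Space N) (c : ℝ) v, L (c • v) = c • L v :=
    fun L c v => (L.restrictScalars ℝ).map_smul c v
  simp only [Function.comp_apply, slope_def_module, e2, ← smul_add, e]

theorem norm_symB_sub_one_le (h : ℝ) (ξ : RSpace N) :
    ‖symB N h ξ - 1‖ ≤ |h| * (2 * Real.pi) ^ 2 * ‖ξ‖ ^ 2 := by
  have := Real.norm_exp_I_mul_ofReal_sub_one_le (x := -(h * (2 * Real.pi * ‖ξ‖) ^ 2))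
  rw [symB_apply, schrodingerSymbol, mul_comm]
  refine this.trans_eq ?_
  rw [Real.norm_eq_abs, abs_neg, abs_mul, abs_of_nonneg (sq_nonneg (2 * Real.pi * ‖ξ‖))]
  ring

theorem hasDerivAt_symB_zero (ξ : RSpace N) :
    HasDerivAt (fun h : ℝ => symB N h ξ) (-(Complex.I * (((2 * Real.pi * ‖ξ‖) ^ 2 : ℝ) : ℂ))) 0 := by
  have h1 : HasDerivAt (fun h : ℝ => -(h * (2 * Real.pi * ‖ξ‖) ^ 2))
      (-((2 * Real.pi * ‖ξ‖) ^ 2)) 0 := by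
    refine ((hasDerivAt_id (0 : ℝ)).mul_const ((2 * Real.pi * ‖ξ‖) ^ 2)).neg.congr_deriv ?_
    simp
  have h2 := (h1.ofReal_comp.mul_const Complex.I).cexp
  refine h2.congr_deriv ?_
  simp
  ring

section

variable {q : ℕ}

theorem sum_derivWeight_two (h2 : 2 ≤ q) (ξ : RSpace N) :
    ∑ i, derivWeight h2 i ξ = -((((2 * Real.pi * ‖ξ‖) ^ 2 : ℝ) : ℂ)) * invWeight N q ξ := by
  simp only [derivWeight_apply, ← Finset.sum_mul]
  congr 1
  rw [mul_pow, EuclideanSpace.norm_sq_eq]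
  simp only [mul_pow, Complex.I_sq, Real.norm_eq_abs, sq_abs]
  push_cast
  rw [← Finset.mul_sum]
  ring

/-- The quotient of the symbol is at most `(2π)²|ξ|²`, which the weight of order `q ≥ 2` absorbs;
strong convergence of multipliers then gives a derivative in `L²`, though not in `H^q`. -/
theorem hasDerivAt_free (h2 : 2 ≤ q) (t : ℝ) (Z : L2Space N) :
    HasDerivAt (fun s => ofCoord q (bmul (symB N s) Z))
      (Complex.I • ∑ i, derivCoord h2 i (bmul (symB N t) Z)) t := by
  set B := bmul (symB N t) Z with hB
  set m' : RSpace N →ᵇ ℂ := Complex.I • ∑ i, derivWeight h2 i with hm'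
  have hm'x : ∀ ξ, m' ξ =
      -(Complex.I * (((2 * Real.pi * ‖ξ‖) ^ 2 : ℝ) : ℂ)) * invWeight N q ξ := by
    intro ξ
    have : m' ξ = Complex.I * ∑ i, derivWeight h2 i ξ := by
      rw [hm', BoundedContinuousFunction.smul_apply, smul_eq_mul]
      congr 1
      exact (congrFun (BoundedContinuousFunction.coe_sum _ _) ξ).trans (Finset.sum_apply _ _ _)
    rw [this, sum_derivWeight_two]
    ring
  set M : ℝ → RSpace N →ᵇ ℂ :=
    fun h => ((h⁻¹ : ℝ) : ℂ) • ((symB N h - 1) * invWeight N q) with hM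
  have hMx : ∀ h ξ, M h ξ = ((h⁻¹ : ℝ) : ℂ) * ((symB N h ξ - 1) * invWeight N q ξ) :=
    fun h ξ => rfl
  have key : Tendsto (fun h => bmul (M h) B) (𝓝[≠] 0) (𝓝 (bmul m' B)) := by
    refine tendsto_bmul (C := (2 * Real.pi) ^ 2) ?_ ?_ B
    · filter_upwards [self_mem_nhdsWithin] with h hh ξ
      have hh' : 0 < |h| := abs_pos.2 hh
      rw [hMx, norm_mul, norm_mul, Complex.norm_real, norm_inv, Real.norm_eq_abs,
        inv_mul_le_iff₀ hh', norm_invWeight, ← div_eq_mul_inv, div_le_iff₀ (sobWeight_pos q ξ)]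
      refine (norm_symB_sub_one_le h ξ).trans ?_
      gcongr
      exact norm_pow_le_sobWeight h2 ξ
    · intro ξ
      rw [hm'x]
      refine ((hasDerivAt_symB_zero ξ).tendsto_slope_zero.mul_const (invWeight N q ξ)).congr
        fun h => ?_
      rw [hMx, zero_add, Complex.real_smul, symB_zero, mul_assoc]
      rfl
  rw [hasDerivAt_iff_tendsto_slope_zero]
  have h3 := ((Lp.fourierTransformₗᵢ (RSpace N) ℂ).symm.continuous.tendsto _).comp key
  have e1 : Complex.I • ∑ i, derivCoord h2 i B
      = (Lp.fourierTransformₗᵢ (RSpace N) ℂ).symm (bmul m' B) := by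
    rw [hm', bmul_smul_left, bmul_sum_left, map_smul, map_sum]
    rfl
  rw [e1]
  refine h3.congr fun h => ?_
  have e2 : bmul (M h) B = ((h⁻¹ : ℝ) : ℂ) •
      (bmul (invWeight N q) (bmul (symB N (t + h)) Z) - bmul (invWeight N q) (bmul (symB N t) Z)) := by
    rw [hM]
    simp only
    rw [bmul_smul_left, mul_comm, ← bmul_bmul, bmul_sub_left, bmul_one, hB, bmul_symB_symB,
      map_sub, add_comm t h]
  rw [Function.comp_apply, e2, map_smul, map_sub]
  rfl

variable (hq : (N : ℝ) / 2 < q) {η : ℕ} {lam T : ℝ} {Y : ℝ → L2Space N}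

/-- Writing `S(s)` for the symbol, `S(s)Y(s) - S(t)Y(t) = S(s)(Y(s) - Y(t)) + (S(s) - S(t))Y(t)`.
The first part converges by joint strong continuity, the second by `hasDerivAt_free`. -/
theorem hasDerivWithinAt_ofCoord_state (h2 : 2 ≤ q)
    (hY : ∀ t ∈ Icc 0 T, HasDerivWithinAt Y (interactionField hq η lam t (Y t)) (Icc 0 T) t)
    {t : ℝ} (ht : t ∈ Icc 0 T) :
    HasDerivWithinAt (fun s => ofCoord q (bmul (symB N s) (Y s)))
      (Complex.I • (∑ i, derivCoord h2 i (bmul (symB N t) (Y t))) -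
        (Complex.I * (lam : ℂ)) • ofCoord q (powCoord hq η (bmul (symB N t) (Y t)))) (Icc 0 T) t := by
  have h1 := (hasDerivAt_free h2 t (Y t)).hasDerivWithinAt (s := Icc 0 T)
  have h3 := hY t ht
  have e0 : bmul (symB N t) (interactionField hq η lam t (Y t)) =
      -((Complex.I * (lam : ℂ)) • powCoord hq η (bmul (symB N t) (Y t))) := by
    rw [interactionField, map_smul, bmul_symB_symB, add_neg_cancel, bmul_symB_zero, neg_smul]
  rw [hasDerivWithinAt_iff_tendsto_slope] at h1 h3 ⊢
  have hs : Tendsto (fun s : ℝ => s) (𝓝[Icc 0 T \ {t}] t) (𝓝 t) := nhdsWithin_le_nhds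
  have h4 := ((ofCoord q).continuous.tendsto _).comp (hs.bmul_symB h3)
  rw [e0, map_neg, map_smul] at h4
  rw [sub_eq_add_neg]
  refine (h1.add h4).congr fun s => ?_
  have e2 : ∀ (L : L2Space N →L[ℂ] L2Space N) (c : ℝ) v, L (c • v) = c • L v :=
    fun L c v => (L.restrictScalars ℝ).map_smul c v
  simp only [Function.comp_apply, slope_def_module, e2, ← smul_add, map_sub]
  congr 1
  abel

theorem hasDerivWithinAt_pow_state
    (hY : ∀ t ∈ Icc 0 T, HasDerivWithinAt Y (interactionField hq η lam t (Y t)) (Icc 0 T) t)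
    (n : ℕ) {t : ℝ} (ht : t ∈ Icc 0 T) {ψ' : L2Space N}
    (hψ : HasDerivWithinAt (fun s => ofCoord q (bmul (symB N s) (Y s))) ψ' (Icc 0 T) t) :
    HasDerivWithinAt (fun s => bmul (contRep hq (bmul (symB N s) (Y s)) ^ n)
      (ofCoord q (bmul (symB N s) (Y s))))
      (((n : ℂ) + 1) • bmul (contRep hq (bmul (symB N t) (Y t)) ^ n) ψ') (Icc 0 T) t := by
  induction n with
  | zero => simpa [bmul_one] using hψ
  | succ n ih =>
    have cp : ContinuousWithinAt (fun s => contRep hq (bmul (symB N s) (Y s))) (Icc 0 T) t :=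
      (contRep hq).continuous.continuousAt.comp_continuousWithinAt (continuousOn_state hq hY t ht)
    have h := hasDerivWithinAt_bmul_mul (u := fun s => contRep hq (bmul (symB N s) (Y s)) ^ (n + 1))
      cp ih hψ (fun s => ?_) (fun s => coeFn_ofCoord hq _)
    · simp only [bmul_bmul, map_smul, ← pow_succ'] at h
      refine h.congr_deriv ?_
      push_cast
      module
    · filter_upwards [coeFn_bmul (contRep hq (bmul (symB N s) (Y s)) ^ n)
        (ofCoord q (bmul (symB N s) (Y s))), coeFn_ofCoord hq (bmul (symB N s) (Y s))] with x e1 e2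
      rw [e1, e2]
      rfl

theorem norm_pow_state_sq (A : L2Space N) (n : ℕ) :
    ‖bmul (contRep hq A ^ n) (ofCoord q A)‖ ^ 2 = ∫ x, ‖contRep hq A x‖ ^ (2 * (n + 1)) := by
  have h := L2.inner_def (𝕜 := ℂ) (bmul (contRep hq A ^ n) (ofCoord q A))
    (bmul (contRep hq A ^ n) (ofCoord q A))
  have e : ∫ x, inner ℂ (bmul (contRep hq A ^ n) (ofCoord q A) x)
      (bmul (contRep hq A ^ n) (ofCoord q A) x)
      = ∫ x, ((‖contRep hq A x‖ ^ (2 * (n + 1)) : ℝ) : ℂ) := by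
    apply integral_congr_ae
    filter_upwards [coeFn_bmul (contRep hq A ^ n) (ofCoord q A), coeFn_ofCoord hq A] with x e1 e2
    rw [inner_self_eq_norm_sq_to_K, e1, e2]
    simp only [BoundedContinuousFunction.pow_apply, norm_mul, norm_pow]
    rw [← Complex.coe_algebraMap]
    push_cast
    simp
    ring
  have e2 := integral_ofReal (𝕜 := ℂ) (μ := volume)
    (f := fun x => ‖contRep hq A x‖ ^ (2 * (n + 1)))
  rw [← inner_self_eq_norm_sq (𝕜 := ℂ), h, e]
  exact (congrArg Complex.re e2).trans (Complex.ofReal_re _)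

theorem inner_pow_state (A W : L2Space N) (n : ℕ) :
    inner ℂ (bmul (contRep hq A ^ n) (ofCoord q A)) (bmul (contRep hq A ^ n) W) =
      ∫ x, ((‖contRep hq A x‖ ^ (2 * n) : ℝ) : ℂ) * (starRingEnd ℂ) (contRep hq A x) * W x := by
  rw [L2.inner_def]
  apply integral_congr_ae
  filter_upwards [coeFn_bmul (contRep hq A ^ n) (ofCoord q A), coeFn_ofCoord hq A,
    coeFn_bmul (contRep hq A ^ n) W] with x e1 e2 e3
  rw [e1, e2, e3, RCLike.inner_apply, BoundedContinuousFunction.pow_apply, pow_mul,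
    ← Complex.normSq_eq_norm_sq, Complex.ofReal_pow, ← Complex.mul_conj, map_mul, map_pow, mul_pow]
  ring

/-- The integrand is real. Thus the nonlinear term of the equation does not affect the time
derivative of the potential energy. -/
theorem im_inner_pow_state_nonlinearity (A : L2Space N) (n k : ℕ) :
    (inner ℂ (bmul (contRep hq A ^ n) (ofCoord q A))
      (bmul (contRep hq A ^ n) (ofCoord q (powCoord hq k A)))).im = 0 := by
  have e : ∫ x, ((‖contRep hq A x‖ ^ (2 * n) : ℝ) : ℂ) * (starRingEnd ℂ) (contRep hq A x) *
      ofCoord q (powCoord hq k A) x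
      = ∫ x, ((‖contRep hq A x‖ ^ (2 * n) * ‖contRep hq A x‖ ^ (2 * k) *
        Complex.normSq (contRep hq A x) : ℝ) : ℂ) := by
    apply integral_congr_ae
    filter_upwards [coeFn_ofCoord hq (powCoord hq k A)] with x e1
    rw [e1, contRep_powCoord, Complex.ofReal_mul, Complex.ofReal_mul, ← Complex.mul_conj]
    ring
  rw [inner_pow_state, e]
  have e2 := integral_ofReal (𝕜 := ℂ) (μ := volume) (f := fun x => ‖contRep hq A x‖ ^ (2 * n) *
    ‖contRep hq A x‖ ^ (2 * k) * Complex.normSq (contRep hq A x))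
  exact (congrArg Complex.im e2).trans (Complex.ofReal_im _)

/-- The evolution of the potential energy. -/
theorem hasDerivWithinAt_integral_pow (h2 : 2 ≤ q) {k : ℕ}
    (hY : ∀ t ∈ Icc 0 T, HasDerivWithinAt Y (interactionField hq (k + 1) lam t (Y t)) (Icc 0 T) t)
    {t : ℝ} (ht : t ∈ Icc 0 T) :
    HasDerivWithinAt (fun s => ∫ x, ‖contRep hq (bmul (symB N s) (Y s)) x‖ ^ (2 * (k + 2)))
      (2 * (k + 2) * ∑ i, ∫ x, densDeriv k (contRep hq (bmul (symB N t) (Y t)))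
        (derivCoord (one_le_two.trans h2) i (bmul (symB N t) (Y t))) x *
        ((starRingEnd ℂ) (contRep hq (bmul (symB N t) (Y t)) x) *
          derivCoord (one_le_two.trans h2) i (bmul (symB N t) (Y t)) x).im) (Icc 0 T) t := by
  have hψ := hasDerivWithinAt_ofCoord_state hq h2 hY ht
  -- The integral of `|ψ|^{2(k+2)}` is the squared `L²` norm of `ψ^{k+2} = ψ^{k+1} · ψ`, hence the
  -- exponent `k + 1`.
  have hp := hasDerivWithinAt_pow_state hq hY (k + 1) ht hψ
  have h1 := hp.inner ℂ hp
  have h3 := Complex.reCLM.hasFDerivAt.comp_hasDerivWithinAt t h1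
  have h4 : HasDerivWithinAt (fun s => ∫ x, ‖contRep hq (bmul (symB N s) (Y s)) x‖ ^ (2 * (k + 2)))
      _ (Icc 0 T) t := h3.congr (fun s _ => ?_) ?_
  · refine h4.congr_deriv ?_
    set A := bmul (symB N t) (Y t) with hA
    have hz : ∀ (c z : ℂ), (c * z + (starRingEnd ℂ) (c * z)).re = 2 * (c * z).re := fun c z => by
      rw [Complex.add_re, Complex.conj_re, two_mul]
    rw [← inner_conj_symm (((k + 1 : ℕ) + 1 : ℂ) • _), inner_smul_right, Complex.reCLM_apply, hz,
      map_sub, map_smul, map_smul, map_sum, inner_sub_right, inner_smul_right, inner_smul_right,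
      inner_sum, mul_assoc]
    have hc : (((k + 1 : ℕ) : ℂ) + 1) = ((k + 2 : ℝ) : ℂ) := by push_cast; ring
    rw [hc, Complex.re_ofReal_mul, Complex.sub_re, Complex.I_mul_re,
      Complex.I_mul_re, Complex.im_ofReal_mul, im_inner_pow_state_nonlinearity, Complex.im_sum,
      ← Finset.sum_neg_distrib]
    -- The second derivative coming from the Laplacian is removed by parts, so that the same
    -- integrals appear as in the evolution of the conformal field.
    have hi : ∀ i, -(inner ℂ (bmul (contRep hq A ^ (k + 1)) (ofCoord q A))
        (bmul (contRep hq A ^ (k + 1)) (derivCoord h2 i A))).im =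
        ∫ x, densDeriv k (contRep hq A) (derivCoord (one_le_two.trans h2) i A) x *
          ((starRingEnd ℂ) (contRep hq A x) *
            derivCoord (one_le_two.trans h2) i A x).im := by
      intro i
      rw [inner_pow_state, (hasLpPartial_contRep hq (one_le_two.trans h2) i A).im_integral_mul_second
        (hasLpPartial_derivCoord (k := 1) h2 i A) (contRep hq A).continuous
        (contRep hq A).norm_coe_le_norm k, neg_neg]
    simp only [hi]
    ring
  all_goals
    rw [Function.comp_apply, ← norm_pow_state_sq]
    exact (inner_self_eq_norm_sq (𝕜 := ℂ) _).symm
end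

/-! ### The pseudo-conformal law -/

/-- The pseudo-conformal conservation law. -/
theorem pseudoConformal_law {q : ℕ} (hq : (N : ℝ) / 2 < q) {lam T : ℝ} {Y : ℝ → L2Space N}
    (h2 : 2 ≤ q) {k : ℕ} (hk : (k + 1) * N = 2)
    (hY : ∀ t ∈ Icc 0 T, HasDerivWithinAt Y (interactionField hq (k + 1) lam t (Y t)) (Icc 0 T) t)
    (h0 : ∀ i, MemLp (fun x => ((x i : ℝ) : ℂ) * ofCoord q (Y 0) x) 2) {t : ℝ}
    (ht : t ∈ Icc 0 T) :
    (∑ i, ∫ x, ‖conformalPart t i (contRep hq (bmul (symB N t) (Y t)))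
        (derivCoord (one_le_two.trans h2) i (bmul (symB N t) (Y t))) x‖ ^ 2) +
      4 * t ^ 2 * lam / (k + 2) *
        ∫ x, ‖contRep hq (bmul (symB N t) (Y t)) x‖ ^ (2 * (k + 2)) =
    ∑ i, ∫ x, ‖conformalPart 0 i (contRep hq (bmul (symB N 0) (Y 0)))
        (derivCoord (one_le_two.trans h2) i (bmul (symB N 0) (Y 0))) x‖ ^ 2 := by
  have h1 : 1 ≤ q := one_le_two.trans h2
  set R : ℝ → ℝ := fun s => ∫ x, ‖contRep hq (bmul (symB N s) (Y s)) x‖ ^ (2 * (k + 2)) with hR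
  set K : Fin N → ℝ → ℝ := fun i s => ∫ x, densDeriv k (contRep hq (bmul (symB N s) (Y s)))
        (derivCoord h1 i (bmul (symB N s) (Y s))) x *
        ((starRingEnd ℂ) (contRep hq (bmul (symB N s) (Y s)) x) *
          derivCoord h1 i (bmul (symB N s) (Y s)) x).im with hK
  have hsub : uIcc 0 t ⊆ Icc 0 T := by
    rw [uIcc_of_le ht.1]
    exact Icc_subset_Icc_right ht.2
  have hv : ∀ i, ∀ s ∈ Icc 0 T, 4 * lam * (s * ∫ x, densDeriv k
        (contRep hq (bmul (symB N s) (Y s))) (derivCoord h1 i (bmul (symB N s) (Y s))) x *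
        ((starRingEnd ℂ) (contRep hq (bmul (symB N s) (Y s)) x) *
          conformalPart s i (contRep hq (bmul (symB N s) (Y s)))
            (derivCoord h1 i (bmul (symB N s) (Y s))) x).re)
      = 4 * lam * (s * (-((k + 1) / (k + 2)) * R s - 2 * s * K i s)) := by
    intro i s hs
    rw [(hasLpPartial_contRep hq h1 i _).integral_densDeriv_conformalPart
      (contRep hq _).continuous (contRep hq _).norm_coe_le_norm
      (memLp_coord_mul_contRep hq h1 hY (h0 i) hs) k s]
  -- The time derivative of the potential term `4s²λR(s)/(k+2)`.
  set E' : ℝ → ℝ := fun s => 4 * (2 * s) * lam / (k + 2) * R s +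
    4 * s ^ 2 * lam / (k + 2) * (2 * (k + 2) * ∑ i, K i s) with hE'
  have hNk : ((k : ℝ) + 1) * N = 2 := by exact_mod_cast hk
  have hk2 : (k + 2 : ℝ) ≠ 0 := by positivity
  -- The terms with `K` cancel identically. Those with `R` cancel because summing over the `N`
  -- directions produces `(k+1)N = 2`.
  have hsum : ∀ s, ∑ i, 4 * lam * (s * (-((k + 1) / (k + 2)) * R s - 2 * s * K i s)) = -E' s := by
    intro s
    rw [← Finset.mul_sum, ← Finset.mul_sum, Finset.sum_sub_distrib,
      Finset.sum_const, Finset.card_univ, Fintype.card_fin, nsmul_eq_mul, ← Finset.mul_sum, hE']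
    simp only
    field_simp
    linear_combination (-(lam * s * R s)) * hNk
  have hI : ∀ i, IntervalIntegrable
      (fun s => 4 * lam * (s * (-((k + 1) / (k + 2)) * R s - 2 * s * K i s))) volume 0 t :=
    fun i => (integral_norm_conformalPart_sq hq h1 hY (h0 i) ht).1.congr
      fun s hs => hv i s (hsub (uIoc_subset_uIcc hs))
  -- Integrability comes from the cancellation, since the summands are already known to be
  -- integrable in time.
  have hE'I : IntervalIntegrable E' volume 0 t := by
    have := (IntervalIntegrable.sum Finset.univ fun i _ => hI i).neg
    refine this.congr fun s _ => ?_
    simp only [Pi.neg_apply, Finset.sum_apply]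
    rw [hsum, neg_neg]
  have hd : ∀ s ∈ Icc 0 T, HasDerivWithinAt (fun s => 4 * s ^ 2 * lam / (k + 2) * R s)
      (E' s) (Icc 0 T) s := by
    intro s hs
    have e1 : HasDerivAt (fun s : ℝ => 4 * s ^ 2 * lam / (k + 2)) (4 * (2 * s) * lam / (k + 2)) s := by
      have := ((((hasDerivAt_id s).pow 2).const_mul 4).mul_const lam).div_const ((k : ℝ) + 2)
      refine this.congr_deriv ?_
      simp
    exact e1.hasDerivWithinAt.mul (hasDerivWithinAt_integral_pow hq h2 hY hs)
  have hFTC : ∫ s in (0 : ℝ)..t, E' s = 4 * t ^ 2 * lam / (k + 2) * R t := by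
    have hsub' : Icc 0 t ⊆ Icc 0 T := Icc_subset_Icc_right ht.2
    rw [intervalIntegral.integral_eq_sub_of_hasDeriv_right_of_le ht.1
      (fun s hs => ((hd s (hsub' hs)).continuousWithinAt).mono hsub') (fun s hs =>
        (hd s ⟨hs.1.le, hs.2.le.trans ht.2⟩).mono_of_mem_nhdsWithin
          (Icc_mem_nhdsGT_of_mem ⟨hs.1.le, hs.2.trans_le ht.2⟩)) hE'I]
    simp
  have hJ : ∀ i, ∫ x, ‖conformalPart t i (contRep hq (bmul (symB N t) (Y t)))
        (derivCoord h1 i (bmul (symB N t) (Y t))) x‖ ^ 2 =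
      (∫ x, ‖conformalPart 0 i (contRep hq (bmul (symB N 0) (Y 0)))
        (derivCoord h1 i (bmul (symB N 0) (Y 0))) x‖ ^ 2) +
      ∫ s in (0 : ℝ)..t, 4 * lam * (s * (-((k + 1) / (k + 2)) * R s - 2 * s * K i s)) := by
    intro i
    rw [(integral_norm_conformalPart_sq hq h1 hY (h0 i) ht).2]
    congr 1
    exact intervalIntegral.integral_congr fun s hs => hv i s (hsub hs)
  simp only [hJ]
  rw [Finset.sum_add_distrib, ← intervalIntegral.integral_finsetSum fun i _ => hI i]
  simp only [hsum]
  rw [intervalIntegral.integral_neg, hFTC]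
  ring

/-! ### Uniqueness of weak derivatives -/

theorem IsWeakPartial.ae_eq {F : Type*} [NormedAddCommGroup F] [NormedSpace ℝ F] [CompleteSpace F]
    {i : Fin N} {u v w : RSpace N → F} (hv : IsWeakPartial i u v) (hw : IsWeakPartial i u w) :
    v =ᵐ[volume] w := by
  refine ae_eq_of_integral_contDiff_smul_eq hv.2.1 hw.2.1 fun g hg hc => ?_
  exact neg_injective ((hv.2.2 g hg hc).symm.trans (hw.2.2 g hg hc))

theorem IsWeakPartial.weakPartial_ae_eq {F : Type*} [NormedAddCommGroup F] [NormedSpace ℝ F]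
    [CompleteSpace F] {i : Fin N} {u v : RSpace N → F} (hv : IsWeakPartial i u v) :
    IsWeakPartial i u (weakPartial i u) ∧ weakPartial i u =ᵐ[volume] v := by
  have h : ∃ v, IsWeakPartial i u v := ⟨v, hv⟩
  have e : weakPartial i u = h.choose := dif_pos h
  rw [e]
  exact ⟨h.choose_spec, h.choose_spec.ae_eq hv⟩

theorem IsWeakPartial.congr {F : Type*} [NormedAddCommGroup F] [NormedSpace ℝ F]
    {i : Fin N} {u v u' v' : RSpace N → F} (h : IsWeakPartial i u v) (hu : u =ᵐ[volume] u')
    (hv : v =ᵐ[volume] v') : IsWeakPartial i u' v' := by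
  refine ⟨(locallyIntegrable_congr hu).1 h.1, (locallyIntegrable_congr hv).1 h.2.1,
    fun φ hφ hc => ?_⟩
  have e1 : ∫ x, (fderiv ℝ φ x (EuclideanSpace.single i 1)) • u x
      = ∫ x, (fderiv ℝ φ x (EuclideanSpace.single i 1)) • u' x :=
    integral_congr_ae (hu.mono fun x hx => by simp only [hx])
  have e2 : ∫ x, φ x • v x = ∫ x, φ x • v' x :=
    integral_congr_ae (hv.mono fun x hx => by simp only [hx])
  rw [← e1, ← e2]
  exact h.2.2 φ hφ hc

theorem IsWeakPartial.re {i : Fin N} {u v : RSpace N → ℂ} (h : IsWeakPartial i u v) :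
    IsWeakPartial i (fun x => (u x).re) (fun x => (v x).re) := by
  have hl : ∀ {w : RSpace N → ℂ}, LocallyIntegrable w → LocallyIntegrable fun x => (w x).re :=
    fun hw x => let ⟨s, hs, hi⟩ := hw x; ⟨s, hs, hi.re⟩
  refine ⟨hl h.1, hl h.2.1, fun φ hφ hc => ?_⟩
  have e := congrArg Complex.re (h.2.2 φ hφ hc)
  have i1 : Integrable fun x => (fderiv ℝ φ x (EuclideanSpace.single i 1)) • u x :=
    h.1.integrable_smul_left_of_hasCompactSupport
      ((hφ.continuous_fderiv (by simp)).clm_apply continuous_const) (hc.fderiv_apply ℝ _)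
  have i2 : Integrable fun x => φ x • v x :=
    h.2.1.integrable_smul_left_of_hasCompactSupport hφ.continuous hc
  have r1 := integral_re (𝕜 := ℂ) i1
  have r2 := integral_re (𝕜 := ℂ) i2
  simp only [RCLike.re_eq_complex_re, Complex.smul_re] at r1 r2
  rw [Complex.neg_re, ← r1, ← r2] at e
  exact e

/-! ### Time integrals of weak derivatives -/

/-- Integration against a compactly supported continuous function, on `L¹`. -/
theorem exists_pairing {χ : RSpace N → ℝ} (hχ : Continuous χ) (hc : HasCompactSupport χ) :
    ∃ Λ : Lp ℂ 1 (volume : Measure (RSpace N)) →L[ℝ] ℂ, ∀ f, Λ f = ∫ x, χ x • f x := by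
  obtain ⟨C, hC⟩ := hc.exists_bound_of_continuous hχ
  have hi : ∀ f : Lp ℂ 1 (volume : Measure (RSpace N)), Integrable fun x => χ x • f x := fun f =>
    (memLp_one_iff_integrable.1 (Lp.memLp f)).bdd_smul C hχ.aestronglyMeasurable (ae_of_all _ hC)
  refine ⟨LinearMap.mkContinuous
    { toFun := fun f => ∫ x, χ x • f x
      map_add' := fun f g => ?_
      map_smul' := fun c f => ?_ } C fun f => ?_, fun f => rfl⟩
  · rw [← integral_add (hi f) (hi g)]
    refine integral_congr_ae ?_
    filter_upwards [Lp.coeFn_add f g] with x hx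
    rw [hx, Pi.add_apply, smul_add]
  · rw [RingHom.id_apply, ← integral_smul]
    refine integral_congr_ae ?_
    filter_upwards [Lp.coeFn_smul c f] with x hx
    rw [hx, Pi.smul_apply, smul_comm]
  · simp only [LinearMap.coe_mk, AddHom.coe_mk]
    refine (norm_integral_le_integral_norm _).trans ?_
    rw [L1.norm_eq_integral_norm, ← integral_const_mul]
    refine integral_mono (hi f).norm ((memLp_one_iff_integrable.1 (Lp.memLp f)).norm.const_mul C)
      fun x => ?_
    rw [norm_smul]
    exact mul_le_mul_of_nonneg_right (hC x) (norm_nonneg _)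

/-- Testing against a fixed function is a bounded functional on `L¹`, so it commutes with the
Bochner integral and the defining identity integrates in time. -/
theorem isWeakPartial_intervalIntegral {i : Fin N} {a b : ℝ}
    {f g : ℝ → Lp ℂ 1 (volume : Measure (RSpace N))} (hf : IntervalIntegrable f volume a b)
    (hg : IntervalIntegrable g volume a b) (h : ∀ s ∈ uIcc a b, IsWeakPartial i (f s) (g s)) :
    IsWeakPartial i (∫ s in a..b, f s : Lp ℂ 1 (volume : Measure (RSpace N)))
      (∫ s in a..b, g s : Lp ℂ 1 (volume : Measure (RSpace N))) := by
  refine ⟨(Lp.memLp _).locallyIntegrable le_rfl, (Lp.memLp _).locallyIntegrable le_rfl,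
    fun φ hφ hc => ?_⟩
  obtain ⟨Λ, hΛ⟩ := exists_pairing hφ.continuous hc
  obtain ⟨Λ', hΛ'⟩ := exists_pairing
    (χ := fun x => fderiv ℝ φ x (EuclideanSpace.single i 1))
    ((hφ.continuous_fderiv (by simp)).clm_apply continuous_const) (hc.fderiv_apply ℝ _)
  rw [← hΛ, ← hΛ', ← Λ.intervalIntegral_comp_comm hg, ← Λ'.intervalIntegral_comp_comm hf,
    ← intervalIntegral.integral_neg]
  refine intervalIntegral.integral_congr fun s hs => ?_
  simp only [hΛ, hΛ']
  exact (h s hs).2.2 φ hφ hc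

/-- The time integral of continuous functions agrees with the time integral of their classes. -/
theorem coeFn_intervalIntegral {a b : ℝ} {f : ℝ → Lp ℂ 1 (volume : Measure (RSpace N))}
    {F : ℝ → RSpace N →ᵇ ℂ} (hf : IntervalIntegrable f volume a b)
    (hF : IntervalIntegrable F volume a b) (h : ∀ s ∈ uIcc a b, f s =ᵐ[volume] F s) :
    (∫ s in a..b, f s : Lp ℂ 1 (volume : Measure (RSpace N))) =ᵐ[volume]
      fun x => ∫ s in a..b, F s x := by
  -- The pointwise integral is the value of the Bochner integral in the supremum norm; the two
  -- Bochner integrals are then compared by testing.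
  have hev : ∀ x, ∫ s in a..b, F s x = (∫ s in a..b, F s) x := fun x =>
    (BoundedContinuousFunction.evalCLM ℝ x).intervalIntegral_comp_comm hF
  simp only [hev]
  refine ae_eq_of_integral_contDiff_smul_eq ((Lp.memLp _).locallyIntegrable le_rfl)
    (∫ s in a..b, F s).continuous.locallyIntegrable fun χ hχ hc => ?_
  obtain ⟨Λ, hΛ⟩ := exists_pairing hχ.continuous hc
  have hi : Integrable χ := hχ.continuous.integrable_of_hasCompactSupport hc
  have hi2 : ∀ G : RSpace N →ᵇ ℂ, Integrable fun x => χ x • G x := fun G =>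
    (hχ.continuous.smul G.continuous).integrable_of_hasCompactSupport hc.smul_right
  let Λ' : (RSpace N →ᵇ ℂ) →L[ℝ] ℂ := LinearMap.mkContinuous
    { toFun := fun G => ∫ x, χ x • G x
      map_add' := fun G H => by
        rw [← integral_add (hi2 G) (hi2 H)]
        simp only [BoundedContinuousFunction.add_apply, smul_add]
      map_smul' := fun c G => by
        rw [RingHom.id_apply, ← integral_smul]
        simp only [BoundedContinuousFunction.smul_apply, smul_comm c] } (∫ x, ‖χ x‖) fun G => by
      simp only [LinearMap.coe_mk, AddHom.coe_mk]
      refine (norm_integral_le_integral_norm _).trans ?_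
      rw [← integral_mul_const]
      refine integral_mono (hi2 G).norm (hi.norm.mul_const _) fun x => ?_
      rw [norm_smul]
      exact mul_le_mul_of_nonneg_left (G.norm_coe_le_norm x) (norm_nonneg _)
  have hΛ' : ∀ G, Λ' G = ∫ x, χ x • G x := fun G => rfl
  rw [← hΛ, ← hΛ', ← Λ.intervalIntegral_comp_comm hf, ← Λ'.intervalIntegral_comp_comm hF]
  refine intervalIntegral.integral_congr fun s hs => ?_
  simp only [hΛ, hΛ']
  exact integral_congr_ae ((h s hs).mono fun x hx => by simp only [hx])

/-! ### Densities in `L¹` -/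

theorem HasLpPartial.add {F : Type*} [NormedAddCommGroup F] [NormedSpace ℝ F] {p : ℝ≥0∞}
    (hp : 1 ≤ p) {i : Fin N} {u u' w w' : RSpace N → F} (hu : HasLpPartial p i u u')
    (hw : HasLpPartial p i w w') :
    HasLpPartial p i (fun x => u x + w x) (fun x => u' x + w' x) := by
  refine ⟨hu.memLp_left.add hw.memLp_left, hu.memLp_right.add hw.memLp_right, ?_⟩
  refine (tendsto_eLpNorm_add_zero hp
    (Eventually.of_forall fun t => (hu.aestronglyMeasurable_quot t).sub hu.memLp_right.1)
    (Eventually.of_forall fun t => (hw.aestronglyMeasurable_quot t).sub hw.memLp_right.1)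
    hu.tendsto hw.tendsto).congr fun t => ?_
  congr 1
  ext x
  simp only [Pi.sub_apply, smul_sub, smul_add]
  abel

/-- The function `conj f * g` in `L¹`. -/
def conjMul (f g : L2Space N) : Lp ℂ 1 (volume : Measure (RSpace N)) :=
  (ContinuousLinearMap.mul ℂ ℂ).holderL volume 2 2 1
    (ContinuousLinearMap.compLpL 2 volume (Complex.conjCLE : ℂ →L[ℝ] ℂ) f) g

theorem coeFn_conjMul (f g : L2Space N) :
    conjMul f g =ᵐ[volume] fun x => (starRingEnd ℂ) (f x) * g x := by
  filter_upwards [ContinuousLinearMap.coeFn_holder (r := 1) (ContinuousLinearMap.mul ℂ ℂ)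
    (ContinuousLinearMap.compLpL 2 volume (Complex.conjCLE : ℂ →L[ℝ] ℂ) f) g,
    ContinuousLinearMap.coeFn_compLpL (p := 2) (μ := volume) (Complex.conjCLE : ℂ →L[ℝ] ℂ) f]
    with x h1 h2
  rw [conjMul, ContinuousLinearMap.holderL_apply_apply, h1, h2]
  rfl

theorem ContinuousOn.conjMul {X : Type*} [TopologicalSpace X] {S : Set X} {f g : X → L2Space N}
    (hf : ContinuousOn f S) (hg : ContinuousOn g S) :
    ContinuousOn (fun x => _root_.conjMul (f x) (g x)) S := by
  have h1 : ContinuousOn (fun x => ContinuousLinearMap.compLpL 2 volume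
      (Complex.conjCLE : ℂ →L[ℝ] ℂ) (f x)) S :=
    (ContinuousLinearMap.compLpL 2 volume
      (Complex.conjCLE : ℂ →L[ℝ] ℂ)).continuous.comp_continuousOn hf
  exact (((ContinuousLinearMap.mul ℂ ℂ).holderL volume 2 2 1).continuous.comp_continuousOn
    h1).clm_apply hg

theorem HasLpPartial.conjMul {i : Fin N} {f f' g g' : L2Space N} (hf : HasLpPartial 2 i f f')
    (hg : HasLpPartial 2 i g g') :
    HasLpPartial 1 i (_root_.conjMul f g) (_root_.conjMul f g' + _root_.conjMul f' g :
      Lp ℂ 1 (volume : Measure (RSpace N))) := by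
  refine (hf.conj.mul_one hg).congr (coeFn_conjMul f g).symm ?_
  filter_upwards [coeFn_conjMul f g', coeFn_conjMul f' g,
    Lp.coeFn_add (_root_.conjMul f g') (_root_.conjMul f' g)] with x h1 h2 h3
  rw [h3, Pi.add_apply, h1, h2]

theorem HasLpPartial.isWeakPartial_smul {i : Fin N}
    {f g : Lp ℂ 1 (volume : Measure (RSpace N))} (h : HasLpPartial 1 i f g) (c : ℝ) :
    IsWeakPartial i (c • f : Lp ℂ 1 (volume : Measure (RSpace N)))
      (c • g : Lp ℂ 1 (volume : Measure (RSpace N))) :=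
  ((h.clm_comp (c • ContinuousLinearMap.id ℝ ℂ)).isWeakPartial (p' := ⊤)).congr
    (Lp.coeFn_smul c f).symm (Lp.coeFn_smul c g).symm

section

variable {q : ℕ} (h2 : 2 ≤ q) (i : Fin N) (A : L2Space N)

/-- The density `|ψ|²`, in `L¹`. -/
def densL1 (q : ℕ) (A : L2Space N) : Lp ℂ 1 (volume : Measure (RSpace N)) :=
  conjMul (ofCoord q A) (ofCoord q A)

/-- The derivative `∂ᵢ|ψ|²`, in `L¹`. -/
def densL1Deriv : Lp ℂ 1 (volume : Measure (RSpace N)) :=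
  conjMul (ofCoord q A) (derivCoord (one_le_two.trans h2) i A)
    + conjMul (derivCoord (one_le_two.trans h2) i A) (ofCoord q A)

/-- The second derivative `∂ᵢ²|ψ|²`, in `L¹`. -/
def densL1Deriv2 : Lp ℂ 1 (volume : Measure (RSpace N)) :=
  (conjMul (ofCoord q A) (derivCoord h2 i A)
    + conjMul (derivCoord (one_le_two.trans h2) i A) (derivCoord (one_le_two.trans h2) i A))
  + (conjMul (derivCoord (one_le_two.trans h2) i A) (derivCoord (one_le_two.trans h2) i A)
    + conjMul (derivCoord h2 i A) (ofCoord q A))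

theorem hasLpPartial_ofCoord (h1 : 1 ≤ q) :
    HasLpPartial 2 i (ofCoord q A) (derivCoord h1 i A) := by
  have := hasLpPartial_derivCoord (k := 0) h1 i A
  rwa [derivCoord_zero] at this

theorem hasLpPartial_densL1 : HasLpPartial 1 i (densL1 q A) (densL1Deriv h2 i A) :=
  (hasLpPartial_ofCoord i A _).conjMul (hasLpPartial_ofCoord i A _)

theorem hasLpPartial_densL1Deriv :
    HasLpPartial 1 i (densL1Deriv h2 i A) (densL1Deriv2 h2 i A) := by
  have a := hasLpPartial_ofCoord i A (one_le_two.trans h2)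
  have b := hasLpPartial_derivCoord (k := 1) h2 i A
  exact ((a.conjMul b).add le_rfl (b.conjMul a)).congr (Lp.coeFn_add _ _).symm
    (Lp.coeFn_add _ _).symm

end

/-! ### The phase function -/

section

variable {q : ℕ} (hq : (N : ℝ) / 2 < q) {T : ℝ} {A : ℝ → L2Space N}

theorem coeFn_smul_densL1 (s : ℝ) (B : L2Space N) :
    (s • densL1 q B : Lp ℂ 1 (volume : Measure (RSpace N))) =ᵐ[volume]
      (s • (star (contRep hq B) * contRep hq B) : RSpace N →ᵇ ℂ) := by
  filter_upwards [Lp.coeFn_smul s (densL1 q B), coeFn_conjMul (ofCoord q B) (ofCoord q B),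
    coeFn_ofCoord hq B] with x h1 h2 h3
  rw [h1, Pi.smul_apply, densL1, h2, h3]
  rfl

theorem continuousOn_densBCF (hA : ContinuousOn A (Icc 0 T)) :
    ContinuousOn (fun s => (s • (star (contRep hq (A s)) * contRep hq (A s)) : RSpace N →ᵇ ℂ))
      (Icc 0 T) := by
  have c := (contRep hq).continuous.comp_continuousOn hA
  exact continuousOn_id.smul ((continuous_star.comp_continuousOn c).mul c)

theorem continuousOn_eval (hA : ContinuousOn A (Icc 0 T)) (x : RSpace N) :
    ContinuousOn (fun s => s * ‖contRep hq (A s) x‖ ^ 2) (Icc 0 T) := by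
  have c := (BoundedContinuousFunction.evalCLM ℂ x).continuous.comp_continuousOn
    ((contRep hq).continuous.comp_continuousOn hA)
  exact continuousOn_id.mul (c.norm.pow 2)

theorem isPhaseFunction_integral {ψ : ℝ → L2Space N} (hA : ContinuousOn A (Icc 0 T))
    (hψ : ∀ t ∈ Icc 0 T, ψ t = ofCoord q (A t)) :
    IsPhaseFunction T ψ (fun x t => ∫ s in (0 : ℝ)..t, s * ‖contRep hq (A s) x‖ ^ 2) := by
  refine ⟨fun t => contRep hq (A t), fun t ht => ⟨(contRep hq (A t)).continuous, ?_⟩,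
    ae_of_all _ fun x => ⟨by simp, fun t ht => ?_⟩⟩
  · rw [hψ t ht]
    exact (coeFn_ofCoord hq (A t)).symm
  · have hcF := continuousOn_eval hq hA x
    have : Fact (t ∈ Icc 0 T) := ⟨ht⟩
    apply intervalIntegral.integral_hasDerivWithinAt_right
    · refine (hcF.mono ?_).intervalIntegrable
      rw [uIcc_of_le ht.1]
      exact Icc_subset_Icc_right ht.2
    · exact hcF.stronglyMeasurableAtFilter_nhdsWithin measurableSet_Icc t
    · exact hcF t ht

/-- Two continuous representatives coincide everywhere, so for almost every `x` the derivative of `H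
x` is a known continuous function at every time, and the fundamental theorem of calculus determines
`H x`. -/
theorem IsPhaseFunction.ae_eq {ψ : ℝ → L2Space N} {H : RSpace N → ℝ → ℝ}
    (hH : IsPhaseFunction T ψ H) (hA : ContinuousOn A (Icc 0 T))
    (hψ : ∀ t ∈ Icc 0 T, ψ t = ofCoord q (A t)) {t : ℝ} (ht : t ∈ Icc 0 T) :
    (fun x => H x t) =ᵐ[volume] fun x => ∫ s in (0 : ℝ)..t, s * ‖contRep hq (A s) x‖ ^ 2 := by
  obtain ⟨φ, hφ, hx⟩ := hH
  have e : ∀ s ∈ Icc 0 T, φ s = contRep hq (A s) := fun s hs => by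
    refine ((hφ s hs).1.ae_eq_iff_eq volume (contRep hq (A s)).continuous).1 ?_
    refine (hφ s hs).2.trans ?_
    rw [hψ s hs]
    exact coeFn_ofCoord hq (A s)
  have hsub : Icc 0 t ⊆ Icc 0 T := Icc_subset_Icc_right ht.2
  filter_upwards [hx] with x ⟨h0, hd⟩
  have hd' : ∀ s ∈ Icc 0 T,
      HasDerivWithinAt (H x) (s * ‖contRep hq (A s) x‖ ^ 2) (Icc 0 T) s := fun s hs => by
    rw [← e s hs]
    exact hd s hs
  rw [intervalIntegral.integral_eq_sub_of_hasDeriv_right_of_le ht.1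
    (fun s hs => ((hd' s (hsub hs)).continuousWithinAt).mono hsub) (fun s hs =>
      (hd' s ⟨hs.1.le, hs.2.le.trans ht.2⟩).mono_of_mem_nhdsWithin
        (Icc_mem_nhdsGT_of_mem ⟨hs.1.le, hs.2.trans_le ht.2⟩)) ?_, h0, sub_zero]
  refine ((continuousOn_eval hq hA x).mono ?_).intervalIntegrable
  rwa [uIcc_of_le ht.1]

/-- The weak derivatives of the phase function. -/
theorem IsPhaseFunction.derivatives (hq : (N : ℝ) / 2 < q) {ψ : ℝ → L2Space N} {H : RSpace N → ℝ → ℝ} (h2 : 2 ≤ q)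
    (hH : IsPhaseFunction T ψ H) (hA : ContinuousOn A (Icc 0 T))
    (hψ : ∀ t ∈ Icc 0 T, ψ t = ofCoord q (A t)) {t : ℝ} (ht : t ∈ Icc 0 T) (i : Fin N) :
    ∃ v w : RSpace N → ℝ, IsWeakPartial i (fun x => H x t) v ∧ IsWeakPartial i v w ∧
      Integrable w ∧ ∫ x, w x = 0 := by
  have hsub : uIcc 0 t ⊆ Icc 0 T := by
    rw [uIcc_of_le ht.1]
    exact Icc_subset_Icc_right ht.2
  have cψ : ContinuousOn (fun s => ofCoord q (A s)) (uIcc 0 t) :=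
    (ofCoord q).continuous.comp_continuousOn (hA.mono hsub)
  have cd : ContinuousOn (fun s => derivCoord (one_le_two.trans h2) i (A s)) (uIcc 0 t) :=
    (derivCoord _ i).continuous.comp_continuousOn (hA.mono hsub)
  have cdd : ContinuousOn (fun s => derivCoord h2 i (A s)) (uIcc 0 t) :=
    (derivCoord _ i).continuous.comp_continuousOn (hA.mono hsub)
  have I0 : IntervalIntegrable (fun s => s • densL1 q (A s)) volume 0 t :=
    (continuousOn_id.smul (cψ.conjMul cψ)).intervalIntegrable
  have I1 : IntervalIntegrable (fun s => s • densL1Deriv h2 i (A s)) volume 0 t :=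
    (continuousOn_id.smul ((cψ.conjMul cd).add (cd.conjMul cψ))).intervalIntegrable
  have I2 : IntervalIntegrable (fun s => s • densL1Deriv2 h2 i (A s)) volume 0 t :=
    (continuousOn_id.smul (((cψ.conjMul cdd).add (cd.conjMul cd)).add
      ((cd.conjMul cd).add (cdd.conjMul cψ)))).intervalIntegrable
  -- Differentiating under the time integral in `L¹` avoids any pointwise second derivatives of `ψ`.
  have w1 := isWeakPartial_intervalIntegral I0 I1
    fun s _ => (hasLpPartial_densL1 h2 i (A s)).isWeakPartial_smul s
  have w2 := isWeakPartial_intervalIntegral I1 I2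
    fun s _ => (hasLpPartial_densL1Deriv h2 i (A s)).isWeakPartial_smul s
  set W2 : Lp ℂ 1 (volume : Measure (RSpace N)) := ∫ s in (0 : ℝ)..t, s • densL1Deriv2 h2 i (A s)
    with hW2
  have hi : Integrable W2 := memLp_one_iff_integrable.1 (Lp.memLp W2)
  refine ⟨_, _, w1.re.congr ?_ EventuallyEq.rfl, w2.re, hi.re, ?_⟩
  · have hB := coeFn_intervalIntegral I0
      ((continuousOn_densBCF hq hA).mono hsub).intervalIntegrable
      (fun s _ => coeFn_smul_densL1 hq s (A s))
    refine EventuallyEq.trans ?_ (hH.ae_eq hq hA hψ ht).symm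
    filter_upwards [hB] with x hx
    rw [hx]
    have e : ∀ s : ℝ, (s • (star (contRep hq (A s)) * contRep hq (A s)) : RSpace N →ᵇ ℂ) x
        = ((s * ‖contRep hq (A s) x‖ ^ 2 : ℝ) : ℂ) := by
      intro s
      have : (s • (star (contRep hq (A s)) * contRep hq (A s)) : RSpace N →ᵇ ℂ) x
        = s • ((starRingEnd ℂ) (contRep hq (A s) x) * contRep hq (A s) x) := rfl
      rw [this, mul_comm, Complex.mul_conj, Complex.normSq_eq_norm_sq, Complex.real_smul,
        ← Complex.ofReal_mul]
    simp only [e]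
    rw [intervalIntegral.integral_ofReal, Complex.ofReal_re]
  · have hz : ∫ x, W2 x = 0 := by
      rw [← L1.integral_eq_integral, L1.integral_eq, hW2,
        ← ContinuousLinearMap.intervalIntegral_comp_comm _ I2]
      refine (intervalIntegral.integral_congr fun s _ => ?_).trans intervalIntegral.integral_zero
      simp only [map_smul]
      rw [← L1.integral_eq, L1.integral_eq_integral,
        (hasLpPartial_densL1Deriv h2 i (A s)).integral_eq_zero, smul_zero]
    have := integral_re (𝕜 := ℂ) hi
    simp only [RCLike.re_eq_complex_re] at this
    rw [this, hz, Complex.zero_re]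

end

/-! ### The modified pseudo-conformal quantity -/

section

variable {q : ℕ} (hq : (N : ℝ) / 2 < q) {T : ℝ} {A : ℝ → L2Space N}

theorem pseudoConformalField_ae_eq (h1 : 1 ≤ q) (t : ℝ) (B : L2Space N) (i : Fin N) :
    (fun x => pseudoConformalField t (ofCoord q B) x i) =ᵐ[volume]
      conformalPart t i (contRep hq B) (derivCoord h1 i B) := by
  have hw := ((hasLpPartial_ofCoord i B h1).isWeakPartial (p' := 2)).weakPartial_ae_eq.2
  filter_upwards [hw, coeFn_ofCoord hq B] with x e1 e2
  simp only [pseudoConformalField, conformalPart]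
  rw [e1, e2]

/-- The derivative chosen by `weakPartial` agrees almost everywhere with any given weak derivative,
and weak differentiation ignores null sets, so the second choice is legitimate. -/
theorem divGrad_of_derivatives {h : RSpace N → ℝ}
    (hd : ∀ i, ∃ v w : RSpace N → ℝ, IsWeakPartial i h v ∧ IsWeakPartial i v w ∧
      Integrable w ∧ ∫ x, w x = 0) :
    (∀ i, ∃ v, IsWeakPartial i h v) ∧ (∀ i, ∃ w, IsWeakPartial i (weakPartial i h) w) ∧
      Integrable (divGrad h) ∧ ∫ x, divGrad h x = 0 := by
  choose v w hv hw hi h0 using hd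
  have hvw : ∀ i, IsWeakPartial i (weakPartial i h) (w i) := fun i =>
    (hw i).congr (hv i).weakPartial_ae_eq.2.symm EventuallyEq.rfl
  have he : ∀ i, weakPartial i (weakPartial i h) =ᵐ[volume] w i := fun i =>
    (hvw i).weakPartial_ae_eq.2
  have hi' : ∀ i, Integrable (weakPartial i (weakPartial i h)) := fun i => (hi i).congr (he i).symm
  refine ⟨fun i => ⟨v i, hv i⟩, fun i => ⟨w i, hvw i⟩, integrable_finsetSum _ fun i _ => hi' i, ?_⟩
  simp only [divGrad]
  rw [integral_finsetSum _ fun i _ => hi' i]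
  exact Finset.sum_eq_zero fun i _ => (integral_congr_ae (he i)).trans (h0 i)

/-- When `(k+1)N = 2`, the exponent `4/N + 2` is the even integer `2(k+2)` and `N/(N+2) = 1/(k+2)`;
the term with the phase function integrates to zero. -/
theorem pseudoConformal_eq {k : ℕ} (hk : (k + 1) * N = 2) (h1 : 1 ≤ q) (lam t : ℝ) (B : L2Space N)
    {h : RSpace N → ℝ} (hx : ∀ i, MemLp (fun x => ((x i : ℝ) : ℂ) * contRep hq B x) 2)
    (hd : ∀ i, ∃ v w : RSpace N → ℝ, IsWeakPartial i h v ∧ IsWeakPartial i v w ∧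
      Integrable w ∧ ∫ x, w x = 0) :
    PseudoConformalDefined t (ofCoord q B) h ∧
    pseudoConformal lam t (ofCoord q B) h =
      (∑ i, ∫ x, ‖conformalPart t i (contRep hq B) (derivCoord h1 i B) x‖ ^ 2) +
      4 * t ^ 2 * lam / (k + 2) * ∫ x, ‖contRep hq B x‖ ^ (2 * (k + 2)) := by
  have hNk : ((k : ℝ) + 1) * N = 2 := by exact_mod_cast hk
  have hN : (N : ℝ) ≠ 0 := fun h => by simp [h] at hNk
  have hexp : 4 / (N : ℝ) + 2 = ((2 * (k + 2) : ℕ) : ℝ) := by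
    push_cast
    field_simp
    linarith
  have hJ : ∀ i, MemLp (conformalPart t i (contRep hq B) (derivCoord h1 i B)) 2 := fun i =>
    memLp_conformalPart (hx i) (Lp.memLp _) t
  have hF : ∀ i, MemLp (fun x => pseudoConformalField t (ofCoord q B) x i) 2 := fun i =>
    (memLp_congr_ae (pseudoConformalField_ae_eq hq h1 t B i)).2 (hJ i)
  obtain ⟨d1, d2, d3, d4⟩ := divGrad_of_derivatives hd
  have hpow : (fun x => ‖ofCoord q B x‖ ^ (4 / (N : ℝ) + 2)) =ᵐ[volume]
      fun x => ‖contRep hq B x‖ ^ (2 * (k + 2)) := by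
    filter_upwards [coeFn_ofCoord hq B] with x e
    rw [e, hexp, Real.rpow_natCast]
  have hpi : Integrable fun x => ‖contRep hq B x‖ ^ (2 * (k + 2)) := by
    have h2 : MemLp (contRep hq B) 2 := memLp_contRep hq B
    have := h2.integrable_norm_pow (by norm_num : (2 : ℕ) ≠ 0)
    refine (this.bdd_mul (c := ‖contRep hq B‖ ^ (2 * (k + 1)))
      (f := fun x => ‖contRep hq B x‖ ^ (2 * (k + 1)))
      (Continuous.aestronglyMeasurable (by fun_prop)) (ae_of_all _ fun x => ?_)).congr
      (ae_of_all _ fun x => ?_)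
    · rw [norm_pow, norm_norm]
      exact pow_le_pow_left₀ (norm_nonneg _) ((contRep hq B).norm_coe_le_norm x) _
    · simp only
      ring
  refine ⟨⟨fun i => ⟨_, (hasLpPartial_ofCoord i B h1).isWeakPartial (p' := 2)⟩,
    MemLp.of_eval_piLp hF, hpi.congr hpow.symm, d1, d2, d3⟩, ?_⟩
  have hsq : ∫ x, ‖pseudoConformalField t (ofCoord q B) x‖ ^ 2 =
      ∑ i, ∫ x, ‖conformalPart t i (contRep hq B) (derivCoord h1 i B) x‖ ^ 2 := by
    simp only [EuclideanSpace.norm_sq_eq]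
    rw [integral_finsetSum _ fun i _ => (hF i).integrable_norm_pow (by norm_num : (2 : ℕ) ≠ 0)]
    refine Finset.sum_congr rfl fun i _ => integral_congr_ae ?_
    filter_upwards [pseudoConformalField_ae_eq hq h1 t B i] with x e
    rw [e]
  rw [pseudoConformal, hsq, d4, integral_congr_ae hpow]
  have hc : 4 * t ^ 2 * lam * N / (N + 2) = 4 * t ^ 2 * lam / (k + 2) := by
    have : (k + 2 : ℝ) ≠ 0 := by positivity
    have : (N + 2 : ℝ) ≠ 0 := by positivity
    field_simp
    linear_combination (t ^ 2 * lam) * hNk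
  rw [hc]
  ring

theorem sum_integral_conformalPart_zero (h1 : 1 ≤ q) (B : L2Space N)
    (hx : ∀ i, MemLp (fun x => ((x i : ℝ) : ℂ) * contRep hq B x) 2) :
    ∑ i, ∫ x, ‖conformalPart 0 i (contRep hq B) (derivCoord h1 i B) x‖ ^ 2
      = ∫ x, ‖x‖ ^ 2 * ‖ofCoord q B x‖ ^ 2 := by
  have e : ∀ i x, conformalPart 0 i (contRep hq B) (derivCoord h1 i B) x
      = ((x i : ℝ) : ℂ) * contRep hq B x := fun i x => by simp [conformalPart]
  simp only [e]
  rw [← integral_finsetSum _ fun i _ => (hx i).integrable_norm_pow (by norm_num : (2 : ℕ) ≠ 0)]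
  refine integral_congr_ae ?_
  filter_upwards [coeFn_ofCoord hq B] with x hx
  rw [hx, EuclideanSpace.norm_sq_eq, Finset.sum_mul]
  simp only [norm_mul, mul_pow, Complex.norm_real]

end

theorem memLp_coord_mul {f : L2Space N} (h : MemLp (fun x => (‖x‖ : ℂ) * f x) 2) (i : Fin N) :
    MemLp (fun x => ((x i : ℝ) : ℂ) * f x) 2 := by
  refine h.mono ?_ (ae_of_all _ fun x => ?_)
  · exact (by fun_prop : Continuous fun x : RSpace N => ((x i : ℝ) : ℂ)).aestronglyMeasurable.mul
      (Lp.aestronglyMeasurable f)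
  · rw [norm_mul, norm_mul, Complex.norm_real, Complex.norm_real, norm_norm]
    gcongr
    exact PiLp.norm_apply_le x i

end

/-! ### The main theorem -/

theorem theorem1p5 (N : ℕ) (hN : N = 1 ∨ N = 2) (η q : ℕ) (hη : 1 ≤ η) (hηq : η ≤ q)
    (hq : (N : ℝ) / 2 < q) (lam : ℝ) (ψ₀ : L2Space N)
    (hψ₀ : MemSobolev (q : ℝ) 2 (ψ₀ : 𝓢'(RSpace N, ℂ))) :
    -- existence of a solution on some `[0,T]`
    (∃ T : ℝ, 0 < T ∧ ∃ ψ : ℝ → L2Space N,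
      IsMildSolution η q lam ψ₀ T ψ ∧ InCSobolev q T ψ) ∧
    -- uniqueness on every `[0,T]`
    (∀ T : ℝ, 0 < T → ∀ ψ₁ ψ₂ : ℝ → L2Space N,
      IsMildSolution η q lam ψ₀ T ψ₁ → IsMildSolution η q lam ψ₀ T ψ₂ →
        ∀ t ∈ Icc 0 T, ψ₁ t = ψ₂ t) ∧
    -- the conservation law as long as the solution exists
    (η * N = 2 → MemLp (fun x => (‖x‖ : ℂ) * ψ₀ x) 2 (volume : Measure (RSpace N)) →
      ∀ T : ℝ, 0 < T → ∀ ψ : ℝ → L2Space N, IsMildSolution η q lam ψ₀ T ψ →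
        (∃ H : RSpace N → ℝ → ℝ, IsPhaseFunction T ψ H) ∧
        ∀ H : RSpace N → ℝ → ℝ, IsPhaseFunction T ψ H → ∀ t ∈ Icc 0 T,
          PseudoConformalDefined t (ψ t) (fun x => H x t) ∧
          pseudoConformal lam t (ψ t) (fun x => H x t)
            = pseudoConformal lam 0 (ψ 0) (fun x => H x 0) ∧
          pseudoConformal lam 0 (ψ 0) (fun x => H x 0) = ∫ x, ‖x‖ ^ 2 * ‖ψ₀ x‖ ^ 2) := by
  obtain ⟨A₀, rfl⟩ := MemSobolev.exists_ofCoord hψ₀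
  refine ⟨?_, fun T _ ψ₁ ψ₂ h₁ h₂ => isMildSolution_unique hq h₁ h₂, ?_⟩
  · obtain ⟨T, hT, Y, rfl, hY⟩ := exists_interaction_solution hq η lam A₀
    exact ⟨T, hT, _, isMildSolution_of_interaction hq η lam hY⟩
  intro hηN hx₀ T hT ψ hψ
  obtain ⟨Y, rfl, hY, hψY⟩ := hψ.exists_interaction hq
  obtain ⟨k, rfl⟩ : ∃ k, η = k + 1 := ⟨η - 1, by omega⟩
  -- For `N = 1` the relation `ηN = 2` gives `η = 2 ≤ q`; for `N = 2` the condition `q > N/2` gives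
  -- `q > 1`.
  have h2 : 2 ≤ q := by
    rcases hN with rfl | rfl
    · omega
    · have : (1 : ℝ) < q := by simpa using hq
      exact_mod_cast this
  have h1 : 1 ≤ q := one_le_two.trans h2
  have h0 := memLp_coord_mul hx₀
  have hA := continuousOn_state hq hY
  refine ⟨⟨_, isPhaseFunction_integral hq hA hψY⟩, fun H hH t ht => ?_⟩
  have h0T : (0 : ℝ) ∈ Icc 0 T := ⟨le_rfl, hT.le⟩
  have key := fun s hs => pseudoConformal_eq hq hηN h1 lam s (bmul (symB N s) (Y s))
    (fun i => memLp_coord_mul_contRep hq h1 hY (h0 i) hs)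
    (fun i => hH.derivatives hq h2 hA hψY hs i)
  have hP0 : pseudoConformal lam 0 (ψ 0) (fun x => H x 0) =
      ∑ i, ∫ x, ‖conformalPart 0 i (contRep hq (bmul (symB N 0) (Y 0)))
        (derivCoord h1 i (bmul (symB N 0) (Y 0))) x‖ ^ 2 := by
    rw [hψY 0 h0T, (key 0 h0T).2]
    -- At time zero the factor `t²` removes the potential term.
    simp
  refine ⟨?_, ?_, ?_⟩
  · rw [hψY t ht]
    exact (key t ht).1
  · rw [hP0, hψY t ht, (key t ht).2]
    exact pseudoConformal_law hq h2 hηN hY h0 ht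
  · rw [hP0, sum_integral_conformalPart_zero hq h1 _
      fun i => memLp_coord_mul_contRep hq h1 hY (h0 i) h0T, bmul_symB_zero]
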